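/- Let $M$ be a smooth ($C^\infty$), connected, paracompact, Hausdorff, finite-dimensional manifold. A spray on $M$ is a smooth vector field $S$ on the whole of $TM$ with $T\pi(S(v))=v$ for all $v\in TM$, where $\pi:TM\to M$ is the projection; equivalently, $S(x,y)=(x,y,y,Y(x,y))$ in local coordinates. It is homogeneous of degree $m\ge 0$ ($m$ real) if $[C,S]=(m-1)S$, where $C(v)=\frac{d}{dt}\big|_{t=1}(tv)$ is the Euler vector field. An $S$-geodesic is a curve $c$ in $M$, defined on an open interval, whose natural lift $\dot c$ to $TM$ is an integral curve of $S$. A spray $S$ is pseudoconvex if for each compact $K\subseteq M$ there is a compact $K'\subseteq M$ such that each $S$-geodesic segment with both endpoints in $K$ lies in $K'$. It is disprisoning if no nonconstant inextendible $S$-geodesic is contained in a compact subset of $M$. Fix any auxiliary Riemannian metric $h$ on $M$, with unit sphere bundle $UM\subset TM$. For each $m$, give the set $\mathcal S_m(M)$ of sprays homogeneous of degree $m$ the $C^0$-fine (Whitney) topology of the sections over $UM$, generated by the sets $\{S : S(UM)\subseteq O\}$ with $O$ open in $TTM$; give the set $\mathcal S_H(M)=\bigcup_m\mathcal S_m(M)$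 of all homogeneous sprays the weak topology, in which a set is open if and only if its intersection with each $\mathcal S_m(M)$ is open in $\mathcal S_m(M)$. Let $g$ be a smooth pseudoriemannian metric on $M$, of any signature, and let $S_g$ be its geodesic spray, given in local coordinates by $Y^k=-\Gamma^k_{ij}(x)y^iy^j$ with the Christoffel symbols $\Gamma^k_{ij}$ of $g$. If $S_g$ is pseudoconvex and disprisoning, then there is an open neighbourhood $W$ of $S_g$ in $\mathcal S_H(M)$ such that every $S\in W$ is pseudoconvex and disprisoning. -/

import Mathlib

open Bundle Set Topology
open scoped Manifold ContDiff

set_option maxSynthPendingDepth 3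

noncomputable section

/-- A smooth spray on `M`: a smooth vector field `S` on the tangent bundle `TM` which is a
second-order equation, i.e. the differential of the projection `π : TM → M` sends `S v` to `v`;
in local coordinates, `S (x, y) = (x, y, y, Y (x, y))`. -/
structure Spray (E : Type*) [NormedAddCommGroup E] [NormedSpace ℝ E]
    (M : Type*) [TopologicalSpace M] [ChartedSpace E M] [IsManifold 𝓘(ℝ, E) ∞ M] where
  toFun : (v : TangentBundle 𝓘(ℝ, E) M) → TangentSpace 𝓘(ℝ, E).tangent v
  smooth : ContMDiff 𝓘(ℝ, E).tangent 𝓘(ℝ, E).tangent.tangent ∞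
    (fun v ↦ (⟨v, toFun v⟩ : TangentBundle 𝓘(ℝ, E).tangent (TangentBundle 𝓘(ℝ, E) M)))
  second_order : ∀ v : TangentBundle 𝓘(ℝ, E) M,
    mfderiv 𝓘(ℝ, E).tangent 𝓘(ℝ, E) (fun w : TangentBundle 𝓘(ℝ, E) M ↦ w.proj) v (toFun v) = v.2

section
variable {E : Type*} [NormedAddCommGroup E] [NormedSpace ℝ E]
  {M : Type*} [TopologicalSpace M] [ChartedSpace E M] [IsManifold 𝓘(ℝ, E) ∞ M]

variable (E M) in
/-- The Euler (Liouville) vector field on `TM`: its value at `v` is the velocity at `t = 1` of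
the curve `t ↦ t • v`. -/
def eulerField (v : TangentBundle 𝓘(ℝ, E) M) : TangentSpace 𝓘(ℝ, E).tangent v :=
  mfderiv 𝓘(ℝ, ℝ) 𝓘(ℝ, E).tangent
    (fun t : ℝ ↦ (⟨v.proj, t • v.2⟩ : TangentBundle 𝓘(ℝ, E) M)) 1 (1 : ℝ)

/-- `S` is homogeneous of degree `m`: `0 ≤ m` and `[C, S] = (m - 1) S`, where `C` is the Euler
field. The degree may be any nonnegative real number. -/
def Spray.IsHomogeneous (S : Spray E M) (m : ℝ) : Prop :=
  0 ≤ m ∧ ∀ v, VectorField.mlieBracket 𝓘(ℝ, E).tangent (eulerField E M) S.toFun v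
    = (m - 1) • S.toFun v

/-- A pseudo-Riemannian metric on `M`: a smooth, symmetric and nondegenerate `(0, 2)` tensor
field, of arbitrary signature. -/
structure PseudoRiemannianMetric (E : Type*) [NormedAddCommGroup E] [NormedSpace ℝ E]
    (M : Type*) [TopologicalSpace M] [ChartedSpace E M] [IsManifold 𝓘(ℝ, E) ∞ M] where
  inner (x : M) : TangentSpace 𝓘(ℝ, E) x →L[ℝ] TangentSpace 𝓘(ℝ, E) x →L[ℝ] ℝ
  symm (x : M) (v w : TangentSpace 𝓘(ℝ, E) x) : inner x v w = inner x w v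
  nondegenerate (x : M) (v : TangentSpace 𝓘(ℝ, E) x) (hv : ∀ w, inner x v w = 0) : v = 0
  contMDiff : ContMDiff 𝓘(ℝ, E) (𝓘(ℝ, E).prod 𝓘(ℝ, E →L[ℝ] E →L[ℝ] ℝ)) ∞
    (fun x ↦ TotalSpace.mk' (E →L[ℝ] E →L[ℝ] ℝ)
      (E := fun x : M ↦ TangentSpace 𝓘(ℝ, E) x →L[ℝ] TangentSpace 𝓘(ℝ, E) x →L[ℝ] ℝ) x (inner x))

variable (E) in
/-- The differential of the preferred chart `φ` of `M` at `x`, at the point `p`. -/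
def chartDeriv (x p : M) : E →L[ℝ] E := mfderiv 𝓘(ℝ, E) 𝓘(ℝ, E) (extChartAt 𝓘(ℝ, E) x) p

/-- The differential of the inverse `φ⁻¹` of the preferred chart of `M` at `x`, at `z`. -/
def chartSymmDeriv (x : M) (z : E) : E →L[ℝ] E :=
  mfderiv 𝓘(ℝ, E) 𝓘(ℝ, E) (extChartAt 𝓘(ℝ, E) x).symm z

variable (E) in
/-- The local parametrization of `TM` given by the preferred chart `φ` of `M` at `x`: it sends
`(z, y)` to the tangent vector at `φ⁻¹ z` with coordinates `y`. -/
def tangentParam (x : M) (p : E × E) : TangentBundle 𝓘(ℝ, E) M :=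
  ⟨(extChartAt 𝓘(ℝ, E) x).symm p.1, chartSymmDeriv x p.1 p.2⟩

variable (E) in
/-- The coordinates on `TM` given by the preferred chart of `M` at `x`. -/
def tangentCoord (x : M) (v : TangentBundle 𝓘(ℝ, E) M) : E × E :=
  (extChartAt 𝓘(ℝ, E) x v.proj, chartDeriv E x v.proj v.2)

variable (E) in
/-- The differential of the parametrization of `TM` given by the preferred chart at `x`: it sends
coordinates `(Z, Y)` at `p = (z, y)` to a vector tangent to `TM` at `tangentParam E x p`. -/
def paramDeriv (x : M) (p : E × E) : E × E →L[ℝ] E × E :=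
  mfderiv 𝓘(ℝ, E × E) 𝓘(ℝ, E).tangent (tangentParam E x) p

namespace PseudoRiemannianMetric
variable (g : PseudoRiemannianMetric E M)

/-- The form `g_p`, the tangent space at `p` being the model space `E` as a vector space. -/
def form (p : M) : E →L[ℝ] E →L[ℝ] ℝ := g.inner p

/-- The coefficients of the metric in the preferred chart at `x`:
`g.coeff x z a b` is `g_{ij}(z) a^i b^j`. -/
def coeff (x : M) (z : E) : E →L[ℝ] E →L[ℝ] ℝ :=
  (g.form ((extChartAt 𝓘(ℝ, E) x).symm z)).bilinearComp (chartSymmDeriv x z) (chartSymmDeriv x z)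

/-- The vertical coefficient `Y` of the geodesic spray in the preferred chart at `x`:
`Y^k = - Γ^k_{ij}(z) y^i y^j`, that is, `g(Y, w) = (1/2) (∂_w g)(y, y) - (∂_y g)(y, w)`
for all `w`. -/
def accel (x : M) (z y : E) : E :=
  (g.coeff x z).inverse
    ((1 / 2 : ℝ) • ((fderiv ℝ (g.coeff x) z).flip y).flip y - fderiv ℝ (g.coeff x) z y y)

/-- The geodesic spray of `g` as a vector field on `TM`: in coordinates,
`S_g (x, y) = (x, y, y, - Γ(x) (y, y))`. -/
def geodesicField (v : TangentBundle 𝓘(ℝ, E) M) : TangentSpace 𝓘(ℝ, E).tangent v :=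
  let p : E × E := tangentCoord E v.proj v
  paramDeriv E v.proj p (p.2, g.accel v.proj p.1 p.2)

end PseudoRiemannianMetric

lemma contMDiffAt_tangentParam (x : M) {p : E × E} (hp : p.1 ∈ (extChartAt 𝓘(ℝ, E) x).target) :
    ContMDiffAt 𝓘(ℝ, E × E) 𝓘(ℝ, E).tangent ∞ (tangentParam E x) p := by
  have h1 := (contMDiffOn_extChartAt_symm (I := 𝓘(ℝ, E)) (n := ∞) x)
  have hU : IsOpen (extChartAt 𝓘(ℝ, E) x).target := isOpen_extChartAt_target x
  have h2 := h1.contMDiffOn_tangentMapWithin (m := ∞) (by simp) hU.uniqueMDiffOn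
  have h3 : ContMDiff 𝓘(ℝ, E × E) 𝓘(ℝ, E).tangent ∞
      (fun p : E × E ↦ (⟨p.1, p.2⟩ : TangentBundle 𝓘(ℝ, E) E)) := by
    intro q
    rw [Bundle.contMDiffAt_totalSpace]
    refine ⟨contDiff_fst.contMDiff.contMDiffAt, ?_⟩
    have : ContMDiffAt 𝓘(ℝ, E × E) 𝓘(ℝ, E) ∞ (fun p : E × E ↦ p.2) q :=
      contDiff_snd.contMDiff.contMDiffAt
    simpa using this
  have h4 := h2.contMDiffAt (x := (⟨p.1, p.2⟩ : TangentBundle 𝓘(ℝ, E) E))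
    ((hU.preimage (FiberBundle.continuous_proj E _)).mem_nhds hp)
  have h5 := h4.comp p h3.contMDiffAt
  refine h5.congr_of_eventuallyEq ?_
  filter_upwards [(hU.preimage continuous_fst).mem_nhds hp] with q hq
  have hq' : (extChartAt 𝓘(ℝ, E) x).target ∈ 𝓝 q.1 := hU.mem_nhds hq
  refine TotalSpace.ext rfl (heq_of_eq ?_)
  change chartSymmDeriv x q.1 q.2 = mfderivWithin 𝓘(ℝ, E) 𝓘(ℝ, E) (extChartAt 𝓘(ℝ, E) x).symm
    (extChartAt 𝓘(ℝ, E) x).target q.1 q.2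
  rw [mfderivWithin_of_mem_nhds hq']
  rfl

lemma mdifferentiableAt_chart_symm (x : M) {z : E} (hz : z ∈ (extChartAt 𝓘(ℝ, E) x).target) :
    MDifferentiableAt 𝓘(ℝ, E) 𝓘(ℝ, E) (extChartAt 𝓘(ℝ, E) x).symm z :=
  ((contMDiffOn_extChartAt_symm (I := 𝓘(ℝ, E)) (n := ∞) x).contMDiffAt
    ((isOpen_extChartAt_target x).mem_nhds hz)).mdifferentiableAt (by simp)

lemma chartSymmDeriv_chartDeriv (x : M) {p : M} (hp : p ∈ (extChartAt 𝓘(ℝ, E) x).source) (w : E) :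
    chartSymmDeriv x (extChartAt 𝓘(ℝ, E) x p) (chartDeriv E x p w) = w := by
  have h := mfderivWithin_extChartAt_symm_comp_mfderiv_extChartAt' (I := 𝓘(ℝ, E)) hp
  have h2 := congrArg (fun L ↦ L w) h
  simp only [modelWithCornersSelf_coe, range_id, mfderivWithin_univ] at h2
  exact h2

lemma chartDeriv_chartSymmDeriv (x : M) {z : E} (hz : z ∈ (extChartAt 𝓘(ℝ, E) x).target) (w : E) :
    chartDeriv E x ((extChartAt 𝓘(ℝ, E) x).symm z) (chartSymmDeriv x z w) = w := by
  have h := mfderiv_extChartAt_comp_mfderivWithin_extChartAt_symm (I := 𝓘(ℝ, E)) hz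
  have h2 := congrArg (fun L ↦ L w) h
  simp only [modelWithCornersSelf_coe, range_id, mfderivWithin_univ] at h2
  exact h2

lemma tangentParam_tangentCoord (x : M) {v : TangentBundle 𝓘(ℝ, E) M}
    (hv : v.proj ∈ (extChartAt 𝓘(ℝ, E) x).source) :
    tangentParam E x (tangentCoord E x v) = v := by
  refine TotalSpace.ext ((extChartAt 𝓘(ℝ, E) x).left_inv hv) ?_
  exact heq_of_eq (chartSymmDeriv_chartDeriv x hv v.2)

lemma tangentCoord_tangentParam (x : M) {p : E × E} (hp : p.1 ∈ (extChartAt 𝓘(ℝ, E) x).target) :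
    tangentCoord E x (tangentParam E x p) = p :=
  Prod.ext ((extChartAt 𝓘(ℝ, E) x).right_inv hp) (chartDeriv_chartSymmDeriv x hp p.2)

variable (E) in
/-- The change of coordinates from the preferred chart at `x` to that at `x'`. -/
def chartChange (x x' : M) : E → E := extChartAt 𝓘(ℝ, E) x' ∘ (extChartAt 𝓘(ℝ, E) x).symm

lemma contDiffAt_chartChange (x x' : M) {z : E} (hz : z ∈ (extChartAt 𝓘(ℝ, E) x).target)
    (hz' : (extChartAt 𝓘(ℝ, E) x).symm z ∈ (extChartAt 𝓘(ℝ, E) x').source) :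
    ContDiffAt ℝ ∞ (chartChange E x x') z := by
  rw [← contMDiffAt_iff_contDiffAt]
  have h1 := (contMDiffOn_extChartAt_symm (I := 𝓘(ℝ, E)) (n := ∞) x).contMDiffAt
    ((isOpen_extChartAt_target x).mem_nhds hz)
  rw [extChartAt_source] at hz'
  exact (contMDiffAt_extChartAt' (I := 𝓘(ℝ, E)) (n := ∞) hz').comp z h1

lemma eventually_overlap (x x' : M) {z : E} (hz : z ∈ (extChartAt 𝓘(ℝ, E) x).target)
    (hz' : (extChartAt 𝓘(ℝ, E) x).symm z ∈ (extChartAt 𝓘(ℝ, E) x').source) :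
    ∀ᶠ u in 𝓝 z, u ∈ (extChartAt 𝓘(ℝ, E) x).target ∧
      (extChartAt 𝓘(ℝ, E) x).symm u ∈ (extChartAt 𝓘(ℝ, E) x').source := by
  have h1 := (contMDiffOn_extChartAt_symm (I := 𝓘(ℝ, E)) (n := ∞) x).contMDiffAt
    ((isOpen_extChartAt_target x).mem_nhds hz)
  exact (Filter.Eventually.and ((isOpen_extChartAt_target x).mem_nhds hz)
    (h1.continuousAt ((isOpen_extChartAt_source x').mem_nhds hz')))

lemma chartSymmDeriv_change (x x' : M) {z : E} (hz : z ∈ (extChartAt 𝓘(ℝ, E) x).target)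
    (hz' : (extChartAt 𝓘(ℝ, E) x).symm z ∈ (extChartAt 𝓘(ℝ, E) x').source) (w : E) :
    chartSymmDeriv x z w =
      chartSymmDeriv x' (chartChange E x x' z) (fderiv ℝ (chartChange E x x') z w) := by
  have hd := ((contDiffAt_chartChange x x' hz hz').differentiableAt (by simp)).hasFDerivAt
  have h1 : (extChartAt 𝓘(ℝ, E) x).symm =ᶠ[𝓝 z]
      (extChartAt 𝓘(ℝ, E) x').symm ∘ chartChange E x x' := by
    filter_upwards [eventually_overlap x x' hz hz'] with u hu
    exact ((extChartAt 𝓘(ℝ, E) x').left_inv hu.2).symm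
  have hm : chartChange E x x' z ∈ (extChartAt 𝓘(ℝ, E) x').target :=
    (extChartAt 𝓘(ℝ, E) x').map_source hz'
  have h2 := ((mdifferentiableAt_chart_symm x' hm).hasMFDerivAt.comp z hd.hasMFDerivAt)
  have h3 := (h2.congr_of_eventuallyEq h1).mfderiv
  exact congrArg (fun L ↦ L w) h3

lemma tangentParam_change (x x' : M) {p : E × E} (hp : p.1 ∈ (extChartAt 𝓘(ℝ, E) x).target)
    (hp' : (extChartAt 𝓘(ℝ, E) x).symm p.1 ∈ (extChartAt 𝓘(ℝ, E) x').source) :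
    tangentParam E x p =
      tangentParam E x' (chartChange E x x' p.1, fderiv ℝ (chartChange E x x') p.1 p.2) :=
  TotalSpace.ext ((extChartAt 𝓘(ℝ, E) x').left_inv hp').symm
    (heq_of_eq (chartSymmDeriv_change x x' hp hp' p.2))

lemma contMDiffAt_tangentCoord (x : M) {v : TangentBundle 𝓘(ℝ, E) M}
    (hv : v.proj ∈ (extChartAt 𝓘(ℝ, E) x).source) :
    ContMDiffAt 𝓘(ℝ, E).tangent 𝓘(ℝ, E × E) ∞ (tangentCoord E x) v := by
  rw [contMDiffAt_prod_module_iff]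
  have hv' : v.proj ∈ (chartAt E x).source := by rwa [extChartAt_source] at hv
  constructor
  · exact (contMDiffAt_extChartAt' (I := 𝓘(ℝ, E)) (n := ∞) hv').comp v
      (contMDiff_proj (TangentSpace 𝓘(ℝ, E))).contMDiffAt
  · have h1 := contMDiffOn_extChartAt (I := 𝓘(ℝ, E)) (n := ∞) (x := x)
    have hU : IsOpen (chartAt E x).source := (chartAt E x).open_source
    have h2 := h1.contMDiffOn_tangentMapWithin (m := ∞) (by simp) hU.uniqueMDiffOn
    have h3 := h2.contMDiffAt (x := v)
      ((hU.preimage (FiberBundle.continuous_proj E _)).mem_nhds hv')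
    have h4 := (contMDiff_snd_tangentBundle_modelSpace (n := ∞) E 𝓘(ℝ, E)).contMDiffAt.comp v h3
    refine h4.congr_of_eventuallyEq ?_
    filter_upwards [(hU.preimage (FiberBundle.continuous_proj E _)).mem_nhds hv'] with q hq
    have hq' : (chartAt E x).source ∈ 𝓝 q.proj := hU.mem_nhds hq
    change chartDeriv E x q.proj q.2 =
      mfderivWithin 𝓘(ℝ, E) 𝓘(ℝ, E) (extChartAt 𝓘(ℝ, E) x) (chartAt E x).source q.proj q.2
    rw [mfderivWithin_of_mem_nhds hq']
    rfl

namespace PseudoRiemannianMetric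
variable (g : PseudoRiemannianMetric E M)

lemma coeff_apply (x : M) (z a b : E) :
    g.coeff x z a b = g.form ((extChartAt 𝓘(ℝ, E) x).symm z) (chartSymmDeriv x z a)
      (chartSymmDeriv x z b) := rfl

lemma coeff_change (x x' : M) {z : E} (hz : z ∈ (extChartAt 𝓘(ℝ, E) x).target)
    (hz' : (extChartAt 𝓘(ℝ, E) x).symm z ∈ (extChartAt 𝓘(ℝ, E) x').source) (a b : E) :
    g.coeff x z a b = g.coeff x' (chartChange E x x' z) (fderiv ℝ (chartChange E x x') z a)
      (fderiv ℝ (chartChange E x x') z b) := by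
  have h0 : (extChartAt 𝓘(ℝ, E) x').symm (chartChange E x x' z) =
    (extChartAt 𝓘(ℝ, E) x).symm z := (extChartAt 𝓘(ℝ, E) x').left_inv hz'
  rw [coeff_apply, coeff_apply, h0, ← chartSymmDeriv_change x x' hz hz',
    ← chartSymmDeriv_change x x' hz hz']

lemma form_symm (p : M) (a b : E) : g.form p a b = g.form p b a := g.symm p a b

lemma coeff_symm (x : M) (z a b : E) : g.coeff x z a b = g.coeff x z b a := by
  rw [coeff_apply, coeff_apply, form_symm]

lemma form_nondegenerate (p : M) (a : E) (ha : ∀ b, g.form p a b = 0) : a = 0 :=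
  g.nondegenerate p a ha

lemma coeff_nondegenerate (x : M) {z : E} (hz : z ∈ (extChartAt 𝓘(ℝ, E) x).target) (a : E)
    (ha : ∀ b, g.coeff x z a b = 0) : a = 0 := by
  have hs := (extChartAt 𝓘(ℝ, E) x).map_target hz
  have h0 : chartSymmDeriv x z a = 0 := g.form_nondegenerate _ _ (fun w ↦ by
    have h1 := ha (chartDeriv E x ((extChartAt 𝓘(ℝ, E) x).symm z) w)
    have h2 := chartSymmDeriv_chartDeriv x hs w
    rw [(extChartAt 𝓘(ℝ, E) x).right_inv hz] at h2
    rw [coeff_apply, h2] at h1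
    exact h1)
  rw [← chartDeriv_chartSymmDeriv x hz a, h0, map_zero]

lemma contDiffAt_coeff [FiniteDimensional ℝ E] (x : M) {z : E}
    (hz : z ∈ (extChartAt 𝓘(ℝ, E) x).target) :
    ContDiffAt ℝ ∞ (g.coeff x) z := by
  refine ContDiffOn.contDiffAt ?_ ((isOpen_extChartAt_target x).mem_nhds hz)
  refine contDiffOn_clm_apply.2 fun a ↦ contDiffOn_clm_apply.2 fun b z hz ↦ ?_
  refine ContDiffAt.contDiffWithinAt ?_
  have h1 := (contMDiffOn_extChartAt_symm (I := 𝓘(ℝ, E)) (n := ∞) x).contMDiffAt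
    ((isOpen_extChartAt_target x).mem_nhds hz)
  have key : ContDiffAt ℝ ∞ (fun u ↦ g.coeff x u a b) z := by
    rw [← contMDiffAt_iff_contDiffAt]
    have hs : ∀ c : E, ContMDiffAt 𝓘(ℝ, E) 𝓘(ℝ, E).tangent ∞
        (fun u : E ↦ tangentParam E x (u, c)) z := by
      intro c
      exact ContMDiffAt.comp (I' := 𝓘(ℝ, E × E)) z (contMDiffAt_tangentParam x (p := (z, c)) hz)
        (contDiff_prodMk_left c).contMDiff.contMDiffAt
    have hg := g.contMDiff.contMDiffAt.comp z h1
    have := ContMDiffAt.clm_bundle_apply₂ (F₁ := E) (F₂ := E) (F₃ := ℝ) (E₃ := Bundle.Trivial M ℝ)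
      hg (hs a) (hs b)
    rw [Bundle.contMDiffAt_totalSpace] at this
    exact this.2
  exact key

end PseudoRiemannianMetric

namespace PseudoRiemannianMetric
variable (g : PseudoRiemannianMetric E M) [FiniteDimensional ℝ E]

lemma exists_coeff_equiv (x : M) {z : E} (hz : z ∈ (extChartAt 𝓘(ℝ, E) x).target) :
    ∃ e : E ≃L[ℝ] (E →L[ℝ] ℝ), (e : E →L[ℝ] (E →L[ℝ] ℝ)) = g.coeff x z := by
  have hinj : Function.Injective (g.coeff x z : E →ₗ[ℝ] (E →L[ℝ] ℝ)) := by
    rw [injective_iff_map_eq_zero]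
    intro a ha
    exact g.coeff_nondegenerate x hz a (fun b ↦ congrArg (fun L : E →L[ℝ] ℝ ↦ L b) ha)
  have hdim : Module.finrank ℝ E = Module.finrank ℝ (E →L[ℝ] ℝ) := by
    rw [← (LinearMap.toContinuousLinearMap (𝕜 := ℝ) (E := E) (F' := ℝ)).finrank_eq]
    exact Subspace.dual_finrank_eq.symm
  refine ⟨(LinearEquiv.ofInjectiveOfFinrankEq _ hinj hdim).toContinuousLinearEquiv, ?_⟩
  ext a b
  rfl

lemma coeff_accel (x : M) {z : E} (hz : z ∈ (extChartAt 𝓘(ℝ, E) x).target) (y w : E) :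
    g.coeff x z (g.accel x z y) w = (1 / 2 : ℝ) * fderiv ℝ (g.coeff x) z w y y
      - fderiv ℝ (g.coeff x) z y y w := by
  obtain ⟨e, he⟩ := g.exists_coeff_equiv x hz
  rw [accel, ← he, ContinuousLinearMap.inverse_equiv]
  simp

lemma eq_accel (x : M) {z : E} (hz : z ∈ (extChartAt 𝓘(ℝ, E) x).target) (y Y : E)
    (h : ∀ w, g.coeff x z Y w = (1 / 2 : ℝ) * fderiv ℝ (g.coeff x) z w y y
      - fderiv ℝ (g.coeff x) z y y w) : g.accel x z y = Y := by
  refine sub_eq_zero.1 (g.coeff_nondegenerate x hz _ fun w ↦ ?_)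
  rw [map_sub, sub_apply, coeff_accel g x hz, h, sub_self]

lemma accel_smul (x : M) {z : E} (hz : z ∈ (extChartAt 𝓘(ℝ, E) x).target) (t : ℝ) (y : E) :
    g.accel x z (t • y) = t ^ 2 • g.accel x z y := by
  refine g.eq_accel x hz _ _ fun w ↦ ?_
  simp only [map_smul, smul_apply, smul_eq_mul, g.coeff_accel x hz]
  ring

lemma contDiffAt_accel (x : M) {p : E × E} (hp : p.1 ∈ (extChartAt 𝓘(ℝ, E) x).target) :
    ContDiffAt ℝ ∞ (fun p : E × E ↦ g.accel x p.1 p.2) p := by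
  obtain ⟨e, he⟩ := g.exists_coeff_equiv x hp
  have hG : ContDiffAt ℝ ∞ (fun p : E × E ↦ g.coeff x p.1) p :=
    (g.contDiffAt_coeff x hp).comp p contDiffAt_fst
  have hD : ContDiffAt ℝ ∞ (fun p : E × E ↦ fderiv ℝ (g.coeff x) p.1) p :=
    ((g.contDiffAt_coeff x hp).fderiv_right (m := ∞) (by simp)).comp p contDiffAt_fst
  have hI : ContDiffAt ℝ ∞ (fun p : E × E ↦ (g.coeff x p.1).inverse) p := by
    have h1 : ContDiffAt ℝ ∞ ContinuousLinearMap.inverse (g.coeff x p.1) := by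
      rw [← he]; exact contDiffAt_map_inverse e
    exact h1.comp p hG
  have hflip1 : ContDiff ℝ ∞ (fun L : E →L[ℝ] E →L[ℝ] E →L[ℝ] ℝ ↦ L.flip) :=
    (ContinuousLinearMap.flipₗᵢ ℝ E E (E →L[ℝ] ℝ)).toContinuousLinearEquiv.contDiff
  have hflip2 : ContDiff ℝ ∞ (fun L : E →L[ℝ] E →L[ℝ] ℝ ↦ L.flip) :=
    (ContinuousLinearMap.flipₗᵢ ℝ E E ℝ).toContinuousLinearEquiv.contDiff
  have hy : ContDiffAt ℝ ∞ (fun p : E × E ↦ p.2) p := contDiffAt_snd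
  have h2 := (hflip2.contDiffAt.comp p
    ((hflip1.contDiffAt.comp p hD).clm_apply hy)).clm_apply hy
  exact hI.clm_apply ((h2.const_smul (1 / 2 : ℝ)).sub ((hD.clm_apply hy).clm_apply hy))

lemma fderiv_coeff_change (x x' : M) {z : E} (hz : z ∈ (extChartAt 𝓘(ℝ, E) x).target)
    (hz' : (extChartAt 𝓘(ℝ, E) x).symm z ∈ (extChartAt 𝓘(ℝ, E) x').source) (c a b : E) :
    fderiv ℝ (g.coeff x) z c a b =
      fderiv ℝ (g.coeff x') (chartChange E x x' z) (fderiv ℝ (chartChange E x x') z c)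
        (fderiv ℝ (chartChange E x x') z a) (fderiv ℝ (chartChange E x x') z b)
      + g.coeff x' (chartChange E x x' z) (fderiv ℝ (fderiv ℝ (chartChange E x x')) z c a)
        (fderiv ℝ (chartChange E x x') z b)
      + g.coeff x' (chartChange E x x' z) (fderiv ℝ (chartChange E x x') z a)
        (fderiv ℝ (fderiv ℝ (chartChange E x x')) z c b) := by
  have hm : chartChange E x x' z ∈ (extChartAt 𝓘(ℝ, E) x').target :=
    (extChartAt 𝓘(ℝ, E) x').map_source hz'
  have hχ := contDiffAt_chartChange x x' hz hz'
  have h1 := (hχ.differentiableAt (by simp)).hasFDerivAt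
  have h2 := ((hχ.fderiv_right (m := ∞) (by simp)).differentiableAt (by simp)).hasFDerivAt
  have h3 := ((g.contDiffAt_coeff x' hm).differentiableAt (by simp)).hasFDerivAt
  have h4 := ((g.contDiffAt_coeff x hz).differentiableAt (by simp)).hasFDerivAt
  have e1 := (h4.clm_apply (hasFDerivAt_const a z)).clm_apply (hasFDerivAt_const b z)
  have e2 := ((h3.comp z h1).clm_apply (h2.clm_apply (hasFDerivAt_const a z))).clm_apply
    (h2.clm_apply (hasFDerivAt_const b z))
  have e3 := e1.unique (e2.congr_of_eventuallyEq (by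
    filter_upwards [eventually_overlap x x' hz hz'] with u hu
    exact g.coeff_change x x' hu.1 hu.2 a b))
  have e4 := congrArg (fun L : E →L[ℝ] ℝ ↦ L c) e3
  simp at e4
  linarith

lemma accel_change (x x' : M) {z : E} (hz : z ∈ (extChartAt 𝓘(ℝ, E) x).target)
    (hz' : (extChartAt 𝓘(ℝ, E) x).symm z ∈ (extChartAt 𝓘(ℝ, E) x').source) (y : E) :
    g.accel x' (chartChange E x x' z) (fderiv ℝ (chartChange E x x') z y) =
      fderiv ℝ (fderiv ℝ (chartChange E x x')) z y y
        + fderiv ℝ (chartChange E x x') z (g.accel x z y) := by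
  have hm : chartChange E x x' z ∈ (extChartAt 𝓘(ℝ, E) x').target :=
    (extChartAt 𝓘(ℝ, E) x').map_source hz'
  have hsurj : Function.Surjective (fderiv ℝ (chartChange E x x') z : E →ₗ[ℝ] E) := by
    rw [← LinearMap.injective_iff_surjective, injective_iff_map_eq_zero]
    intro a ha
    refine g.coeff_nondegenerate x hz a fun b ↦ ?_
    have ha' : fderiv ℝ (chartChange E x x') z a = 0 := ha
    rw [g.coeff_change x x' hz hz', ha', map_zero, zero_apply]
  have hsym : ∀ a b, fderiv ℝ (fderiv ℝ (chartChange E x x')) z a b =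
      fderiv ℝ (fderiv ℝ (chartChange E x x')) z b a :=
    (contDiffAt_chartChange x x' hz hz').isSymmSndFDerivAt
      (by simp only [minSmoothness_of_isRCLikeNormedField]; exact WithTop.coe_le_coe.2 le_top)
  refine g.eq_accel x' hm _ _ fun w' ↦ ?_
  obtain ⟨w, rfl⟩ := hsurj w'
  have e1 := g.fderiv_coeff_change x x' hz hz' w y y
  have e2 := g.fderiv_coeff_change x x' hz hz' y y w
  have e3 := g.coeff_accel x hz y w
  rw [g.coeff_change x x' hz hz'] at e3
  have e4 := g.coeff_symm x' (chartChange E x x' z) (fderiv ℝ (chartChange E x x') z y)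
    (fderiv ℝ (fderiv ℝ (chartChange E x x')) z w y)
  have e5 := hsym y w
  simp only [ContinuousLinearMap.coe_coe, map_add, add_apply]
  rw [e5] at e2
  linarith

end PseudoRiemannianMetric

set_option linter.unusedSectionVars false in
lemma mem_target_tangentCoord (x : M) {v : TangentBundle 𝓘(ℝ, E) M}
    (hv : v.proj ∈ (extChartAt 𝓘(ℝ, E) x).source) :
    (tangentCoord E x v).1 ∈ (extChartAt 𝓘(ℝ, E) x).target :=
  (extChartAt 𝓘(ℝ, E) x).map_source hv

lemma paramDeriv_change (x x' : M) {p : E × E} (hp : p.1 ∈ (extChartAt 𝓘(ℝ, E) x).target)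
    (hp' : (extChartAt 𝓘(ℝ, E) x).symm p.1 ∈ (extChartAt 𝓘(ℝ, E) x').source) (a b : E) :
    paramDeriv E x p (a, b) =
      paramDeriv E x' (tangentCoord E x' (tangentParam E x p))
        (fderiv ℝ (chartChange E x x') p.1 a,
          fderiv ℝ (fderiv ℝ (chartChange E x x')) p.1 a p.2
            + fderiv ℝ (chartChange E x x') p.1 b) := by
  have hm : chartChange E x x' p.1 ∈ (extChartAt 𝓘(ℝ, E) x').target :=
    (extChartAt 𝓘(ℝ, E) x').map_source hp'
  have hχ := contDiffAt_chartChange x x' hp hp'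
  have h1 := (hχ.differentiableAt (by simp)).hasFDerivAt
  have h2 := ((hχ.fderiv_right (m := ∞) (by simp)).differentiableAt (by simp)).hasFDerivAt
  have e1 := h1.comp p (hasFDerivAt_fst (p := p))
  have e2 := (h2.comp p (hasFDerivAt_fst (p := p))).clm_apply (hasFDerivAt_snd (p := p))
  have e3 := e1.prodMk e2
  rw [tangentParam_change x x' hp hp', tangentCoord_tangentParam x' hm]
  have e4 := ((contMDiffAt_tangentParam x'
    (p := (chartChange E x x' p.1, fderiv ℝ (chartChange E x x') p.1 p.2)) hm).mdifferentiableAt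
      (by simp)).hasMFDerivAt.comp p e3.hasMFDerivAt
  have e5 := (e4.congr_of_eventuallyEq (f₁ := tangentParam E x) (by
    filter_upwards [continuousAt_fst.eventually (eventually_overlap x x' hp hp')] with q hq
    exact tangentParam_change x x' hq.1 hq.2)).mfderiv
  have e6 := congrArg (fun L ↦ L (a, b)) e5
  refine e6.trans ?_
  change paramDeriv E x' _ _ = paramDeriv E x' _ _
  congr 1
  refine Prod.ext rfl ?_
  change fderiv ℝ (chartChange E x x') p.1 b
    + fderiv ℝ (fderiv ℝ (chartChange E x x')) p.1 a p.2 = _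
  rw [add_comm]

lemma paramDeriv_isInvertible (x : M) {p : E × E}
    (hp : p.1 ∈ (extChartAt 𝓘(ℝ, E) x).target) :
    (paramDeriv E x p).IsInvertible := by
  have hs : (tangentParam E x p).proj ∈ (extChartAt 𝓘(ℝ, E) x).source :=
    (extChartAt 𝓘(ℝ, E) x).map_target hp
  have h1 := ((contMDiffAt_tangentParam x hp).mdifferentiableAt (by simp)).hasMFDerivAt
  have h2 := ((contMDiffAt_tangentCoord x hs).mdifferentiableAt (by simp)).hasMFDerivAt
  have hU : {q : E × E | q.1 ∈ (extChartAt 𝓘(ℝ, E) x).target} ∈ 𝓝 p :=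
    ((isOpen_extChartAt_target x).preimage continuous_fst).mem_nhds hp
  have hV : {v : TangentBundle 𝓘(ℝ, E) M | v.proj ∈ (extChartAt 𝓘(ℝ, E) x).source} ∈
      𝓝 (tangentParam E x p) :=
    ((isOpen_extChartAt_source x).preimage (FiberBundle.continuous_proj E _)).mem_nhds hs
  have e1 := (h2.comp p h1).congr_of_eventuallyEq (f₁ := id) (by
    filter_upwards [hU] with q hq
    exact (tangentCoord_tangentParam x hq).symm)
  have e1' := hasMFDerivAt_unique e1 (hasMFDerivAt_id p)
  have h1' := h1
  rw [← tangentCoord_tangentParam x hp] at h1'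
  have e2 := (h1'.comp (tangentParam E x p) h2).congr_of_eventuallyEq (f₁ := id) (by
    filter_upwards [hV] with q hq
    exact (tangentParam_tangentCoord x hq).symm)
  have e2' := hasMFDerivAt_unique e2 (hasMFDerivAt_id _)
  rw [tangentCoord_tangentParam x hp] at e2'
  let B : E × E →L[ℝ] E × E :=
    mfderiv 𝓘(ℝ, E).tangent 𝓘(ℝ, E × E) (tangentCoord E x) (tangentParam E x p)
  exact ContinuousLinearMap.IsInvertible.of_inverse (g := B) e2' e1'

/-- A vector field on `TM` is smooth when it is so in the coordinates given by a chart of `M`. -/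
lemma contMDiffAt_field (x : M)
    (F : (v : TangentBundle 𝓘(ℝ, E) M) → TangentSpace 𝓘(ℝ, E).tangent v) (w : E × E → E × E)
    (hF : ∀ v : TangentBundle 𝓘(ℝ, E) M, v.proj ∈ (extChartAt 𝓘(ℝ, E) x).source →
      F v = paramDeriv E x (tangentCoord E x v) (w (tangentCoord E x v)))
    {v : TangentBundle 𝓘(ℝ, E) M} (hv : v.proj ∈ (extChartAt 𝓘(ℝ, E) x).source)
    (hw : ContDiffAt ℝ ∞ w (tangentCoord E x v)) :
    ContMDiffAt 𝓘(ℝ, E).tangent 𝓘(ℝ, E).tangent.tangent ∞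
      (fun v ↦ (⟨v, F v⟩ : TangentBundle 𝓘(ℝ, E).tangent (TangentBundle 𝓘(ℝ, E) M))) v := by
  have hU : IsOpen {q : E × E | q.1 ∈ (extChartAt 𝓘(ℝ, E) x).target} :=
    (isOpen_extChartAt_target x).preimage continuous_fst
  have hV : {v : TangentBundle 𝓘(ℝ, E) M | v.proj ∈ (extChartAt 𝓘(ℝ, E) x).source} ∈ 𝓝 v :=
    ((isOpen_extChartAt_source x).preimage (FiberBundle.continuous_proj E _)).mem_nhds hv
  have hm := mem_target_tangentCoord x hv
  have h1 : ContMDiffOn 𝓘(ℝ, E × E) 𝓘(ℝ, E).tangent ∞ (tangentParam E x)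
      {q : E × E | q.1 ∈ (extChartAt 𝓘(ℝ, E) x).target} :=
    fun q hq ↦ (contMDiffAt_tangentParam x hq).contMDiffWithinAt
  have h2 := h1.contMDiffOn_tangentMapWithin (m := ∞) (by simp) hU.uniqueMDiffOn
  have h3 : ContMDiffAt 𝓘(ℝ, E × E) 𝓘(ℝ, E × E).tangent ∞
      (fun q : E × E ↦ (⟨q, w q⟩ : TangentBundle 𝓘(ℝ, E × E) (E × E))) (tangentCoord E x v) :=
    contMDiffAt_vectorSpace_iff_contDiffAt.2 hw
  have h4 := h2.contMDiffAt
    (x := (⟨tangentCoord E x v, w (tangentCoord E x v)⟩ : TangentBundle 𝓘(ℝ, E × E) (E × E)))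
    ((hU.preimage (FiberBundle.continuous_proj (E × E) _)).mem_nhds hm)
  have h5 := (ContMDiffAt.comp (I' := 𝓘(ℝ, E × E).tangent) (tangentCoord E x v) h4 h3).comp v
    (contMDiffAt_tangentCoord x hv)
  refine h5.congr_of_eventuallyEq ?_
  filter_upwards [hV] with u hu
  refine TotalSpace.ext (tangentParam_tangentCoord x hu).symm (heq_of_eq ?_)
  refine (hF u hu).trans ?_
  change _ = mfderivWithin 𝓘(ℝ, E × E) 𝓘(ℝ, E).tangent (tangentParam E x)
    {q : E × E | q.1 ∈ (extChartAt 𝓘(ℝ, E) x).target} (tangentCoord E x u) (w (tangentCoord E x u))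
  rw [mfderivWithin_of_mem_nhds (hU.mem_nhds (mem_target_tangentCoord x hu))]
  rfl

lemma eulerField_eq (x : M) {v : TangentBundle 𝓘(ℝ, E) M}
    (hv : v.proj ∈ (extChartAt 𝓘(ℝ, E) x).source) :
    eulerField E M v = paramDeriv E x (tangentCoord E x v) (0, (tangentCoord E x v).2) := by
  have hm := mem_target_tangentCoord x hv
  have h1 : HasFDerivAt (fun t : ℝ ↦ ((tangentCoord E x v).1, t • (tangentCoord E x v).2))
      ((0 : ℝ →L[ℝ] E).prod ((1 : ℝ →L[ℝ] ℝ).smulRight (tangentCoord E x v).2)) 1 :=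
    (hasFDerivAt_const _ _).prodMk ((hasFDerivAt_id (𝕜 := ℝ) (1 : ℝ)).smul_const _)
  have h2 := ((contMDiffAt_tangentParam x (p := ((tangentCoord E x v).1,
    (1 : ℝ) • (tangentCoord E x v).2)) hm).mdifferentiableAt (by simp)).hasMFDerivAt.comp
      (1 : ℝ) h1.hasMFDerivAt
  have h3 := (h2.congr_of_eventuallyEq
    (f₁ := fun t : ℝ ↦ (⟨v.proj, t • v.2⟩ : TangentBundle 𝓘(ℝ, E) M))
    (Filter.Eventually.of_forall fun t ↦ by
      refine TotalSpace.ext ((extChartAt 𝓘(ℝ, E) x).left_inv hv).symm (heq_of_eq ?_)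
      have h := chartSymmDeriv_chartDeriv x hv (t • v.2 : E)
      have h' : chartDeriv E x v.proj (t • v.2 : E) = t • chartDeriv E x v.proj v.2 := map_smul _ _ _
      exact h.symm.trans (congrArg (chartSymmDeriv x (extChartAt 𝓘(ℝ, E) x v.proj)) h'))).mfderiv
  have h4 := congrArg (fun L ↦ L (1 : ℝ)) h3
  refine h4.trans ?_
  change paramDeriv E x ((tangentCoord E x v).1, (1 : ℝ) • (tangentCoord E x v).2)
    (0, (1 : ℝ) • (tangentCoord E x v).2) = _
  simp

namespace PseudoRiemannianMetric
variable (g : PseudoRiemannianMetric E M)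

/-- The vector field `geodesicField` has the same expression in all the preferred charts. -/
lemma geodesicField_eq [FiniteDimensional ℝ E] (x : M) {v : TangentBundle 𝓘(ℝ, E) M}
    (hv : v.proj ∈ (extChartAt 𝓘(ℝ, E) x).source) :
    g.geodesicField v = paramDeriv E x (tangentCoord E x v)
      ((tangentCoord E x v).2, g.accel x (tangentCoord E x v).1 (tangentCoord E x v).2) := by
  have hm := mem_target_tangentCoord x hv
  have hp : tangentParam E x (tangentCoord E x v) = v := tangentParam_tangentCoord x hv
  have hp1 : (extChartAt 𝓘(ℝ, E) x).symm (tangentCoord E x v).1 = v.proj :=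
    (extChartAt 𝓘(ℝ, E) x).left_inv hv
  have hm' : (extChartAt 𝓘(ℝ, E) x).symm (tangentCoord E x v).1 ∈
      (extChartAt 𝓘(ℝ, E) v.proj).source := by
    rw [hp1]; exact mem_extChartAt_source v.proj
  have hc := tangentParam_change x v.proj hm hm'
  have hc' : tangentCoord E v.proj v = (chartChange E x v.proj (tangentCoord E x v).1,
      fderiv ℝ (chartChange E x v.proj) (tangentCoord E x v).1 (tangentCoord E x v).2) := by
    rw [hp] at hc
    refine (congrArg (tangentCoord E v.proj) hc).trans ?_
    exact tangentCoord_tangentParam v.proj (p := (chartChange E x v.proj (tangentCoord E x v).1,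
      fderiv ℝ (chartChange E x v.proj) (tangentCoord E x v).1 (tangentCoord E x v).2))
      ((extChartAt 𝓘(ℝ, E) v.proj).map_source hm')
  rw [paramDeriv_change x v.proj hm hm', hp, ← g.accel_change x v.proj hm hm']
  unfold geodesicField
  simp only [hc']
  rfl

lemma contMDiff_geodesicField [FiniteDimensional ℝ E] : ContMDiff 𝓘(ℝ, E).tangent 𝓘(ℝ, E).tangent.tangent ∞
    (fun v ↦ (⟨v, g.geodesicField v⟩ :
      TangentBundle 𝓘(ℝ, E).tangent (TangentBundle 𝓘(ℝ, E) M))) := fun v ↦ by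
  have hv : v.proj ∈ (extChartAt 𝓘(ℝ, E) v.proj).source := mem_extChartAt_source v.proj
  exact contMDiffAt_field v.proj g.geodesicField (fun p ↦ (p.2, g.accel v.proj p.1 p.2))
    (fun u hu ↦ g.geodesicField_eq v.proj hu) hv
    (contDiffAt_snd.prodMk (g.contDiffAt_accel v.proj (mem_target_tangentCoord v.proj hv)))

lemma mfderiv_proj_geodesicField (v : TangentBundle 𝓘(ℝ, E) M) :
    mfderiv 𝓘(ℝ, E).tangent 𝓘(ℝ, E) (fun w : TangentBundle 𝓘(ℝ, E) M ↦ w.proj) v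
      (g.geodesicField v) = v.2 := by
  have hv : v.proj ∈ (extChartAt 𝓘(ℝ, E) v.proj).source := mem_extChartAt_source v.proj
  have hm := mem_target_tangentCoord v.proj hv
  have hp : tangentParam E v.proj (tangentCoord E v.proj v) = v := tangentParam_tangentCoord _ hv
  have h1 := ((contMDiffAt_tangentParam v.proj hm).mdifferentiableAt (by simp)).hasMFDerivAt
  have h2 := (((contMDiff_proj (IB := 𝓘(ℝ, E)) (n := ∞) (F := E)
    (TangentSpace 𝓘(ℝ, E) : M → Type _)).contMDiffAt
      (x := tangentParam E v.proj (tangentCoord E v.proj v))).mdifferentiableAt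
      (by simp)).hasMFDerivAt
  have h3 := (mdifferentiableAt_chart_symm v.proj hm).hasMFDerivAt.comp
    (tangentCoord E v.proj v) (hasFDerivAt_fst (𝕜 := ℝ) (p := tangentCoord E v.proj v)).hasMFDerivAt
  have h4 := hasMFDerivAt_unique (h2.comp _ h1) h3
  rw [hp] at h4
  have h5 := congrArg (fun L ↦ L ((tangentCoord E v.proj v).2,
    g.accel v.proj (tangentCoord E v.proj v).1 (tangentCoord E v.proj v).2)) h4
  refine h5.trans ?_
  exact chartSymmDeriv_chartDeriv v.proj hv v.2

lemma mlieBracket_geodesicField [FiniteDimensional ℝ E] (v : TangentBundle 𝓘(ℝ, E) M) :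
    VectorField.mlieBracket 𝓘(ℝ, E).tangent (eulerField E M) g.geodesicField v
      = g.geodesicField v := by
  have hv : v.proj ∈ (extChartAt 𝓘(ℝ, E) v.proj).source := mem_extChartAt_source v.proj
  have hm := mem_target_tangentCoord v.proj hv
  have hp : tangentParam E v.proj (tangentCoord E v.proj v) = v := tangentParam_tangentCoord _ hv
  have : IsManifold 𝓘(ℝ, E).tangent (minSmoothness ℝ 2) (TangentBundle 𝓘(ℝ, E) M) := by
    rw [minSmoothness_of_isRCLikeNormedField]
    exact IsManifold.of_le (n := ∞) (WithTop.coe_le_coe.2 le_top)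
  have : CompleteSpace E := FiniteDimensional.complete ℝ E
  set x := v.proj with hx
  set p := tangentCoord E x v with hpdef
  let V : E × E → E × E := fun q ↦ (0, q.2)
  let W : E × E → E × E := fun q ↦ (q.2, g.accel x q.1 q.2)
  have hVs : ContDiff ℝ ∞ V := contDiff_const.prodMk contDiff_snd
  have hWs : ContDiffAt ℝ ∞ W p := contDiffAt_snd.prodMk (g.contDiffAt_accel x hm)
  have hC := (contMDiffAt_field x (eulerField E M) V (fun u hu ↦ eulerField_eq x hu) hv
    hVs.contDiffAt).mdifferentiableAt (by simp)
  have hS := (g.contMDiff_geodesicField v).mdifferentiableAt (by simp)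
  rw [← hp] at hC hS
  have key := VectorField.mpullback_mlieBracket hC hS (contMDiffAt_tangentParam x hm)
    (by simp only [minSmoothness_of_isRCLikeNormedField]; exact WithTop.coe_le_coe.2 le_top)
  have hU : ∀ᶠ q : E × E in 𝓝 p, q.1 ∈ (extChartAt 𝓘(ℝ, E) x).target :=
    ((isOpen_extChartAt_target x).preimage continuous_fst).mem_nhds hm
  have pull : ∀ (F : (v : TangentBundle 𝓘(ℝ, E) M) → TangentSpace 𝓘(ℝ, E).tangent v)
      (w : E × E → E × E), (∀ v : TangentBundle 𝓘(ℝ, E) M,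
        v.proj ∈ (extChartAt 𝓘(ℝ, E) x).source →
        F v = paramDeriv E x (tangentCoord E x v) (w (tangentCoord E x v))) →
      VectorField.mpullback 𝓘(ℝ, E × E) 𝓘(ℝ, E).tangent (tangentParam E x) F =ᶠ[𝓝 p] w := by
    intro F w hF
    filter_upwards [hU] with q hq
    have h1 := hF (tangentParam E x q) ((extChartAt 𝓘(ℝ, E) x).map_target hq)
    rw [tangentCoord_tangentParam x hq] at h1
    change (paramDeriv E x q).inverse (F (tangentParam E x q)) = w q
    rw [h1]
    obtain ⟨e, he⟩ := paramDeriv_isInvertible x hq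
    rw [← he, ContinuousLinearMap.inverse_equiv]
    simp
  have k1 := pull _ V (fun u hu ↦ eulerField_eq x hu)
  have k2 := pull _ W (fun u hu ↦ g.geodesicField_eq x hu)
  have hbr : VectorField.lieBracket ℝ V W p = W p := by
    have hWd := (hWs.differentiableAt (by simp)).hasFDerivAt
    have hVd : HasFDerivAt V ((0 : E × E →L[ℝ] E).prod (ContinuousLinearMap.snd ℝ E E)) p :=
      (hasFDerivAt_const _ _).prodMk hasFDerivAt_snd
    have c1 : HasDerivAt (fun t : ℝ ↦ (p.1, t • p.2)) (0, (1 : ℝ) • p.2) 1 :=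
      (hasDerivAt_const _ _).prodMk ((hasDerivAt_id (1 : ℝ)).smul_const _)
    have hp1 : p = (p.1, (1 : ℝ) • p.2) := by simp
    have c2 : HasDerivAt (fun t : ℝ ↦ W (p.1, t • p.2)) (fderiv ℝ W p (0, (1 : ℝ) • p.2)) 1 := by
      have hWd' := hWd
      rw [hp1] at hWd'
      have := hWd'.comp_hasDerivAt (1 : ℝ) c1
      rw [← hp1] at this
      exact this
    have c3 : HasDerivAt (fun t : ℝ ↦ W (p.1, t • p.2)) ((1 : ℝ) • p.2,
        ((2 : ℕ) * (1 : ℝ) ^ (2 - 1)) • g.accel x p.1 p.2) 1 := by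
      have : (fun t : ℝ ↦ W (p.1, t • p.2)) = fun t ↦ (t • p.2, t ^ 2 • g.accel x p.1 p.2) := by
        funext t
        simp only [W, g.accel_smul x hm]
      rw [this]
      exact ((hasDerivAt_id (1 : ℝ)).smul_const _).prodMk ((hasDerivAt_pow 2 (1 : ℝ)).smul_const _)
    have c4 := c2.unique c3
    simp only [one_smul] at c4
    have c5 : V p = (0, p.2) := rfl
    rw [VectorField.lieBracket_eq]
    simp only [hVd.fderiv, c5, c4]
    refine Prod.ext ?_ ?_
    · simp [W]
    · simp only [W, ContinuousLinearMap.prod_apply, ContinuousLinearMap.coe_snd', Prod.snd_sub]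
      module
  have hbr' : VectorField.mlieBracket 𝓘(ℝ, E × E) V W p = W p := by
    rw [← VectorField.lieBracketWithin_univ] at hbr
    exact (congrFun (VectorField.mlieBracketWithin_eq_lieBracketWithin (V := V) (W := W)
      (s := univ)) p).trans hbr
  rw [Filter.EventuallyEq.mlieBracket_vectorField_eq k1 k2, hbr'] at key
  have key' : (paramDeriv E x p).inverse (VectorField.mlieBracket 𝓘(ℝ, E).tangent
    (eulerField E M) g.geodesicField (tangentParam E x p)) = W p := key
  rw [hp] at key'
  have hS' := g.geodesicField_eq x hv
  obtain ⟨e, he⟩ := paramDeriv_isInvertible x hm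
  rw [← he, ContinuousLinearMap.inverse_equiv] at key'
  rw [hS', ← hpdef, ← he]
  exact e.symm_apply_eq.1 key'

end PseudoRiemannianMetric

/-- The set of sprays on `M` which are homogeneous of degree `m`. -/
def HomogeneousSprayOfDegree (E : Type*) [NormedAddCommGroup E] [NormedSpace ℝ E]
    (M : Type*) [TopologicalSpace M] [ChartedSpace E M] [IsManifold 𝓘(ℝ, E) ∞ M] (m : ℝ) : Type _ :=
  {S : Spray E M // S.IsHomogeneous m}

/-- The homogeneous sprays on `M`, of any degree. -/
def HomogeneousSpray (E : Type*) [NormedAddCommGroup E] [NormedSpace ℝ E]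
    (M : Type*) [TopologicalSpace M] [ChartedSpace E M] [IsManifold 𝓘(ℝ, E) ∞ M] : Type _ :=
  {S : Spray E M // ∃ m : ℝ, S.IsHomogeneous m}

/-- A homogeneous spray of degree `m`, as a homogeneous spray. -/
def HomogeneousSprayOfDegree.toHomogeneousSpray {m : ℝ} (S : HomogeneousSprayOfDegree E M m) :
    HomogeneousSpray E M := ⟨S.1, m, S.2⟩

/-- The unit sphere bundle of a Riemannian metric on `M`. -/
def unitSphereBundle (h : ContMDiffRiemannianMetric 𝓘(ℝ, E) ∞ E
    (fun x : M ↦ TangentSpace 𝓘(ℝ, E) x)) : Set (TangentBundle 𝓘(ℝ, E) M) :=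
  {v | h.inner v.proj v.2 v.2 = 1}

/-- The `C⁰`-fine (Whitney) topology on the sprays which are homogeneous of degree `m`, considered
as sections of `TTM` restricted to the unit sphere bundle `UM` of `h`: it is generated by the sets
of the sprays `S` with `S (UM) ⊆ W`, for `W` open in `TTM`. -/
@[reducible] def fineTopologyOfDegree (h : ContMDiffRiemannianMetric 𝓘(ℝ, E) ∞ E
    (fun x : M ↦ TangentSpace 𝓘(ℝ, E) x)) (m : ℝ) :
    TopologicalSpace (HomogeneousSprayOfDegree E M m) :=
  TopologicalSpace.generateFrom
    {N | ∃ W : Set (TangentBundle 𝓘(ℝ, E).tangent (TangentBundle 𝓘(ℝ, E) M)), IsOpen W ∧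
      N = {S | ∀ v ∈ unitSphereBundle h,
        (⟨v, S.1.toFun v⟩ : TangentBundle 𝓘(ℝ, E).tangent (TangentBundle 𝓘(ℝ, E) M)) ∈ W}}

/-- The `C⁰`-fine topology on the homogeneous sprays of any degree: the weak topology generated by
the topologies on the subsets of homogeneous sprays of a given degree. A set is open when its
intersection with each of these subsets is open in it. -/
@[reducible] def fineTopology (h : ContMDiffRiemannianMetric 𝓘(ℝ, E) ∞ E
    (fun x : M ↦ TangentSpace 𝓘(ℝ, E) x)) : TopologicalSpace (HomogeneousSpray E M) :=
  ⨆ m : ℝ, (fineTopologyOfDegree h m).coinduced HomogeneousSprayOfDegree.toHomogeneousSpray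

/-- The natural lift `ċ` of a curve `c` to `TM`. -/
def curveLift (E : Type*) [NormedAddCommGroup E] [NormedSpace ℝ E]
    {M : Type*} [TopologicalSpace M] [ChartedSpace E M] (c : ℝ → M) (t : ℝ) :
    TangentBundle 𝓘(ℝ, E) M :=
  ⟨c t, mfderiv 𝓘(ℝ, ℝ) 𝓘(ℝ, E) c t (1 : ℝ)⟩

namespace Spray
variable (S : Spray E M)

/-- `c` is an `S`-geodesic on the nonempty open interval `J`, which may be unbounded: its natural
lift is an integral curve of `S` there. The values of `c` outside `J` are irrelevant. -/
structure IsGeodesicOn (c : ℝ → M) (J : Set ℝ) : Prop where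
  isOpen : IsOpen J
  ordConnected : J.OrdConnected
  nonempty : J.Nonempty
  isMIntegralCurveOn : IsMIntegralCurveOn (curveLift E c) S.toFun J

/-- `c`, with domain `J`, is an inextendible `S`-geodesic. -/
def IsInextendibleGeodesicOn (c : ℝ → M) (J : Set ℝ) : Prop :=
  S.IsGeodesicOn c J ∧
    ∀ (c' : ℝ → M) (J' : Set ℝ), S.IsGeodesicOn c' J' → J ⊆ J' → EqOn c c' J → J' = J

/-- `S` is pseudoconvex: for every compact set `K` there is a compact set `K'` which contains all
the `S`-geodesic segments with both endpoints in `K`. -/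
def IsPseudoconvex : Prop :=
  ∀ K : Set M, IsCompact K → ∃ K' : Set M, IsCompact K' ∧
    ∀ (c : ℝ → M) (J : Set ℝ), S.IsGeodesicOn c J → ∀ a ∈ J, ∀ b ∈ J, a ≤ b →
      c a ∈ K → c b ∈ K → ∀ t ∈ Icc a b, c t ∈ K'

/-- `S` is disprisoning: no inextendible `S`-geodesic is contained in a compact set. Constant curves, which are geodesics of the
homogeneous sprays, are left out. -/
def IsDisprisoning : Prop :=
  ∀ (c : ℝ → M) (J : Set ℝ), S.IsInextendibleGeodesicOn c J → (∃ s ∈ J, ∃ t ∈ J, c s ≠ c t) →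
    ∀ K : Set M, IsCompact K → ¬ MapsTo c J K

end Spray

namespace PseudoRiemannianMetric
variable [FiniteDimensional ℝ E] (g : PseudoRiemannianMetric E M)

/-- The geodesic spray `S_g` of a pseudo-Riemannian metric `g`. -/
def geodesicSpray : Spray E M where
  toFun := g.geodesicField
  smooth := g.contMDiff_geodesicField
  second_order := g.mfderiv_proj_geodesicField

lemma geodesicSpray_isHomogeneous : g.geodesicSpray.IsHomogeneous 2 :=
  ⟨by norm_num, fun v ↦ (g.mlieBracket_geodesicField v).trans (by
    rw [show (2 : ℝ) - 1 = 1 by norm_num, one_smul]; rfl)⟩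

/-- The geodesic spray, as a homogeneous spray. -/
def geodesicHomogeneousSpray : HomogeneousSpray E M :=
  ⟨g.geodesicSpray, 2, g.geodesicSpray_isHomogeneous⟩

end PseudoRiemannianMetric

end

end

/-! Geodesics are studied after reparametrization by `h`-arc length. The lift becomes a solution of
`y' = S(y) / |y|` (`Spray.IsArcCurveAt`): its projection has unit speed, while the vector `y` keeps
its own norm. For a spray of degree two this equation is invariant under `y ↦ r y` with `r > 0`, so
a curve may be normalized to have unit velocity at one parameter. Over a compact set the logarithm
of the energy is Lipschitz in arc length (`abs_log_energy_sub_le`), so along a bounded length the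
velocity neither vanishes nor blows up. Consequently, if sprays converge to `S₀` in the fine sense
over a compact `A`, their normalized arc curves in `A` converge pointwise along an ultrafilter, and
the limit is an arc curve of `S₀` (`IsFineLimit.exists_limit_curve`). Convergence of the sprays in
`C⁰` is enough, because the curves obey a uniform first-order expansion
(`IsFineLimit.eventually_estimate`).

Two facts about a compact `A` follow by contradiction. Arc curves in `A` of sprays near a
disprisoning `S₀` have bounded length (`Spray.IsDisprisoning.exists_length_le`): longer and longer
ones would converge to a curve of infinite length in both directions, that is, a nonconstant
inextendible geodesic of `S₀` inside `A`. Since lengths are bounded, segments with endpoints in a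
given compact set also pass to the limit, and the control of the segments of `S₀` is inherited by
nearby sprays (`Spray.IsDisprisoning.exists_segment_subset`).

Pseudoconvexity gives a compact exhaustion `K` in which the segments of `S₀` with endpoints in `K n`
stay in the interior of `K (n + 1)`. The shells `K (m + 3) \ interior (K m)` are compact and locally
finite, so the two facts can be imposed on all shells at once by a single fine neighbourhood
(`Spray.IsDisprisoning.exists_fineNhd`). For a spray in it, a segment in `K (m + 3)` with endpoints
in `K m` already lies in `K (m + 2)`. Descending through the exhaustion gives pseudoconvexity. A
geodesic trapped in a compact set has infinite forward length, so it cannot remain in one shell; it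
returns to the smaller sets, and the same descent drives it into an empty set.

The metric `g` enters only through the homogeneity of degree two of `S_g`. In positive dimension a
spray has at most one degree, so a fine neighbourhood among the sprays of degree two is also open
among all homogeneous sprays (`isOpen_fineTopology`). -/

noncomputable section

/-! ### Sprays and their integral curves in the charts of `TM`. -/

variable {E : Type*} [NormedAddCommGroup E] [NormedSpace ℝ E]
  {M : Type*} [TopologicalSpace M] [ChartedSpace E M] [IsManifold 𝓘(ℝ, E) ∞ M]

/-- The coordinates of a vector tangent to `TM` given by the preferred chart of `M` at `x`. -/
def fieldCoord (x : M) (ξ : TangentBundle 𝓘(ℝ, E).tangent (TangentBundle 𝓘(ℝ, E) M)) : E × E :=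
  mfderiv 𝓘(ℝ, E).tangent 𝓘(ℝ, E × E) (tangentCoord E x) ξ.proj ξ.2

variable (E) in
lemma isOpen_tangent_source (x : M) :
    IsOpen {v : TangentBundle 𝓘(ℝ, E) M | v.proj ∈ (extChartAt 𝓘(ℝ, E) x).source} :=
  (isOpen_extChartAt_source x).preimage (FiberBundle.continuous_proj E _)

omit [IsManifold 𝓘(ℝ, E) ∞ M] in
variable (E) in
lemma isOpen_tangent_target (x : M) :
    IsOpen {q : E × E | q.1 ∈ (extChartAt 𝓘(ℝ, E) x).target} :=
  (isOpen_extChartAt_target x).preimage continuous_fst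

lemma continuousOn_tangentCoord (x : M) : ContinuousOn (tangentCoord E x)
    {v : TangentBundle 𝓘(ℝ, E) M | v.proj ∈ (extChartAt 𝓘(ℝ, E) x).source} :=
  fun _ hv ↦ (contMDiffAt_tangentCoord x hv).continuousAt.continuousWithinAt

lemma continuousOn_tangentParam (x : M) : ContinuousOn (tangentParam E x)
    {q : E × E | q.1 ∈ (extChartAt 𝓘(ℝ, E) x).target} :=
  fun _ hv ↦ (contMDiffAt_tangentParam x hv).continuousAt.continuousWithinAt

lemma contMDiffAt_fieldCoord (x : M)
    {ξ : TangentBundle 𝓘(ℝ, E).tangent (TangentBundle 𝓘(ℝ, E) M)}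
    (hξ : ξ.proj.proj ∈ (extChartAt 𝓘(ℝ, E) x).source) :
    ContMDiffAt 𝓘(ℝ, E).tangent.tangent 𝓘(ℝ, E × E) ∞ (fieldCoord x) ξ := by
  have h1 : ContMDiffOn 𝓘(ℝ, E).tangent 𝓘(ℝ, E × E) ∞ (tangentCoord E x)
      {v : TangentBundle 𝓘(ℝ, E) M | v.proj ∈ (extChartAt 𝓘(ℝ, E) x).source} :=
    fun q hq ↦ (contMDiffAt_tangentCoord x hq).contMDiffWithinAt
  have hU := isOpen_tangent_source E x
  have h2 := h1.contMDiffOn_tangentMapWithin (m := ∞) (by simp) hU.uniqueMDiffOn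
  have hV := hU.preimage
    (FiberBundle.continuous_proj (E × E) (TangentSpace 𝓘(ℝ, E).tangent))
  have h3 := h2.contMDiffAt (hV.mem_nhds hξ)
  have h4 := (contMDiff_snd_tangentBundle_modelSpace (n := ∞) (E × E)
    𝓘(ℝ, E × E)).contMDiffAt.comp ξ h3
  refine h4.congr_of_eventuallyEq ?_
  filter_upwards [hV.mem_nhds hξ] with q hq
  change fieldCoord x q = mfderivWithin 𝓘(ℝ, E).tangent 𝓘(ℝ, E × E) (tangentCoord E x)
    {v : TangentBundle 𝓘(ℝ, E) M | v.proj ∈ (extChartAt 𝓘(ℝ, E) x).source} q.proj q.2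
  rw [mfderivWithin_of_mem_nhds (hU.mem_nhds hq)]
  rfl

lemma hasMFDerivAt_tangentCoord (x : M) {v : TangentBundle 𝓘(ℝ, E) M}
    (hv : v.proj ∈ (extChartAt 𝓘(ℝ, E) x).source) :
    HasMFDerivAt 𝓘(ℝ, E).tangent 𝓘(ℝ, E × E) (tangentCoord E x) v
      (mfderiv 𝓘(ℝ, E).tangent 𝓘(ℝ, E × E) (tangentCoord E x) v) :=
  ((contMDiffAt_tangentCoord x hv).mdifferentiableAt (by simp)).hasMFDerivAt

lemma hasMFDerivAt_tangentParam (x : M) {p : E × E} (hp : p.1 ∈ (extChartAt 𝓘(ℝ, E) x).target) :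
    HasMFDerivAt 𝓘(ℝ, E × E) 𝓘(ℝ, E).tangent (tangentParam E x) p (paramDeriv E x p) :=
  ((contMDiffAt_tangentParam x hp).mdifferentiableAt (by simp)).hasMFDerivAt

lemma paramDeriv_fieldCoord (x : M)
    {ξ : TangentBundle 𝓘(ℝ, E).tangent (TangentBundle 𝓘(ℝ, E) M)}
    (hξ : ξ.proj.proj ∈ (extChartAt 𝓘(ℝ, E) x).source) :
    paramDeriv E x (tangentCoord E x ξ.proj) (fieldCoord x ξ) = ξ.2 := by
  have h1 := hasMFDerivAt_tangentParam x (mem_target_tangentCoord x hξ)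
  have h2 := hasMFDerivAt_tangentCoord x hξ
  have e2 := (h1.comp ξ.proj h2).congr_of_eventuallyEq (f₁ := id) (by
    filter_upwards [(isOpen_tangent_source E x).mem_nhds hξ] with q hq
    exact (tangentParam_tangentCoord x hq).symm)
  exact congrArg (fun L ↦ L ξ.2) (hasMFDerivAt_unique e2 (hasMFDerivAt_id _))

/-- The composite of the chart with the projection of `TM` is the first component of `tangentCoord`;
both factorizations are differentiated. This turns the second-order condition into
`Spray.coord_fst`. -/
lemma mfderiv_proj_eq (x : M)
    {ξ : TangentBundle 𝓘(ℝ, E).tangent (TangentBundle 𝓘(ℝ, E) M)}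
    (hξ : ξ.proj.proj ∈ (extChartAt 𝓘(ℝ, E) x).source) :
    chartDeriv E x ξ.proj.proj (mfderiv 𝓘(ℝ, E).tangent 𝓘(ℝ, E)
      (fun w : TangentBundle 𝓘(ℝ, E) M ↦ w.proj) ξ.proj ξ.2) = (fieldCoord x ξ).1 := by
  have hξ' : ξ.proj.proj ∈ (chartAt E x).source := by rwa [extChartAt_source] at hξ
  have h0 := (((contMDiff_proj (IB := 𝓘(ℝ, E)) (n := ∞) (F := E)
    (TangentSpace 𝓘(ℝ, E) : M → Type _)).contMDiffAt
      (x := ξ.proj)).mdifferentiableAt (by simp)).hasMFDerivAt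
  have h1 := ((contMDiffAt_extChartAt' (I := 𝓘(ℝ, E)) (n := ∞) hξ').mdifferentiableAt
    (by simp)).hasMFDerivAt.comp ξ.proj h0
  have h2 := (hasFDerivAt_fst (𝕜 := ℝ) (p := tangentCoord E x ξ.proj)).hasMFDerivAt.comp ξ.proj
    (hasMFDerivAt_tangentCoord x hξ)
  exact congrArg (fun L ↦ L ξ.2) (hasMFDerivAt_unique h1 h2)

namespace Spray

/-- A spray as an element of `TTM` at each `v`. -/
def total (S : Spray E M) (v : TangentBundle 𝓘(ℝ, E) M) :
    TangentBundle 𝓘(ℝ, E).tangent (TangentBundle 𝓘(ℝ, E) M) := ⟨v, S.toFun v⟩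

/-- The expression `(z, y) ↦ (y, Y (z, y))` of a spray in the preferred chart at `x`. -/
def coord (S : Spray E M) (x : M) (p : E × E) : E × E :=
  fieldCoord x (S.total (tangentParam E x p))

variable (S : Spray E M)

lemma continuous_total : Continuous S.total := S.smooth.continuous

lemma coord_tangentCoord (x : M) {v : TangentBundle 𝓘(ℝ, E) M}
    (hv : v.proj ∈ (extChartAt 𝓘(ℝ, E) x).source) :
    S.coord x (tangentCoord E x v) = fieldCoord x (S.total v) := by
  rw [coord, tangentParam_tangentCoord x hv]

lemma coord_fst (x : M) {p : E × E} (hp : p.1 ∈ (extChartAt 𝓘(ℝ, E) x).target) :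
    (S.coord x p).1 = p.2 := by
  have hs : (tangentParam E x p).proj ∈ (extChartAt 𝓘(ℝ, E) x).source :=
    (extChartAt 𝓘(ℝ, E) x).map_target hp
  have h := mfderiv_proj_eq x (ξ := S.total (tangentParam E x p)) hs
  have h2 := S.second_order (tangentParam E x p)
  rw [coord, ← h]
  refine (congrArg (chartDeriv E x (tangentParam E x p).proj) h2).trans ?_
  exact congrArg Prod.snd (tangentCoord_tangentParam x hp)

lemma contDiffAt_coord (x : M) {p : E × E} (hp : p.1 ∈ (extChartAt 𝓘(ℝ, E) x).target) :
    ContDiffAt ℝ ∞ (S.coord x) p := by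
  rw [← contMDiffAt_iff_contDiffAt]
  have hs : (tangentParam E x p).proj ∈ (extChartAt 𝓘(ℝ, E) x).source :=
    (extChartAt 𝓘(ℝ, E) x).map_target hp
  exact (contMDiffAt_fieldCoord x (ξ := S.total (tangentParam E x p)) hs).comp p
    (S.smooth.contMDiffAt.comp p (contMDiffAt_tangentParam x hp))

lemma toFun_eq (x : M) {v : TangentBundle 𝓘(ℝ, E) M}
    (hv : v.proj ∈ (extChartAt 𝓘(ℝ, E) x).source) :
    S.toFun v = paramDeriv E x (tangentCoord E x v) (S.coord x (tangentCoord E x v)) := by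
  rw [S.coord_tangentCoord x hv]
  exact (paramDeriv_fieldCoord x (ξ := S.total v) hv).symm

/-- The factor `a` lets one statement serve both for geodesics, with `a = 1`, and for curves
parametrized by arc length, with `a` the inverse of the norm. -/
lemma hasDerivAt_tangentCoord (x : M) {y : ℝ → TangentBundle 𝓘(ℝ, E) M} {s a : ℝ}
    (hs : (y s).proj ∈ (extChartAt 𝓘(ℝ, E) x).source)
    (hy : HasMFDerivAt 𝓘(ℝ, ℝ) 𝓘(ℝ, E).tangent y s
      ((1 : ℝ →L[ℝ] ℝ).smulRight (a • S.toFun (y s)))) :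
    HasDerivAt (fun s ↦ tangentCoord E x (y s)) (a • S.coord x (tangentCoord E x (y s))) s := by
  have h := (hasMFDerivAt_tangentCoord x hs).comp s hy
  have e : (mfderiv 𝓘(ℝ, E).tangent 𝓘(ℝ, E × E) (tangentCoord E x) (y s)).comp
      ((1 : ℝ →L[ℝ] ℝ).smulRight (a • S.toFun (y s))) =
      ((1 : ℝ →L[ℝ] ℝ).smulRight (a • S.coord x (tangentCoord E x (y s))) : ℝ →L[ℝ] E × E) := by
    rw [S.coord_tangentCoord x hs]
    refine ContinuousLinearMap.ext fun r ↦ ?_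
    refine (map_smul (mfderiv 𝓘(ℝ, E).tangent 𝓘(ℝ, E × E) (tangentCoord E x) (y s)) (id r : ℝ)
      (a • S.toFun (y s))).trans ?_
    exact congrArg (fun w : E × E ↦ (id r : ℝ) • w)
      (map_smul (mfderiv 𝓘(ℝ, E).tangent 𝓘(ℝ, E × E) (tangentCoord E x) (y s)) a (S.toFun (y s)))
  have h2 := HasMFDerivAt.congr_mfderiv h e
  have h3 : HasFDerivAt (fun s ↦ tangentCoord E x (y s))
    ((1 : ℝ →L[ℝ] ℝ).smulRight (a • S.coord x (tangentCoord E x (y s))) : ℝ →L[ℝ] E × E) s :=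
    hasMFDerivAt_iff_hasFDerivAt.1 h2
  simpa using h3.hasDerivAt

lemma hasMFDerivAt_tangentParam (x : M) {z : ℝ → E × E} {s a : ℝ}
    (hs : (z s).1 ∈ (extChartAt 𝓘(ℝ, E) x).target)
    (hz : HasDerivAt z (a • S.coord x (z s)) s) :
    HasMFDerivAt 𝓘(ℝ, ℝ) 𝓘(ℝ, E).tangent (fun s ↦ tangentParam E x (z s)) s
      ((1 : ℝ →L[ℝ] ℝ).smulRight (a • S.toFun (tangentParam E x (z s)))) := by
  have hs' : (tangentParam E x (z s)).proj ∈ (extChartAt 𝓘(ℝ, E) x).source :=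
    (extChartAt 𝓘(ℝ, E) x).map_target hs
  have h := (_root_.hasMFDerivAt_tangentParam x hs).comp s hz.hasFDerivAt.hasMFDerivAt
  have e : S.toFun (tangentParam E x (z s)) = paramDeriv E x (z s) (S.coord x (z s)) := by
    refine (S.toFun_eq x hs').trans ?_
    rw [tangentCoord_tangentParam x hs]
  rw [e]
  refine HasMFDerivAt.congr_mfderiv h ?_
  refine ContinuousLinearMap.ext fun r ↦ ?_
  change paramDeriv E x (z s) ((id r : ℝ) • (a • S.coord x (z s))) =
    (id r : ℝ) • (a • paramDeriv E x (z s) (S.coord x (z s)))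
  rw [map_smul, map_smul]

end Spray
end

/-! ### Scaling in the fibers and homogeneity of degree two. -/

noncomputable section

variable {E : Type*} [NormedAddCommGroup E] [NormedSpace ℝ E]
  {M : Type*} [TopologicalSpace M] [ChartedSpace E M] [IsManifold 𝓘(ℝ, E) ∞ M]

/-- Multiplication by a scalar in the fibers of `TM`. -/
def tangentSMul (r : ℝ) (v : TangentBundle 𝓘(ℝ, E) M) : TangentBundle 𝓘(ℝ, E) M :=
  ⟨v.proj, r • v.2⟩

variable (E) in
/-- Multiplication by a scalar in the second factor of `E × E`. -/
def fiberSMul (r : ℝ) : E × E →L[ℝ] E × E :=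
  (ContinuousLinearMap.fst ℝ E E).prod (r • ContinuousLinearMap.snd ℝ E E)

@[simp] lemma fiberSMul_apply (r : ℝ) (p : E × E) : fiberSMul E r p = (p.1, r • p.2) := rfl

omit [IsManifold 𝓘(ℝ, E) ∞ M] in
lemma tangentCoord_tangentSMul (x : M) (r : ℝ) (v : TangentBundle 𝓘(ℝ, E) M) :
    tangentCoord E x (tangentSMul r v) = fiberSMul E r (tangentCoord E x v) :=
  Prod.ext rfl (map_smul (chartDeriv E x v.proj) r (v.2 : E))

omit [IsManifold 𝓘(ℝ, E) ∞ M] in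
lemma tangentParam_fiberSMul (x : M) (r : ℝ) (p : E × E) :
    tangentParam E x (fiberSMul E r p) = tangentSMul r (tangentParam E x p) :=
  TotalSpace.ext rfl (heq_of_eq (map_smul (chartSymmDeriv x p.1) r p.2))

/-- This is Euler's identity for the vertical coefficient `Y`. Pulled back to the chart, the Euler
field is `(0, y)`, and the second component of its bracket with `(y, Y)` is `DY (0, y) - Y`, which
homogeneity equates with `(m - 1) Y`. -/
lemma Spray.fderiv_coord_euler [FiniteDimensional ℝ E] {S : Spray E M} {m : ℝ}
    (hS : S.IsHomogeneous m) (x : M) {p : E × E} (hm : p.1 ∈ (extChartAt 𝓘(ℝ, E) x).target) :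
    (fderiv ℝ (S.coord x) p (0, p.2)).2 = m • (S.coord x p).2 := by
  have : IsManifold 𝓘(ℝ, E).tangent (minSmoothness ℝ 2) (TangentBundle 𝓘(ℝ, E) M) := by
    rw [minSmoothness_of_isRCLikeNormedField]
    exact IsManifold.of_le (n := ∞) (WithTop.coe_le_coe.2 le_top)
  have : CompleteSpace E := FiniteDimensional.complete ℝ E
  set v := tangentParam E x p with hv0
  have hv : v.proj ∈ (extChartAt 𝓘(ℝ, E) x).source := (extChartAt 𝓘(ℝ, E) x).map_target hm
  have hp : tangentCoord E x v = p := tangentCoord_tangentParam x hm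
  let V : E × E → E × E := fun q ↦ (0, q.2)
  let W : E × E → E × E := S.coord x
  have hVs : ContDiff ℝ ∞ V := contDiff_const.prodMk contDiff_snd
  have hWs : ContDiffAt ℝ ∞ W p := S.contDiffAt_coord x hm
  have hC := (contMDiffAt_field x (eulerField E M) V (fun u hu ↦ eulerField_eq x hu) hv
    hVs.contDiffAt).mdifferentiableAt (by simp)
  have hSm := (S.smooth v).mdifferentiableAt (by simp)
  have key := VectorField.mpullback_mlieBracket (f := tangentParam E x) (x₀ := p) hC hSm
    (contMDiffAt_tangentParam x hm)
    (by simp only [minSmoothness_of_isRCLikeNormedField]; exact WithTop.coe_le_coe.2 le_top)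
  have pull : ∀ (F : (v : TangentBundle 𝓘(ℝ, E) M) → TangentSpace 𝓘(ℝ, E).tangent v)
      (w : E × E → E × E), (∀ v : TangentBundle 𝓘(ℝ, E) M,
        v.proj ∈ (extChartAt 𝓘(ℝ, E) x).source →
        F v = paramDeriv E x (tangentCoord E x v) (w (tangentCoord E x v))) →
      VectorField.mpullback 𝓘(ℝ, E × E) 𝓘(ℝ, E).tangent (tangentParam E x) F =ᶠ[𝓝 p] w := by
    intro F w hF
    filter_upwards [(isOpen_tangent_target E x).mem_nhds hm] with q hq
    have h1 := hF (tangentParam E x q) ((extChartAt 𝓘(ℝ, E) x).map_target hq)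
    rw [tangentCoord_tangentParam x hq] at h1
    change (paramDeriv E x q).inverse (F (tangentParam E x q)) = w q
    rw [h1]
    obtain ⟨e, he⟩ := paramDeriv_isInvertible x hq
    rw [← he, ContinuousLinearMap.inverse_equiv]
    simp
  have k1 := pull _ V (fun u hu ↦ eulerField_eq x hu)
  have k2 := pull _ W (fun u hu ↦ S.toFun_eq x hu)
  rw [Filter.EventuallyEq.mlieBracket_vectorField_eq k1 k2] at key
  have key' : (paramDeriv E x p).inverse (VectorField.mlieBracket 𝓘(ℝ, E).tangent
    (eulerField E M) S.toFun v) = VectorField.mlieBracket 𝓘(ℝ, E × E) V W p := key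
  have hbr : VectorField.mlieBracket 𝓘(ℝ, E × E) V W p = VectorField.lieBracket ℝ V W p := by
    rw [← VectorField.lieBracketWithin_univ]
    exact congrFun (VectorField.mlieBracketWithin_eq_lieBracketWithin (V := V) (W := W)
      (s := univ)) p
  have hVd : HasFDerivAt V ((0 : E × E →L[ℝ] E).prod (ContinuousLinearMap.snd ℝ E E)) p :=
    (hasFDerivAt_const _ _).prodMk hasFDerivAt_snd
  have hL : (paramDeriv E x p).inverse (VectorField.mlieBracket 𝓘(ℝ, E).tangent
    (eulerField E M) S.toFun v) = (m - 1) • W p := by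
    rw [hS.2 v]
    have h1 := S.toFun_eq x hv
    rw [hp] at h1
    rw [h1]
    obtain ⟨e, he⟩ := paramDeriv_isInvertible x hm
    rw [← he, ContinuousLinearMap.inverse_equiv]
    exact (congrArg e.symm (map_smul e (m - 1) (S.coord x p)).symm).trans (e.symm_apply_apply _)
  rw [hL, hbr, VectorField.lieBracket_eq] at key'
  simp only [hVd.fderiv] at key'
  have k3 := congrArg Prod.snd key'
  have k4 : (m - 1) • (S.coord x p).2 = (fderiv ℝ (S.coord x) p (0, p.2)).2 - (S.coord x p).2 := k3
  rw [sub_smul, one_smul] at k4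
  exact (sub_left_inj.1 k4).symm

/-- The coefficients of a homogeneous spray of degree two are positively homogeneous. -/
lemma Spray.coord_fiberSMul [FiniteDimensional ℝ E] {S : Spray E M} (hS : S.IsHomogeneous 2)
    (x : M) {p : E × E} (hm : p.1 ∈ (extChartAt 𝓘(ℝ, E) x).target) {r : ℝ} (hr : 0 < r) :
    S.coord x (fiberSMul E r p) = r • fiberSMul E r (S.coord x p) := by
  refine Prod.ext ?_ ?_
  · rw [S.coord_fst x (p := fiberSMul E r p) hm]
    simp [S.coord_fst x hm]
  -- By Euler's identity `t⁻² Y (z, t y)` has zero derivative on `t > 0`, so its values at `r` and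
  -- at `1` agree.
  let f : ℝ → E := fun t ↦ (t ^ 2)⁻¹ • (S.coord x (fiberSMul E t p)).2
  have hf : ∀ t ∈ Ioi (0 : ℝ), HasDerivAt f 0 t := by
    intro t ht
    have ht : (0 : ℝ) < t := ht
    have h1 := ((S.contDiffAt_coord x (p := fiberSMul E t p) hm).differentiableAt
      (by simp)).hasFDerivAt
    have c1 : HasDerivAt (fun t : ℝ ↦ fiberSMul E t p) (0, p.2) t := by
      have : HasDerivAt (fun t : ℝ ↦ (p.1, t • p.2)) (0, (1 : ℝ) • p.2) t :=
        (hasDerivAt_const _ _).prodMk ((hasDerivAt_id t).smul_const _)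
      simpa using this
    have h2 : HasDerivAt (fun t : ℝ ↦ (S.coord x (fiberSMul E t p)).2)
        (fderiv ℝ (S.coord x) (fiberSMul E t p) (0, p.2)).2 t := by
      have h2' : HasDerivAt (fun t : ℝ ↦ S.coord x (fiberSMul E t p)) _ t :=
        HasFDerivAt.comp_hasDerivAt (l := S.coord x) t h1 c1
      exact (ContinuousLinearMap.snd ℝ E E).hasFDerivAt.comp_hasDerivAt t h2'
    have h3 := S.fderiv_coord_euler hS x (p := fiberSMul E t p) hm
    have h4 : ((0 : E), (fiberSMul E t p).2) = t • ((0 : E), p.2) := by simp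
    rw [h4, map_smul] at h3
    have h5 : (fderiv ℝ (S.coord x) (fiberSMul E t p) (0, p.2)).2 =
        (2 * t⁻¹) • (S.coord x (fiberSMul E t p)).2 := by
      rw [mul_comm, mul_smul, ← h3, Prod.smul_snd, smul_smul, inv_mul_cancel₀ ht.ne', one_smul]
    rw [h5] at h2
    have h6 := (((hasDerivAt_pow 2 t).inv (by positivity)).smul h2)
    refine h6.congr_deriv ?_
    rw [smul_smul, ← add_smul]
    have : (t ^ 2)⁻¹ * (2 * t⁻¹) + -(((2 : ℕ) : ℝ) * t ^ (2 - 1)) / (t ^ 2) ^ 2 = 0 := by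
      field_simp
      norm_num
      ring
    simp only [Pi.inv_apply]
    rw [this, zero_smul]
  have h1 : f r = f 1 := isOpen_Ioi.is_const_of_deriv_eq_zero isPreconnected_Ioi
    (fun t ht ↦ (hf t ht).differentiableAt.differentiableWithinAt) (fun t ht ↦ (hf t ht).deriv)
    hr (mem_Ioi.2 one_pos)
  simp only [f, one_pow, inv_one, one_smul, fiberSMul_apply, Prod.mk.eta] at h1
  rw [inv_smul_eq_iff₀ (by positivity)] at h1
  simp [h1, smul_smul, sq]

lemma t2Space_tangentBundle [T2Space M] : T2Space (TangentBundle 𝓘(ℝ, E) M) := by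
  refine t2_iff_ultrafilter.2 fun {v w} f hv hw ↦ ?_
  have hc := FiberBundle.continuous_proj E (TangentSpace 𝓘(ℝ, E) : M → Type _)
  have h0 : v.proj = w.proj := tendsto_nhds_unique (f := π E (TangentSpace 𝓘(ℝ, E) : M → Type _))
    ((hc.tendsto v).mono_left hv) ((hc.tendsto w).mono_left hw)
  have hs : v.proj ∈ (extChartAt 𝓘(ℝ, E) v.proj).source := mem_extChartAt_source _
  have hs' : w.proj ∈ (extChartAt 𝓘(ℝ, E) v.proj).source := h0 ▸ hs
  have h1 : tangentCoord E v.proj v = tangentCoord E v.proj w := tendsto_nhds_unique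
    ((contMDiffAt_tangentCoord _ hs).continuousAt.mono_left hv)
    ((contMDiffAt_tangentCoord _ hs').continuousAt.mono_left hw)
  rw [← tangentParam_tangentCoord v.proj hs, h1, tangentParam_tangentCoord v.proj hs']

lemma locallyCompactSpace_tangentBundle [FiniteDimensional ℝ E] :
    LocallyCompactSpace (TangentBundle 𝓘(ℝ, E) M) :=
  Manifold.locallyCompact_of_finiteDimensional 𝓘(ℝ, E).tangent

/-! ### The energy of the auxiliary metric and compactness in `TM`. -/

section energy
variable (h : ContMDiffRiemannianMetric 𝓘(ℝ, E) ∞ E (fun x : M ↦ TangentSpace 𝓘(ℝ, E) x))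

/-- The square of the norm of a tangent vector. -/
def energy (v : TangentBundle 𝓘(ℝ, E) M) : ℝ := h.inner v.proj v.2 v.2

lemma contMDiff_energy : ContMDiff 𝓘(ℝ, E).tangent 𝓘(ℝ, ℝ) ∞ (energy h) := by
  intro v
  have h1 := h.contMDiff.contMDiffAt.comp v
    (contMDiff_proj (IB := 𝓘(ℝ, E)) (F := E) (TangentSpace 𝓘(ℝ, E) : M → Type _)).contMDiffAt
  have := ContMDiffAt.clm_bundle_apply₂ (F₁ := E) (F₂ := E) (F₃ := ℝ) (E₃ := Bundle.Trivial M ℝ)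
    h1 contMDiffAt_id contMDiffAt_id
  rw [Bundle.contMDiffAt_totalSpace] at this
  exact this.2

lemma continuous_energy : Continuous (energy h) := (contMDiff_energy h).continuous

lemma energy_nonneg (v : TangentBundle 𝓘(ℝ, E) M) : 0 ≤ energy h v := by
  by_cases hv : v.2 = 0
  · simp [energy, hv]
  · exact (h.pos _ _ hv).le

lemma energy_pos {v : TangentBundle 𝓘(ℝ, E) M} (hv : v.2 ≠ 0) : 0 < energy h v := h.pos _ _ hv

lemma energy_tangentSMul (r : ℝ) (v : TangentBundle 𝓘(ℝ, E) M) :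
    energy h (tangentSMul r v) = r ^ 2 * energy h v := by
  let L : E →L[ℝ] E →L[ℝ] ℝ := h.inner v.proj
  have hL : ∀ w : E, L (r • w) (r • w) = r ^ 2 * L w w := fun w ↦ by
    simp only [map_smul, smul_apply, smul_eq_mul]
    ring
  exact hL v.2

/-- The differential of the energy. -/
def energyDeriv (ξ : TangentBundle 𝓘(ℝ, E).tangent (TangentBundle 𝓘(ℝ, E) M)) : ℝ :=
  mfderiv 𝓘(ℝ, E).tangent 𝓘(ℝ, ℝ) (energy h) ξ.proj ξ.2

lemma continuous_energyDeriv : Continuous (energyDeriv h) := by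
  have h1 := ((contMDiff_energy h).contMDiff_tangentMap (m := ∞) (by simp)).continuous
  exact (contMDiff_snd_tangentBundle_modelSpace (n := ∞) ℝ 𝓘(ℝ, ℝ)).continuous.comp h1

lemma hasDerivAt_energy (S : Spray E M) {y : ℝ → TangentBundle 𝓘(ℝ, E) M} {s a : ℝ}
    (hy : HasMFDerivAt 𝓘(ℝ, ℝ) 𝓘(ℝ, E).tangent y s
      ((1 : ℝ →L[ℝ] ℝ).smulRight (a • S.toFun (y s)))) :
    HasDerivAt (fun s ↦ energy h (y s)) (a * energyDeriv h (S.total (y s))) s := by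
  have h0 := ((contMDiff_energy h (y s)).mdifferentiableAt (by simp)).hasMFDerivAt.comp s hy
  have e : (mfderiv 𝓘(ℝ, E).tangent 𝓘(ℝ, ℝ) (energy h) (y s)).comp
      ((1 : ℝ →L[ℝ] ℝ).smulRight (a • S.toFun (y s))) =
      ((1 : ℝ →L[ℝ] ℝ).smulRight (a * energyDeriv h (S.total (y s))) : ℝ →L[ℝ] ℝ) := by
    refine ContinuousLinearMap.ext fun r ↦ ?_
    refine (map_smul (mfderiv 𝓘(ℝ, E).tangent 𝓘(ℝ, ℝ) (energy h) (y s)) (id r : ℝ)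
      (a • S.toFun (y s))).trans ?_
    exact congrArg (fun w : ℝ ↦ (id r : ℝ) • w)
      (map_smul (mfderiv 𝓘(ℝ, E).tangent 𝓘(ℝ, ℝ) (energy h) (y s)) a (S.toFun (y s)))
  have h3 : HasFDerivAt (fun s ↦ energy h (y s))
    ((1 : ℝ →L[ℝ] ℝ).smulRight (a * energyDeriv h (S.total (y s))) : ℝ →L[ℝ] ℝ) s :=
    hasMFDerivAt_iff_hasFDerivAt.1 (HasMFDerivAt.congr_mfderiv h0 e)
  simpa using h3.hasDerivAt

lemma energyDeriv_eq (S : Spray E M) (x : M) {v : TangentBundle 𝓘(ℝ, E) M}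
    (hv : v.proj ∈ (extChartAt 𝓘(ℝ, E) x).source) :
    HasFDerivAt (fun p ↦ energy h (tangentParam E x p))
      (fderiv ℝ (fun p ↦ energy h (tangentParam E x p)) (tangentCoord E x v)) (tangentCoord E x v) ∧
    energyDeriv h (S.total v) = fderiv ℝ (fun p ↦ energy h (tangentParam E x p))
      (tangentCoord E x v) (S.coord x (tangentCoord E x v)) := by
  have hm := mem_target_tangentCoord x hv
  have hp := tangentParam_tangentCoord x hv
  have h0 := ((contMDiff_energy h (tangentParam E x (tangentCoord E x v))).mdifferentiableAt
    (by simp)).hasMFDerivAt.comp _ (hasMFDerivAt_tangentParam x hm)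
  let L : E × E →L[ℝ] ℝ := (mfderiv 𝓘(ℝ, E).tangent 𝓘(ℝ, ℝ) (energy h)
    (tangentParam E x (tangentCoord E x v))).comp (paramDeriv E x (tangentCoord E x v))
  have h1 : HasFDerivAt (fun p ↦ energy h (tangentParam E x p)) L (tangentCoord E x v) :=
    hasMFDerivAt_iff_hasFDerivAt.1 h0
  refine ⟨h1.differentiableAt.hasFDerivAt, ?_⟩
  rw [h1.fderiv]
  change mfderiv 𝓘(ℝ, E).tangent 𝓘(ℝ, ℝ) (energy h) v (S.toFun v) =
    mfderiv 𝓘(ℝ, E).tangent 𝓘(ℝ, ℝ) (energy h) (tangentParam E x (tangentCoord E x v))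
      (paramDeriv E x (tangentCoord E x v) (S.coord x (tangentCoord E x v)))
  rw [S.toFun_eq x hv, hp]

/-- The exponent is `2 + 1`: differentiating the quadratic scaling of the energy gives `r ^ 2`, and
the spray at `r v` is `r` times the image of the spray at `v` under fiber scaling. -/
lemma energyDeriv_tangentSMul [FiniteDimensional ℝ E] {S : Spray E M} (hS : S.IsHomogeneous 2)
    {r : ℝ} (hr : 0 < r) (v : TangentBundle 𝓘(ℝ, E) M) :
    energyDeriv h (S.total (tangentSMul r v)) = r ^ 3 * energyDeriv h (S.total v) := by
  set x := v.proj
  have hv : v.proj ∈ (extChartAt 𝓘(ℝ, E) x).source := mem_extChartAt_source _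
  have hv' : (tangentSMul r v).proj ∈ (extChartAt 𝓘(ℝ, E) x).source := hv
  have hm := mem_target_tangentCoord x hv
  obtain ⟨d1, e1⟩ := energyDeriv_eq h S x hv
  obtain ⟨d2, e2⟩ := energyDeriv_eq h S x hv'
  rw [tangentCoord_tangentSMul] at d2 e2
  rw [e1, e2, S.coord_fiberSMul hS x hm hr]
  have k1 := d2.comp _ (fiberSMul E r).hasFDerivAt
  have k2 := d1.const_mul (r ^ 2)
  have k3 := k1.unique (k2.congr_of_eventuallyEq (Filter.Eventually.of_forall fun p ↦ by
    simp only [Function.comp_apply]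
    rw [tangentParam_fiberSMul, energy_tangentSMul]))
  have k4 := congrArg (fun L ↦ L (S.coord x (tangentCoord E x v))) k3
  simp only [ContinuousLinearMap.comp_apply, smul_apply, smul_eq_mul] at k4
  rw [map_smul, k4, smul_eq_mul]
  ring

/-- The energy has a positive lower bound `c` on the unit sphere of `E` at `z`; compactness of that
sphere keeps the bound `c / 2` for all nearby base points, and scaling extends it to all vectors. -/
lemma eventually_le_energy_tangentParam [FiniteDimensional ℝ E] (x : M) {z : E}
    (hz : z ∈ (extChartAt 𝓘(ℝ, E) x).target) :
    ∃ c > 0, ∀ᶠ z' in 𝓝 z, ∀ w : E, c * ‖w‖ ^ 2 ≤ energy h (tangentParam E x (z', w)) := by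
  have hc : ∀ w : E, ContinuousAt (fun p ↦ energy h (tangentParam E x p)) (z, w) := fun w ↦
    (continuous_energy h).continuousAt.comp
      (contMDiffAt_tangentParam x (p := (z, w)) hz).continuousAt
  have hK := isCompact_sphere (0 : E) 1
  have hpos : ∀ w ∈ Metric.sphere (0 : E) 1, 0 < energy h (tangentParam E x (z, w)) := by
    intro w hw
    refine energy_pos h fun h0 ↦ ?_
    have h1 : chartSymmDeriv x z w = 0 := h0
    have h2 := chartDeriv_chartSymmDeriv x hz w
    rw [h1, map_zero] at h2
    simp [← h2] at hw
  obtain ⟨c, hc0, hcK⟩ := hK.exists_forall_le' (f := fun w ↦ energy h (tangentParam E x (z, w)))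
    (fun w _ ↦ ((hc w).comp (Continuous.prodMk_right z).continuousAt).continuousWithinAt) hpos
  refine ⟨c / 2, by positivity, ?_⟩
  have h1 := hK.eventually_forall_of_forall_eventually (x₀ := z)
    (P := fun z' w ↦ c / 2 < energy h (tangentParam E x (z', w))) (fun w hw ↦
      (hc w).eventually_const_lt (by have := hcK w hw; dsimp only; linarith))
  filter_upwards [h1] with z' hz' w
  by_cases hw : w = 0
  · subst hw; simpa using energy_nonneg h _
  have hw' : 0 < ‖w‖ := norm_pos_iff.2 hw
  have h2 := hz' (‖w‖⁻¹ • w) (by simp [norm_smul, hw'.ne'])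
  have h3 : (z', w) = fiberSMul E ‖w‖ (z', ‖w‖⁻¹ • w) := by
    simp [smul_smul, hw'.ne']
  rw [h3, tangentParam_fiberSMul, energy_tangentSMul]
  nlinarith [sq_nonneg ‖w‖]

/-- Base points converge along an ultrafilter because `A` is compact. In a chart at the limit the
energy dominates a multiple of the squared norm, so the fiber coordinates lie in a closed ball and
converge too. -/
lemma isCompact_energy_le [FiniteDimensional ℝ E] {A : Set M} (hA : IsCompact A) (b : ℝ) :
    IsCompact {v : TangentBundle 𝓘(ℝ, E) M | v.proj ∈ A ∧ energy h v ≤ b} := by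
  rw [isCompact_iff_ultrafilter_le_nhds]
  intro f hf
  have hf : ∀ᶠ v : TangentBundle 𝓘(ℝ, E) M in f, v.proj ∈ A ∧ energy h v ≤ b :=
    Filter.le_principal_iff.1 hf
  let pr : TangentBundle 𝓘(ℝ, E) M → M := fun v ↦ v.proj
  have hpr : Continuous pr := FiberBundle.continuous_proj E (TangentSpace 𝓘(ℝ, E) : M → Type _)
  obtain ⟨x, hx, hfx⟩ := hA.ultrafilter_le_nhds (f.map pr)
    (Filter.le_principal_iff.2 (hf.mono fun v hv ↦ hv.1))
  have hfx : Filter.Tendsto pr f (𝓝 x) := hfx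
  have hxs : x ∈ (extChartAt 𝓘(ℝ, E) x).source := mem_extChartAt_source _
  have hz : extChartAt 𝓘(ℝ, E) x x ∈ (extChartAt 𝓘(ℝ, E) x).target :=
    (extChartAt 𝓘(ℝ, E) x).map_source hxs
  obtain ⟨c, hc, hcz⟩ := eventually_le_energy_tangentParam h x hz
  have h1 : Filter.Tendsto (fun v : TangentBundle 𝓘(ℝ, E) M ↦ (tangentCoord E x v).1) f
      (𝓝 (extChartAt 𝓘(ℝ, E) x x)) :=
    (continuousAt_extChartAt (I := 𝓘(ℝ, E)) x).tendsto.comp hfx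
  have h2 : ∀ᶠ v : TangentBundle 𝓘(ℝ, E) M in f, v.proj ∈ (extChartAt 𝓘(ℝ, E) x).source :=
    hfx.eventually (extChartAt_source_mem_nhds x)
  have h3 : ∀ᶠ v : TangentBundle 𝓘(ℝ, E) M in f,
      (tangentCoord E x v).2 ∈ Metric.closedBall (0 : E) (√(b / c)) := by
    filter_upwards [hf, h2, h1.eventually hcz] with v hv hv2 hv3
    have h4 := hv3 (tangentCoord E x v).2
    rw [Prod.mk.eta, tangentParam_tangentCoord x hv2] at h4
    rw [mem_closedBall_zero_iff]
    refine Real.le_sqrt_of_sq_le ?_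
    rw [le_div_iff₀ hc]
    linarith [hv.2]
  obtain ⟨w, -, hw⟩ := (isCompact_closedBall (0 : E) (√(b / c))).ultrafilter_le_nhds
    (f.map fun v : TangentBundle 𝓘(ℝ, E) M ↦ (tangentCoord E x v).2) (Filter.le_principal_iff.2 h3)
  have h4 : Filter.Tendsto (tangentCoord E x) f (𝓝 (extChartAt 𝓘(ℝ, E) x x, w)) :=
    h1.prodMk_nhds hw
  have h5 : (f : Filter (TangentBundle 𝓘(ℝ, E) M)) ≤
      𝓝 (tangentParam E x (extChartAt 𝓘(ℝ, E) x x, w)) := by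
    refine Filter.Tendsto.congr' (f₁ := fun v ↦ tangentParam E x (tangentCoord E x v)) ?_
      ((contMDiffAt_tangentParam x (p := (extChartAt 𝓘(ℝ, E) x x, w)) hz).continuousAt.tendsto.comp
        h4)
    filter_upwards [h2] with v hv using tangentParam_tangentCoord x hv
  refine ⟨_, ⟨?_, ?_⟩, h5⟩
  · change (extChartAt 𝓘(ℝ, E) x).symm (extChartAt 𝓘(ℝ, E) x x) ∈ A
    rwa [(extChartAt 𝓘(ℝ, E) x).left_inv hxs]
  · exact le_of_tendsto ((continuous_energy h).continuousAt.mono_left h5)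
      (hf.mono fun v hv ↦ hv.2)

end energy
end

/-! ### Curves parametrized by arc length and growth of their energy. -/

noncomputable section

variable {E : Type*} [NormedAddCommGroup E] [NormedSpace ℝ E]
  {M : Type*} [TopologicalSpace M] [ChartedSpace E M] [IsManifold 𝓘(ℝ, E) ∞ M]

section arc
variable (h : ContMDiffRiemannianMetric 𝓘(ℝ, E) ∞ E (fun x : M ↦ TangentSpace 𝓘(ℝ, E) x))

/-- At the parameter `s`, the curve `y` in `TM` is an integral curve of the spray `S` up to the
change of parameter which makes its projection to `M` run with unit speed. -/
def Spray.IsArcCurveAt (S : Spray E M) (y : ℝ → TangentBundle 𝓘(ℝ, E) M) (s : ℝ) : Prop :=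
  0 < energy h (y s) ∧ HasMFDerivAt 𝓘(ℝ, ℝ) 𝓘(ℝ, E).tangent y s
    ((1 : ℝ →L[ℝ] ℝ).smulRight ((√(energy h (y s)))⁻¹ • S.toFun (y s)))

/-- The spray `S` divided by the norm, in the preferred chart at `x`. -/
def Spray.arcField (S : Spray E M) (x : M) (p : E × E) : E × E :=
  (√(energy h (tangentParam E x p)))⁻¹ • S.coord x p

variable {h}

lemma Spray.IsArcCurveAt.hasDerivAt {S : Spray E M} {y : ℝ → TangentBundle 𝓘(ℝ, E) M} {s : ℝ}
    (hy : S.IsArcCurveAt h y s) (x : M) (hs : (y s).proj ∈ (extChartAt 𝓘(ℝ, E) x).source) :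
    HasDerivAt (fun s ↦ tangentCoord E x (y s)) (S.arcField h x (tangentCoord E x (y s))) s := by
  rw [Spray.arcField, tangentParam_tangentCoord x hs]
  exact S.hasDerivAt_tangentCoord x hs hy.2

lemma Spray.IsArcCurveAt.continuousAt {S : Spray E M} {y : ℝ → TangentBundle 𝓘(ℝ, E) M} {s : ℝ}
    (hy : S.IsArcCurveAt h y s) : ContinuousAt y s := hy.2.continuousAt

lemma Spray.isArcCurveAt_of_hasDerivAt {S : Spray E M} {y : ℝ → TangentBundle 𝓘(ℝ, E) M} {s : ℝ}
    (x : M) (he : 0 < energy h (y s))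
    (hs : ∀ᶠ t in 𝓝 s, (y t).proj ∈ (extChartAt 𝓘(ℝ, E) x).source)
    (hy : HasDerivAt (fun s ↦ tangentCoord E x (y s)) (S.arcField h x (tangentCoord E x (y s))) s) :
    S.IsArcCurveAt h y s := by
  have hs0 := hs.self_of_nhds
  have h1 := S.hasMFDerivAt_tangentParam x (z := fun s ↦ tangentCoord E x (y s))
    (mem_target_tangentCoord x hs0) hy
  rw [tangentParam_tangentCoord x hs0] at h1
  exact ⟨he, h1.congr_of_eventuallyEq (hs.mono fun t ht ↦ (tangentParam_tangentCoord x ht).symm)⟩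

/-- Degree two is exactly what makes the arc length equation scale invariant: replacing `y` by `r y`
multiplies the spray by an extra factor `r` beyond fiber scaling, and the division by the norm
removes it. -/
lemma Spray.IsArcCurveAt.tangentSMul [FiniteDimensional ℝ E] {S : Spray E M}
    (hS : S.IsHomogeneous 2) {y : ℝ → TangentBundle 𝓘(ℝ, E) M} {s r : ℝ}
    (hy : S.IsArcCurveAt h y s) (hr : 0 < r) :
    S.IsArcCurveAt h (fun t ↦ tangentSMul r (y t)) s := by
  set x := (y s).proj with hx
  have hs : (y s).proj ∈ (extChartAt 𝓘(ℝ, E) x).source := mem_extChartAt_source _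
  refine Spray.isArcCurveAt_of_hasDerivAt x ?_ ?_ ?_
  · rw [energy_tangentSMul]
    have := hy.1
    positivity
  · exact hy.continuousAt.eventually ((isOpen_tangent_source E x).mem_nhds hs)
  · simp only [tangentCoord_tangentSMul]
    have h1 : HasDerivAt (fun s ↦ fiberSMul E r (tangentCoord E x (y s))) _ s :=
      (fiberSMul E r).hasFDerivAt.comp_hasDerivAt s (hy.hasDerivAt x hs)
    refine h1.congr_deriv ?_
    rw [Spray.arcField, Spray.arcField, S.coord_fiberSMul hS x (mem_target_tangentCoord x hs) hr,
      tangentParam_fiberSMul, energy_tangentSMul, Real.sqrt_mul (sq_nonneg r), Real.sqrt_sq hr.le,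
      mul_inv, map_smul, smul_smul]
    congr 1
    field_simp

lemma Spray.IsArcCurveAt.comp_add {S : Spray E M} {y : ℝ → TangentBundle 𝓘(ℝ, E) M} {s d : ℝ}
    (hy : S.IsArcCurveAt h y (s + d)) : S.IsArcCurveAt h (fun t ↦ y (t + d)) s := by
  set x := (y (s + d)).proj with hx
  have hs : (y (s + d)).proj ∈ (extChartAt 𝓘(ℝ, E) x).source := mem_extChartAt_source _
  refine Spray.isArcCurveAt_of_hasDerivAt x hy.1 ?_ ?_
  · have h1 : ContinuousAt (fun t ↦ y (t + d)) s :=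
      ContinuousAt.comp (f := fun t ↦ t + d) (g := y) hy.continuousAt (by fun_prop)
    exact h1.eventually ((isOpen_tangent_source E x).mem_nhds hs)
  · exact (hy.hasDerivAt x hs).comp_add_const s d

lemma tangentSMul_mem_unitSphereBundle {v : TangentBundle 𝓘(ℝ, E) M} (hv : 0 < energy h v) :
    tangentSMul (√(energy h v))⁻¹ v ∈ unitSphereBundle h := by
  change energy h _ = 1
  rw [energy_tangentSMul, inv_pow, Real.sq_sqrt hv.le, inv_mul_cancel₀ hv.ne']

lemma abs_energyDeriv_le [FiniteDimensional ℝ E] {S : Spray E M} (hS : S.IsHomogeneous 2)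
    {A : Set M} {C : ℝ} (hC : ∀ u ∈ unitSphereBundle h, u.proj ∈ A →
      |energyDeriv h (S.total u)| ≤ C) {v : TangentBundle 𝓘(ℝ, E) M} (hv : 0 < energy h v)
    (hvA : v.proj ∈ A) : |energyDeriv h (S.total v)| ≤ C * √(energy h v) ^ 3 := by
  have h1 := hC _ (tangentSMul_mem_unitSphereBundle hv) hvA
  have hN : 0 < √(energy h v) := Real.sqrt_pos.2 hv
  rw [energyDeriv_tangentSMul h hS (inv_pos.2 hN), abs_mul, abs_of_pos (by positivity), inv_pow,
    inv_mul_le_iff₀ (by positivity)] at h1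
  linarith

/-- The derivative of the logarithm is `dE(S) / (|y| E)`, where `E` is the energy. The numerator is
at most `C |y| ^ 3` and the denominator equals `|y| ^ 3`. -/
lemma abs_log_energy_sub_le [FiniteDimensional ℝ E] {S : Spray E M} (hS : S.IsHomogeneous 2)
    {A : Set M} {C : ℝ} (hC : ∀ u ∈ unitSphereBundle h, u.proj ∈ A →
      |energyDeriv h (S.total u)| ≤ C) {y : ℝ → TangentBundle 𝓘(ℝ, E) M} {s t : ℝ}
    (hy : ∀ r ∈ uIcc s t, S.IsArcCurveAt h y r ∧ (y r).proj ∈ A) :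
    |Real.log (energy h (y t)) - Real.log (energy h (y s))| ≤ C * |t - s| := by
  refine (convex_uIcc s t).norm_image_sub_le_of_norm_hasDerivWithin_le
    (f := fun r ↦ Real.log (energy h (y r)))
    (f' := fun r ↦ ((√(energy h (y r)))⁻¹ * energyDeriv h (S.total (y r))) / energy h (y r))
    (fun r hr ↦ (((hasDerivAt_energy h S (hy r hr).1.2).log (hy r hr).1.1.ne').hasDerivWithinAt))
    (fun r hr ↦ ?_) left_mem_uIcc right_mem_uIcc
  have h1 := abs_energyDeriv_le hS hC (hy r hr).1.1 (hy r hr).2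
  have he := (hy r hr).1.1
  have hN : 0 < √(energy h (y r)) := Real.sqrt_pos.2 he
  rw [Real.norm_eq_abs, abs_div, abs_mul, abs_of_pos he, abs_of_pos (inv_pos.2 hN), div_le_iff₀ he,
    inv_mul_le_iff₀ hN]
  refine h1.trans (le_of_eq ?_)
  nth_rewrite 3 [← Real.sq_sqrt he.le]
  ring

end arc

/-- A curve which cannot leave the open set `O` without having left the closed set `Q ⊇ O`
stays in `O`. -/
lemma mem_of_forall_mem_closed {X : Type*} [TopologicalSpace X] {y : ℝ → X} {p q : ℝ}
    (hy : ContinuousOn y (Icc p q)) {O Q : Set X} (hO : IsOpen O) (hQ : IsClosed Q) (hOQ : O ⊆ Q)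
    (h0 : y p ∈ O) (hstep : ∀ t ∈ Icc p q, (∀ r ∈ Icc p t, y r ∈ Q) → y t ∈ O) :
    ∀ t ∈ Icc p q, y t ∈ O := by
  by_contra! hcon
  obtain ⟨t₁, ht₁, hyt₁⟩ := hcon
  obtain ⟨V, hV, hVeq⟩ := continuousOn_iff'.1 hy O hO
  have hB : {t ∈ Icc p q | y t ∉ O} = Icc p q ∩ Vᶜ := by
    ext t
    have := Set.ext_iff.1 hVeq t
    simp only [mem_inter_iff, mem_preimage, mem_ofPred_eq, mem_compl_iff] at this ⊢
    tauto
  have hBc : IsCompact {t ∈ Icc p q | y t ∉ O} := by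
    rw [hB]; exact isCompact_Icc.inter_right hV.isClosed_compl
  -- Take the first time outside `O`. The curve is in `O` before it, hence in the closed set `Q` up
  -- to and including it, and `hstep` puts it back in `O`.
  obtain ⟨t, ⟨ht, hyt⟩, hmin⟩ := hBc.exists_isLeast ⟨t₁, ht₁, hyt₁⟩
  have hlt : ∀ r ∈ Ico p t, y r ∈ O := fun r hr ↦ by
    by_contra hr'
    exact (hmin ⟨⟨hr.1, hr.2.le.trans ht.2⟩, hr'⟩).not_gt hr.2
  have hpt : p < t := lt_of_le_of_ne ht.1 fun e ↦ hyt (e ▸ h0)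
  refine hyt (hstep t ht fun r hr ↦ ?_)
  have h1 : MapsTo y (Ico p t) Q := fun r hr ↦ hOQ (hlt r hr)
  have h2 : ContinuousOn y (closure (Ico p t)) := by
    rw [closure_Ico hpt.ne]
    exact hy.mono (Icc_subset_Icc_right ht.2)
  have h3 := h1.closure_of_continuousOn h2
  rw [closure_Ico hpt.ne, hQ.closure_eq] at h3
  exact h3 hr

/-! ### Fine convergence of sprays and uniform local estimates. -/

section limits
variable [FiniteDimensional ℝ E] [T2Space M]
variable {h : ContMDiffRiemannianMetric 𝓘(ℝ, E) ∞ E (fun x : M ↦ TangentSpace 𝓘(ℝ, E) x)}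

/-- While the curve stays in the closed coordinate ball its velocity is within `ε` of `w`, and the
mean value inequality gives the expansion. The expansion in turn bounds the displacement from `p₀`
by less than `r / 2 + r / 2`, so the curve never reaches the boundary of the ball. -/
lemma Spray.IsArcCurveAt.estimate {S : Spray E M} {A : Set M} {y : ℝ → TangentBundle 𝓘(ℝ, E) M}
    {x : M} {p₀ w : E × E} {r ε s₀ s : ℝ}
    (hball : Metric.closedBall p₀ r ⊆ {q | q.1 ∈ (extChartAt 𝓘(ℝ, E) x).target})
    (hy : ∀ t ∈ uIcc s₀ s, S.IsArcCurveAt h y t ∧ (y t).proj ∈ A)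
    (hX : ∀ p ∈ Metric.closedBall p₀ r, (tangentParam E x p).proj ∈ A →
      ‖S.arcField h x p - w‖ ≤ ε)
    (hsrc : (y s₀).proj ∈ (extChartAt 𝓘(ℝ, E) x).source)
    (h0 : dist (tangentCoord E x (y s₀)) p₀ < r / 2) (hτ : (‖w‖ + ε) * |s - s₀| < r / 2) :
    (y s).proj ∈ (extChartAt 𝓘(ℝ, E) x).source ∧ tangentCoord E x (y s) ∈ Metric.ball p₀ r ∧
      ‖tangentCoord E x (y s) - tangentCoord E x (y s₀) - (s - s₀) • w‖ ≤ ε * |s - s₀| := by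
  have := t2Space_tangentBundle (E := E) (M := M)
  let Q : Set (TangentBundle 𝓘(ℝ, E) M) := tangentParam E x '' Metric.closedBall p₀ r
  let O : Set (TangentBundle 𝓘(ℝ, E) M) :=
    {v | v.proj ∈ (extChartAt 𝓘(ℝ, E) x).source} ∩ tangentCoord E x ⁻¹' Metric.ball p₀ r
  -- Closedness is needed in all of `TM`, not just in the chart domain; it comes from compactness in
  -- a Hausdorff space.
  have hQc : IsClosed Q := ((isCompact_closedBall p₀ r).image_of_continuousOn
    ((continuousOn_tangentParam x).mono hball)).isClosed
  have hOo : IsOpen O := (continuousOn_tangentCoord x).isOpen_inter_preimage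
    (isOpen_tangent_source E x) Metric.isOpen_ball
  have hQ : ∀ v ∈ Q, v.proj ∈ (extChartAt 𝓘(ℝ, E) x).source ∧
      tangentCoord E x v ∈ Metric.closedBall p₀ r := by
    rintro _ ⟨p, hp, rfl⟩
    refine ⟨(extChartAt 𝓘(ℝ, E) x).map_target (hball hp), ?_⟩
    rwa [tangentCoord_tangentParam x (hball hp)]
  have hOQ : O ⊆ Q := fun v hv ↦
    ⟨tangentCoord E x v, Metric.ball_subset_closedBall hv.2, tangentParam_tangentCoord x hv.1⟩
  -- The affine parameter on `[0, 1]` treats `s₀ ≤ s` and `s ≤ s₀` together.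
  have hseg : ∀ t ∈ Icc (0 : ℝ) 1, s₀ + t * (s - s₀) ∈ uIcc s₀ s := by
    intro t ht
    rw [← segment_eq_uIcc, segment_eq_image']
    exact ⟨t, ht, rfl⟩
  have hest : ∀ t ∈ Icc (0 : ℝ) 1, (∀ r ∈ Icc 0 t, y (s₀ + r * (s - s₀)) ∈ Q) →
      ‖tangentCoord E x (y (s₀ + t * (s - s₀))) - tangentCoord E x (y s₀) - (t * (s - s₀)) • w‖
        ≤ ε * |s - s₀| * t := by
    intro t ht hr
    have h1 := norm_image_sub_le_of_norm_deriv_le_segment' (a := 0) (b := t)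
      (f := fun t ↦ tangentCoord E x (y (s₀ + t * (s - s₀))) - (t * (s - s₀)) • w)
      (f' := fun t ↦ (s - s₀) • (S.arcField h x (tangentCoord E x (y (s₀ + t * (s - s₀)))) - w))
      (C := ε * |s - s₀|) (fun r hr' ↦ ?_) (fun r hr' ↦ ?_) t ⟨ht.1, le_rfl⟩
    · simp only [zero_mul, add_zero, zero_smul, sub_zero] at h1
      rwa [sub_right_comm] at h1
    · have h2 := (hy _ (hseg r ⟨hr'.1, hr'.2.trans ht.2⟩)).1.hasDerivAt x (hQ _ (hr r hr')).1
      have h3 : HasDerivAt (fun t ↦ s₀ + t * (s - s₀)) (s - s₀) r := by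
        simpa using ((hasDerivAt_id r).mul_const (s - s₀)).const_add s₀
      have h4 : HasDerivAt (fun t : ℝ ↦ (t * (s - s₀)) • w) ((s - s₀) • w) r := by
        have := ((hasDerivAt_id r).mul_const (s - s₀)).smul_const w
        simpa using this
      have h5 := (h2.scomp r h3).sub h4
      rw [← smul_sub] at h5
      exact h5.hasDerivWithinAt
    · rw [norm_smul, Real.norm_eq_abs, mul_comm]
      have h2 := hQ _ (hr r ⟨hr'.1, hr'.2.le⟩)
      refine mul_le_mul_of_nonneg_right (hX _ h2.2 ?_) (abs_nonneg _)
      rw [tangentParam_tangentCoord x h2.1]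
      exact (hy _ (hseg r ⟨hr'.1, hr'.2.le.trans ht.2⟩)).2
  have hcont : ContinuousOn (fun t ↦ y (s₀ + t * (s - s₀))) (Icc 0 1) := fun t ht ↦
    (ContinuousAt.comp (f := fun t ↦ s₀ + t * (s - s₀)) (g := y)
      (hy _ (hseg t ht)).1.continuousAt (by fun_prop)).continuousWithinAt
  have hr : 0 < r / 2 := dist_nonneg.trans_lt h0
  have hin := mem_of_forall_mem_closed hcont hOo hQc hOQ
    (by
      simp only [zero_mul, add_zero]
      exact ⟨hsrc, Metric.mem_ball.2 (by linarith)⟩)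
    (fun t ht hrt ↦ by
      refine ⟨(hQ _ (hrt t ⟨ht.1, le_rfl⟩)).1, ?_⟩
      have h1 := hest t ht hrt
      -- The sign of `ε` is not a hypothesis: it is read off from `hX` at a point of the curve.
      have hε : 0 ≤ ε * |s - s₀| := by
        have h2 := hest 0 ⟨le_rfl, zero_le_one⟩
        have h3 := hX _ (hQ _ (hrt t ⟨ht.1, le_rfl⟩)).2 (by
          rw [tangentParam_tangentCoord x (hQ _ (hrt t ⟨ht.1, le_rfl⟩)).1]
          exact (hy _ (hseg t ht)).2)
        exact mul_nonneg ((norm_nonneg _).trans h3) (abs_nonneg _)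
      have h2 : ‖(t * (s - s₀)) • w‖ ≤ ‖w‖ * |s - s₀| := by
        rw [norm_smul, Real.norm_eq_abs, abs_mul, abs_of_nonneg ht.1, mul_comm ‖w‖]
        exact mul_le_mul_of_nonneg_right
          (mul_le_of_le_one_left (abs_nonneg _) ht.2) (norm_nonneg _)
      rw [mem_preimage, Metric.mem_ball, dist_eq_norm]
      rw [dist_eq_norm] at h0
      calc _ = ‖(tangentCoord E x (y (s₀ + t * (s - s₀))) - tangentCoord E x (y s₀)
            - (t * (s - s₀)) • w) + (t * (s - s₀)) • w + (tangentCoord E x (y s₀) - p₀)‖ := by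
              congr 1; abel
        _ ≤ ε * |s - s₀| * t + ‖w‖ * |s - s₀| + ‖tangentCoord E x (y s₀) - p₀‖ :=
          (norm_add_le _ _).trans (add_le_add_left ((norm_add_le _ _).trans (add_le_add h1 h2)) _)
        _ < r := by nlinarith [mul_le_mul_of_nonneg_left ht.2 hε])
  have hfin := hin 1 ⟨zero_le_one, le_rfl⟩
  have hest1 := hest 1 ⟨zero_le_one, le_rfl⟩ (fun t ht ↦ hOQ (hin t ht))
  simp only [one_mul, mul_one, add_sub_cancel] at hfin hest1
  exact ⟨hfin.1, hfin.2, hest1⟩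

variable (h) in
/-- The sprays `S i` converge to `S₀` along the filter `l` for the `C⁰`-fine topology over the
part of the unit sphere bundle which lies above `A`. -/
def IsFineLimit {ι : Type*} (A : Set M) (l : Filter ι) (S : ι → Spray E M) (S₀ : Spray E M) :
    Prop :=
  ∀ O : Set (TangentBundle 𝓘(ℝ, E).tangent (TangentBundle 𝓘(ℝ, E) M)), IsOpen O →
    (∀ u ∈ unitSphereBundle h, S₀.total u ∈ O) →
    ∀ᶠ i in l, ∀ u ∈ unitSphereBundle h, u.proj ∈ A → (S i).total u ∈ O

variable {ι : Type*} {A : Set M} {l : Filter ι} {S : ι → Spray E M} {S₀ : Spray E M}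

/-- Fine convergence only concerns unit vectors. Homogeneity writes the arc field at `p` as the
fiber scaling of the spray at the normalized vector, which carries the convergence to all nonzero
vectors. It is joint in the spray and the point, and restricted to points above `A`, where the
sprays are controlled. -/
lemma IsFineLimit.tendsto_arcField (hl : IsFineLimit h A l S S₀) (hS : ∀ i, (S i).IsHomogeneous 2)
    (hS₀ : S₀.IsHomogeneous 2) (x : M) {p₀ : E × E} (hp : p₀.1 ∈ (extChartAt 𝓘(ℝ, E) x).target)
    (he : 0 < energy h (tangentParam E x p₀)) :
    Filter.Tendsto (fun q : ι × (E × E) ↦ (S q.1).arcField h x q.2)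
      (l ×ˢ 𝓝[{p | (tangentParam E x p).proj ∈ A}] p₀) (𝓝 (S₀.arcField h x p₀)) := by
  have := t2Space_tangentBundle (E := E) (M := M)
  have := locallyCompactSpace_tangentBundle (E := E) (M := M)
  let N : E × E → ℝ := fun p ↦ √(energy h (tangentParam E x p))
  let n : E × E → E × E := fun p ↦ fiberSMul E (N p)⁻¹ p
  have hNc : ContinuousAt N p₀ := ((continuous_energy h).continuousAt.comp
    (contMDiffAt_tangentParam x hp).continuousAt).sqrt
  have htgt : ∀ᶠ p : E × E in 𝓝 p₀, p.1 ∈ (extChartAt 𝓘(ℝ, E) x).target :=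
    (isOpen_tangent_target E x).mem_nhds hp
  have hN0 : 0 < N p₀ := Real.sqrt_pos.2 he
  have hnc : ContinuousAt n p₀ :=
    continuousAt_fst.prodMk ((hNc.inv₀ hN0.ne').smul continuousAt_snd)
  have key : ∀ (T : Spray E M), T.IsHomogeneous 2 → ∀ p : E × E,
      p.1 ∈ (extChartAt 𝓘(ℝ, E) x).target → 0 < N p →
      T.arcField h x p = fiberSMul E (N p) (T.coord x (n p)) := by
    intro T hT p hp hNp
    have h1 : p = fiberSMul E (N p) (n p) := by simp [n, smul_smul, hNp.ne']
    have h2 := T.coord_fiberSMul hT x (p := n p) hp hNp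
    rw [← h1] at h2
    rw [Spray.arcField, h2, smul_smul, inv_mul_cancel₀ hNp.ne', one_smul]
  have hnt : tangentParam E x (n p₀) = tangentSMul (N p₀)⁻¹ (tangentParam E x p₀) :=
    tangentParam_fiberSMul _ _ _
  have hcoord : Filter.Tendsto (fun q : ι × (E × E) ↦ (S q.1).coord x (n q.2))
      (l ×ˢ 𝓝[{p | (tangentParam E x p).proj ∈ A}] p₀) (𝓝 (S₀.coord x (n p₀))) := by
    intro V hV
    obtain ⟨V', hV'V, hV'o, hV'⟩ := mem_nhds_iff.1 hV
    let Ω : Set (TangentBundle 𝓘(ℝ, E).tangent (TangentBundle 𝓘(ℝ, E) M)) :=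
      {ξ | ξ.proj.proj ∈ (extChartAt 𝓘(ℝ, E) x).source} ∩ fieldCoord x ⁻¹' V'
    have hpr : Continuous fun ξ : TangentBundle 𝓘(ℝ, E).tangent (TangentBundle 𝓘(ℝ, E) M) ↦
      ξ.proj := FiberBundle.continuous_proj (E × E) (TangentSpace 𝓘(ℝ, E).tangent)
    have hΩ : IsOpen Ω := ContinuousOn.isOpen_inter_preimage
      (fun ξ hξ ↦ (contMDiffAt_fieldCoord x hξ).continuousAt.continuousWithinAt)
      ((isOpen_tangent_source E x).preimage hpr) hV'o
    have hn₀ : S₀.total (tangentParam E x (n p₀)) ∈ Ω :=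
      ⟨(extChartAt 𝓘(ℝ, E) x).map_target hp, hV'⟩
    obtain ⟨Q, ⟨hQ, hQc⟩, hQΩ⟩ := (closed_nhds_basis (tangentParam E x (n p₀))).mem_iff.1
      ((hΩ.preimage S₀.continuous_total).mem_nhds hn₀)
    -- A local condition near one unit vector is made into an open set containing the whole image of
    -- `S₀`: membership in `Ω` is only required above the closed neighbourhood `Q`.
    have hO := hl (Ω ∪ {ξ | ξ.proj ∈ Qᶜ}) (hΩ.union (hQc.isOpen_compl.preimage hpr)) (fun u hu ↦ by
      by_cases huQ : u ∈ Q
      · exact Or.inl (hQΩ huQ)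
      · exact Or.inr huQ)
    have hmem : ∀ᶠ p in 𝓝[{p | (tangentParam E x p).proj ∈ A}] p₀,
        0 < N p ∧ p.1 ∈ (extChartAt 𝓘(ℝ, E) x).target ∧ tangentParam E x (n p) ∈ Q ∧
          (tangentParam E x p).proj ∈ A := by
      have h1 : ∀ᶠ p in 𝓝 p₀, 0 < N p ∧ p.1 ∈ (extChartAt 𝓘(ℝ, E) x).target ∧
          tangentParam E x (n p) ∈ Q := by
        refine (hNc.eventually_const_lt hN0).and
          (htgt.and ?_)
        exact (ContinuousAt.comp (f := n) (g := tangentParam E x)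
          (contMDiffAt_tangentParam x (p := n p₀) hp).continuousAt hnc).eventually hQ
      filter_upwards [h1.filter_mono nhdsWithin_le_nhds, self_mem_nhdsWithin] with p hp1 hp2
      exact ⟨hp1.1, hp1.2.1, hp1.2.2, hp2⟩
    refine Filter.mem_map.2 ?_
    filter_upwards [hO.prod_mk hmem] with q hq
    obtain ⟨hq1, hq2, hq3, hq4, hq5⟩ := hq
    have he : 0 < energy h (tangentParam E x q.2) := Real.sqrt_pos.1 hq2
    have h1 : tangentParam E x (n q.2) = tangentSMul (N q.2)⁻¹ (tangentParam E x q.2) :=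
      tangentParam_fiberSMul _ _ _
    have h2 := hq1 (tangentParam E x (n q.2))
      (h1 ▸ tangentSMul_mem_unitSphereBundle he) hq5
    rcases h2 with h2 | h2
    · exact hV'V h2.2
    · exact absurd hq4 h2
  have hN2 : Filter.Tendsto (fun q : ι × (E × E) ↦ N q.2)
      (l ×ˢ 𝓝[{p | (tangentParam E x p).proj ∈ A}] p₀) (𝓝 (N p₀)) :=
    (hNc.tendsto.mono_left nhdsWithin_le_nhds).comp Filter.tendsto_snd
  rw [key S₀ hS₀ p₀ hp hN0]
  have hlim : Filter.Tendsto (fun q : ι × (E × E) ↦ fiberSMul E (N q.2) ((S q.1).coord x (n q.2)))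
      (l ×ˢ 𝓝[{p | (tangentParam E x p).proj ∈ A}] p₀)
      (𝓝 (fiberSMul E (N p₀) (S₀.coord x (n p₀)))) :=
    (hcoord.fst_nhds).prodMk_nhds (hN2.smul hcoord.snd_nhds)
  refine hlim.congr' ?_
  have h1 : ∀ᶠ p in 𝓝 p₀, 0 < N p ∧ p.1 ∈ (extChartAt 𝓘(ℝ, E) x).target :=
    (hNc.eventually_const_lt hN0).and htgt
  filter_upwards [Filter.tendsto_snd.eventually (h1.filter_mono nhdsWithin_le_nhds)] with q hq
  exact (key _ (hS q.1) _ hq.2 hq.1).symm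

end limits
end

/-! ### Limits of arc curves of converging sprays. -/

noncomputable section

variable {E : Type*} [NormedAddCommGroup E] [NormedSpace ℝ E]
  {M : Type*} [TopologicalSpace M] [ChartedSpace E M] [IsManifold 𝓘(ℝ, E) ∞ M]

section limits
variable [FiniteDimensional ℝ E] [T2Space M]
variable {h : ContMDiffRiemannianMetric 𝓘(ℝ, E) ∞ E (fun x : M ↦ TangentSpace 𝓘(ℝ, E) x)}

variable {ι : Type*} {A : Set M} {l : Filter ι} {S : ι → Spray E M} {S₀ : Spray E M}

/-- The point is that `τ` does not depend on `i`: all the curves starting near `u` have, for the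
same length, the first-order expansion dictated by `S₀`. The base parameter may vary with `i`, since
it will be an endpoint of a varying interval. -/
lemma IsFineLimit.eventually_estimate (hl : IsFineLimit h A l S S₀)
    (hS : ∀ i, (S i).IsHomogeneous 2) (hS₀ : S₀.IsHomogeneous 2) {a b s₀ : ι → ℝ}
    {y : ι → ℝ → TangentBundle 𝓘(ℝ, E) M}
    (hy : ∀ᶠ i in l, ∀ s ∈ Icc (a i) (b i), (S i).IsArcCurveAt h (y i) s ∧ (y i s).proj ∈ A)
    (hs₀ : ∀ᶠ i in l, s₀ i ∈ Icc (a i) (b i)) {u : TangentBundle 𝓘(ℝ, E) M}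
    (hu : Filter.Tendsto (fun i ↦ y i (s₀ i)) l (𝓝 u)) (he : 0 < energy h u) {x : M}
    (hx : u.proj ∈ (extChartAt 𝓘(ℝ, E) x).source) {ε : ℝ} (hε : 0 < ε)
    {O : Set (TangentBundle 𝓘(ℝ, E) M)} (hO : O ∈ 𝓝 u) :
    ∃ τ > 0, ∀ᶠ i in l, ∀ s ∈ Icc (a i) (b i), |s - s₀ i| ≤ τ →
      y i s ∈ O ∧ ‖tangentCoord E x (y i s) - tangentCoord E x (y i (s₀ i))
        - (s - s₀ i) • S₀.arcField h x (tangentCoord E x u)‖ ≤ ε * |s - s₀ i| := by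
  set p₀ := tangentCoord E x u with hp₀
  set w := S₀.arcField h x p₀ with hw
  have hp : p₀.1 ∈ (extChartAt 𝓘(ℝ, E) x).target := mem_target_tangentCoord x hx
  have hup : tangentParam E x p₀ = u := tangentParam_tangentCoord x hx
  have h1 := hl.tendsto_arcField hS hS₀ x hp (by rwa [hup])
  have h2 := h1.eventually (Metric.ball_mem_nhds w hε)
  obtain ⟨pa, hpa, pb, hpb, hab⟩ := Filter.eventually_prod_iff.1 h2
  have h3 := eventually_nhdsWithin_iff.1 hpb
  have h4 : ∀ᶠ p : E × E in 𝓝 p₀, p.1 ∈ (extChartAt 𝓘(ℝ, E) x).target :=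
    (isOpen_tangent_target E x).mem_nhds hp
  have h5 : ∀ᶠ p : E × E in 𝓝 p₀, tangentParam E x p ∈ O :=
    (contMDiffAt_tangentParam x hp).continuousAt.eventually (by rwa [hup])
  obtain ⟨r₀, hr₀, hr⟩ := Metric.eventually_nhds_iff_ball.1 (h3.and (h4.and h5))
  have hsub : Metric.closedBall p₀ (r₀ / 2) ⊆ Metric.ball p₀ r₀ :=
    Metric.closedBall_subset_ball (by linarith)
  have hwε : 0 < ‖w‖ + ε := by positivity
  -- With this length the displacement `(‖w‖ + ε) τ` is `r₀ / 8`, below the `r₀ / 4` allowed by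
  -- `Spray.IsArcCurveAt.estimate` on the ball of radius `r₀ / 2`.
  refine ⟨r₀ / (8 * (‖w‖ + ε)), by positivity, ?_⟩
  have h6 : ∀ᶠ i in l, (y i (s₀ i)).proj ∈ (extChartAt 𝓘(ℝ, E) x).source :=
    hu.eventually ((isOpen_tangent_source E x).mem_nhds hx)
  have h7 : ∀ᶠ i in l, dist (tangentCoord E x (y i (s₀ i))) p₀ < r₀ / 2 / 2 :=
    ((contMDiffAt_tangentCoord x hx).continuousAt.tendsto.comp hu).eventually
      (Metric.ball_mem_nhds p₀ (by positivity))
  filter_upwards [hpa, h6, h7, hs₀, hy] with i hi1 hi2 hi3 hi4 hi5 s hs hsτ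
  have hseg : uIcc (s₀ i) s ⊆ Icc (a i) (b i) := ordConnected_Icc.uIcc_subset hi4 hs
  obtain ⟨k1, k2, k3⟩ := Spray.IsArcCurveAt.estimate (S := S i) (A := A) (y := y i) (x := x)
    (p₀ := p₀) (w := w) (r := r₀ / 2) (ε := ε) (s₀ := s₀ i) (s := s)
    (fun p hp ↦ (hr p (hsub hp)).2.1) (fun t ht ↦ hi5 t (hseg ht))
    (fun p hp hpA ↦ by
      have := hab hi1 ((hr p (hsub hp)).1 hpA)
      rw [dist_eq_norm] at this
      exact this.le) hi2 hi3 (by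
      have := mul_le_mul_of_nonneg_left hsτ hwε.le
      have e : (‖w‖ + ε) * (r₀ / (8 * (‖w‖ + ε))) = r₀ / 8 := by field_simp
      linarith)
  refine ⟨?_, k3⟩
  have := (hr _ (hsub (Metric.ball_subset_closedBall k2))).2.2
  rwa [tangentParam_tangentCoord x k1] at this

/-- Unit speed curves are locally uniformly equicontinuous. -/
lemma IsFineLimit.eventually_mem (hl : IsFineLimit h A l S S₀)
    (hS : ∀ i, (S i).IsHomogeneous 2) (hS₀ : S₀.IsHomogeneous 2) {a b s₀ : ι → ℝ}
    {y : ι → ℝ → TangentBundle 𝓘(ℝ, E) M}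
    (hy : ∀ᶠ i in l, ∀ s ∈ Icc (a i) (b i), (S i).IsArcCurveAt h (y i) s ∧ (y i s).proj ∈ A)
    (hs₀ : ∀ᶠ i in l, s₀ i ∈ Icc (a i) (b i)) {u : TangentBundle 𝓘(ℝ, E) M}
    (hu : Filter.Tendsto (fun i ↦ y i (s₀ i)) l (𝓝 u)) (he : 0 < energy h u)
    {O : Set (TangentBundle 𝓘(ℝ, E) M)} (hO : O ∈ 𝓝 u) :
    ∃ τ > 0, ∀ᶠ i in l, ∀ s ∈ Icc (a i) (b i), |s - s₀ i| ≤ τ → y i s ∈ O := by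
  obtain ⟨τ, hτ, hev⟩ := hl.eventually_estimate hS hS₀ hy hs₀ hu he
    (mem_extChartAt_source (I := 𝓘(ℝ, E)) u.proj) one_pos hO
  exact ⟨τ, hτ, hev.mono fun i hi s hs hs' ↦ (hi s hs hs').1⟩

/-- The uniform expansion with error `ε |t - s|` survives pointwise limits, and having it for every
`ε` is differentiability of the limit with the prescribed derivative. No convergence of derivatives
is used. -/
lemma IsFineLimit.isArcCurveAt (hl : IsFineLimit h A l S S₀) [l.NeBot]
    (hS : ∀ i, (S i).IsHomogeneous 2) (hS₀ : S₀.IsHomogeneous 2) {a b : ι → ℝ}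
    {y : ι → ℝ → TangentBundle 𝓘(ℝ, E) M}
    (hy : ∀ i, ∀ s ∈ Icc (a i) (b i), (S i).IsArcCurveAt h (y i) s ∧ (y i s).proj ∈ A)
    {I : Set ℝ} (hIo : IsOpen I) (hI : ∀ s ∈ I, ∀ᶠ i in l, s ∈ Icc (a i) (b i))
    {y₀ : ℝ → TangentBundle 𝓘(ℝ, E) M}
    (hlim : ∀ s ∈ I, Filter.Tendsto (fun i ↦ y i s) l (𝓝 (y₀ s)))
    {s : ℝ} (hs : s ∈ I) (he : 0 < energy h (y₀ s)) : S₀.IsArcCurveAt h y₀ s := by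
  have := t2Space_tangentBundle (E := E) (M := M)
  have := locallyCompactSpace_tangentBundle (E := E) (M := M)
  set x := (y₀ s).proj
  have hx : (y₀ s).proj ∈ (extChartAt 𝓘(ℝ, E) x).source := mem_extChartAt_source _
  obtain ⟨Q, ⟨hQ, hQc⟩, hQs⟩ := (closed_nhds_basis (y₀ s)).mem_iff.1
    ((isOpen_tangent_source E x).mem_nhds hx)
  have key : ∀ ε > 0, ∀ᶠ t in 𝓝 s, y₀ t ∈ Q ∧
      ‖tangentCoord E x (y₀ t) - tangentCoord E x (y₀ s)
        - (t - s) • S₀.arcField h x (tangentCoord E x (y₀ s))‖ ≤ ε * |t - s| := by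
    intro ε hε
    obtain ⟨τ, hτ, hev⟩ := hl.eventually_estimate hS hS₀ (.of_forall hy) (s₀ := fun _ ↦ s)
      (hI s hs) (hlim s hs) he hx hε hQ
    have hτ' : ∀ᶠ t in 𝓝 s, |t - s| ≤ τ := by
      filter_upwards [Metric.ball_mem_nhds s hτ] with t ht
      exact (Metric.mem_ball.1 ht).le
    filter_upwards [hτ', hIo.mem_nhds hs] with t ht htI
    have hmem : ∀ᶠ i in l, y i t ∈ Q := by
      filter_upwards [hev, hI t htI] with i hi1 hi2 using (hi1 t hi2 ht).1
    have hQt : y₀ t ∈ Q := hQc.mem_of_tendsto (hlim t htI) hmem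
    refine ⟨hQt, ?_⟩
    have hc1 := (contMDiffAt_tangentCoord x (hQs hQt)).continuousAt.tendsto.comp (hlim t htI)
    have hc2 := (contMDiffAt_tangentCoord x hx).continuousAt.tendsto.comp (hlim s hs)
    refine le_of_tendsto ((hc1.sub hc2).sub_const _).norm ?_
    filter_upwards [hev, hI t htI] with i hi1 hi2 using (hi1 t hi2 ht).2
  refine Spray.isArcCurveAt_of_hasDerivAt x he ((key 1 one_pos).mono fun t ht ↦ hQs ht.1) ?_
  rw [hasDerivAt_iff_isLittleO, Asymptotics.isLittleO_iff]
  intro ε hε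
  exact (key ε hε).mono fun t ht ↦ ht.2

omit [FiniteDimensional ℝ E] [T2Space M] in
variable (h) in
lemma isClosed_unitSphereBundle : IsClosed (unitSphereBundle h) :=
  isClosed_eq (continuous_energy h) continuous_const

omit [T2Space M] in
variable (h) in
-- The unit sphere bundle above `A` is compact. The bound is strict so that it defines an open
-- subset of `TTM`, which nearby sprays then also respect.
lemma exists_abs_energyDeriv_lt (hA : IsCompact A) (S₀ : Spray E M) :
    ∃ C, ∀ u ∈ unitSphereBundle h, u.proj ∈ A → |energyDeriv h (S₀.total u)| < C := by
  have hK : IsCompact (unitSphereBundle h ∩ {u | u.proj ∈ A ∧ energy h u ≤ 1}) :=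
    (isCompact_energy_le h hA 1).inter_left (isClosed_unitSphereBundle h)
  obtain ⟨C, hC⟩ := hK.bddAbove_image
    (f := fun u ↦ |energyDeriv h (S₀.total u)|)
    ((continuous_energyDeriv h).comp S₀.continuous_total).abs.continuousOn
  refine ⟨C + 1, fun u hu huA ↦ ?_⟩
  have : energy h u = 1 := hu
  have := hC (mem_image_of_mem _ ⟨hu, huA, this.le⟩)
  exact lt_of_le_of_lt this (by linarith)

lemma IsFineLimit.eventually_abs_energyDeriv_le (hl : IsFineLimit h A l S S₀) (hA : IsCompact A) :
    ∃ C, 0 ≤ C ∧ ∀ᶠ i in l, ∀ u ∈ unitSphereBundle h, u.proj ∈ A →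
      |energyDeriv h ((S i).total u)| ≤ C := by
  obtain ⟨C, hC⟩ := exists_abs_energyDeriv_lt h hA S₀
  have hpr : Continuous fun ξ : TangentBundle 𝓘(ℝ, E).tangent (TangentBundle 𝓘(ℝ, E) M) ↦
    ξ.proj.proj := (FiberBundle.continuous_proj E (TangentSpace 𝓘(ℝ, E))).comp
      (FiberBundle.continuous_proj (E × E) (TangentSpace 𝓘(ℝ, E).tangent))
  have h1 := hl ({ξ | |energyDeriv h ξ| < C} ∪ {ξ | ξ.proj.proj ∈ Aᶜ})
    ((isOpen_lt (continuous_energyDeriv h).abs continuous_const).union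
      (hA.isClosed.isOpen_compl.preimage hpr)) (fun u hu ↦ by
      by_cases huA : u.proj ∈ A
      · exact Or.inl (hC u hu huA)
      · exact Or.inr huA)
  refine ⟨|C|, abs_nonneg C, h1.mono fun i hi u hu huA ↦ ?_⟩
  rcases hi u hu huA with h2 | h2
  · exact h2.le.trans (le_abs_self C)
  · exact absurd huA h2

variable {𝒰 : Ultrafilter ι}

omit [T2Space M] in
-- The two-sided logarithmic bound confines the vectors to a compact set and also keeps their limit
-- off the zero section.
lemma exists_tendsto_of_abs_log_energy_le (hA : IsCompact A) {v : ι → TangentBundle 𝓘(ℝ, E) M}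
    {R : ℝ} (hv : ∀ᶠ i in 𝒰, (v i).proj ∈ A ∧ 0 < energy h (v i) ∧
      |Real.log (energy h (v i))| ≤ R) :
    ∃ u, Filter.Tendsto v 𝒰 (𝓝 u) ∧ u.proj ∈ A ∧ 0 < energy h u := by
  have h1 : ∀ᶠ i in 𝒰, v i ∈ {v | v.proj ∈ A ∧ energy h v ≤ Real.exp R} ∧
      Real.exp (-R) ≤ energy h (v i) := by
    filter_upwards [hv] with i hi
    have h2 := abs_le.1 hi.2.2
    exact ⟨⟨hi.1, (Real.log_le_iff_le_exp hi.2.1).1 h2.2⟩, (Real.le_log_iff_exp_le hi.2.1).1 h2.1⟩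
  obtain ⟨u, hu, hlim⟩ := (isCompact_energy_le h hA (Real.exp R)).ultrafilter_le_nhds (𝒰.map v)
    (Filter.le_principal_iff.2 (h1.mono fun i hi ↦ hi.1))
  refine ⟨u, hlim, hu.1, (Real.exp_pos (-R)).trans_le ?_⟩
  exact ge_of_tendsto (((continuous_energy h).tendsto u).comp hlim) (h1.mono fun i hi ↦ hi.2)

variable {a b : ι → ℝ} {y : ι → ℝ → TangentBundle 𝓘(ℝ, E) M}

lemma IsFineLimit.exists_tendsto (hl : IsFineLimit h A 𝒰 S S₀) (hA : IsCompact A)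
    (hS : ∀ i, (S i).IsHomogeneous 2)
    (hy : ∀ i, ∀ s ∈ Icc (a i) (b i), (S i).IsArcCurveAt h (y i) s ∧ (y i s).proj ∈ A)
    (h0 : ∀ i, (0 : ℝ) ∈ Icc (a i) (b i)) (h1 : ∀ i, energy h (y i 0) = 1)
    {s : ι → ℝ} (hs : ∀ᶠ i in 𝒰, s i ∈ Icc (a i) (b i)) {L : ℝ} (hL : ∀ᶠ i in 𝒰, |s i| ≤ L) :
    ∃ u, Filter.Tendsto (fun i ↦ y i (s i)) 𝒰 (𝓝 u) ∧ u.proj ∈ A ∧ 0 < energy h u := by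
  obtain ⟨C, hC0, hC⟩ := hl.eventually_abs_energyDeriv_le hA
  refine exists_tendsto_of_abs_log_energy_le hA (R := C * L) ?_
  filter_upwards [hC, hs, hL] with i hi1 hi2 hi3
  refine ⟨(hy i _ hi2).2, (hy i _ hi2).1.1, ?_⟩
  have h2 := abs_log_energy_sub_le (hS i) hi1 (y := y i) (s := 0) (t := s i)
    (fun r hr ↦ hy i r (ordConnected_Icc.uIcc_subset (h0 i) hi2 hr))
  rw [h1, Real.log_one, sub_zero, sub_zero] at h2
  exact h2.trans (mul_le_mul_of_nonneg_left hi3 hC0)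

/-- Limits of unit speed geodesics of sprays which converge to `S₀` are geodesics of `S₀`. -/
lemma IsFineLimit.exists_limit_curve (hl : IsFineLimit h A 𝒰 S S₀) (hA : IsCompact A)
    (hS : ∀ i, (S i).IsHomogeneous 2) (hS₀ : S₀.IsHomogeneous 2)
    (hy : ∀ i, ∀ s ∈ Icc (a i) (b i), (S i).IsArcCurveAt h (y i) s ∧ (y i s).proj ∈ A)
    (h0 : ∀ i, (0 : ℝ) ∈ Icc (a i) (b i)) (h1 : ∀ i, energy h (y i 0) = 1)
    {I : Set ℝ} (hIo : IsOpen I) (hI : ∀ s ∈ I, ∀ᶠ i in 𝒰, s ∈ Icc (a i) (b i)) :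
    ∃ y₀ : ℝ → TangentBundle 𝓘(ℝ, E) M, ∀ s ∈ I, S₀.IsArcCurveAt h y₀ s ∧ (y₀ s).proj ∈ A ∧
      Filter.Tendsto (fun i ↦ y i s) 𝒰 (𝓝 (y₀ s)) := by
  have : ∀ s : ℝ, ∃ u, s ∈ I → Filter.Tendsto (fun i ↦ y i s) 𝒰 (𝓝 u) ∧ u.proj ∈ A ∧
      0 < energy h u := fun s ↦ by
    by_cases hs : s ∈ I
    · obtain ⟨u, hu⟩ := hl.exists_tendsto hA hS hy h0 h1 (s := fun _ ↦ s) (hI s hs) (L := |s|)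
        (Filter.Eventually.of_forall fun _ ↦ le_rfl)
      exact ⟨u, fun _ ↦ hu⟩
    · obtain ⟨i⟩ := 𝒰.neBot.nonempty
      exact ⟨y i 0, fun h ↦ absurd h hs⟩
  choose y₀ hy₀ using this
  exact ⟨y₀, fun s hs ↦ ⟨hl.isArcCurveAt hS hS₀ hy hIo hI (fun s hs ↦ (hy₀ s hs).1) hs
    (hy₀ s hs).2.2, (hy₀ s hs).2.1, (hy₀ s hs).1⟩⟩

end limits
end

/-! ### Changes of parameter between geodesics and arc curves. -/

noncomputable section

/-- `σ : J → I` and `τ : I → J` are inverse increasing changes of parameter between open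
intervals, and `n > 0` is the derivative of `σ`. -/
structure IsReparam (J I : Set ℝ) (n σ τ : ℝ → ℝ) : Prop where
  isOpen : IsOpen I
  ordConnected : I.OrdConnected
  mapsTo : MapsTo σ J I
  mapsTo_symm : MapsTo τ I J
  left_inv : ∀ t ∈ J, τ (σ t) = t
  right_inv : ∀ s ∈ I, σ (τ s) = s
  hasDerivAt : ∀ t ∈ J, HasDerivAt σ (n t) t
  hasDerivAt_symm : ∀ s ∈ I, HasDerivAt τ (n (τ s))⁻¹ s
  strictMonoOn : StrictMonoOn σ J

lemma IsReparam.strictMonoOn_symm {J I : Set ℝ} {n σ τ : ℝ → ℝ} (hr : IsReparam J I n σ τ) :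
    StrictMonoOn τ I := fun s hs t ht hst ↦ by
  rw [← hr.strictMonoOn.lt_iff_lt (hr.mapsTo_symm hs) (hr.mapsTo_symm ht), hr.right_inv s hs,
    hr.right_inv t ht]
  exact hst

/-- The change of parameter is the primitive of `n` vanishing at `a`; positivity of `n` makes it
strictly increasing, with an inverse that is differentiable by the inverse function theorem. -/
lemma exists_isReparam {J : Set ℝ} (hJ : IsOpen J) (hJc : J.OrdConnected) {n : ℝ → ℝ}
    (hn : ContinuousOn n J) (hpos : ∀ t ∈ J, 0 < n t) {a : ℝ} (ha : a ∈ J) :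
    ∃ (I : Set ℝ) (σ τ : ℝ → ℝ), IsReparam J I n σ τ ∧ σ a = 0 := by
  let σ : ℝ → ℝ := fun t ↦ ∫ r in a..t, n r
  have hσ : ∀ t ∈ J, HasStrictDerivAt σ (n t) t := fun t ht ↦
    intervalIntegral.integral_hasStrictDerivAt_right
      ((hn.mono (hJc.uIcc_subset ha ht)).intervalIntegrable)
      (hn.stronglyMeasurableAtFilter hJ t ht) (hn.continuousAt (hJ.mem_nhds ht))
  have hmono : StrictMonoOn σ J := by
    refine strictMonoOn_of_deriv_pos hJc.convex
      (fun t ht ↦ (hσ t ht).hasDerivAt.continuousAt.continuousWithinAt) fun t ht ↦ ?_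
    rw [hJ.interior_eq] at ht
    rw [(hσ t ht).hasDerivAt.deriv]
    exact hpos t ht
  have hinv : ∀ t ∈ J, Function.invFunOn σ J (σ t) = t := fun t ht ↦
    hmono.injOn.leftInvOn_invFunOn ht
  refine ⟨σ '' J, σ, Function.invFunOn σ J, ⟨?_, ?_, mapsTo_image _ _, ?_, hinv, ?_,
    fun t ht ↦ (hσ t ht).hasDerivAt, ?_, hmono⟩, intervalIntegral.integral_same⟩
  · rw [isOpen_iff_mem_nhds]
    rintro _ ⟨t, ht, rfl⟩
    rw [← (hσ t ht).map_nhds_eq (hpos t ht).ne']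
    exact Filter.image_mem_map (hJ.mem_nhds ht)
  · exact (hJc.isPreconnected.image σ
      fun t ht ↦ (hσ t ht).hasDerivAt.continuousAt.continuousWithinAt).ordConnected
  · rintro _ ⟨t, ht, rfl⟩
    rwa [hinv t ht]
  · rintro _ ⟨t, ht, rfl⟩
    rw [hinv t ht]
  · rintro _ ⟨t, ht, rfl⟩
    rw [hinv t ht]
    exact ((hσ t ht).to_local_left_inverse (hpos t ht).ne'
      (Filter.eventually_of_mem (hJ.mem_nhds ht) hinv)).hasDerivAt

lemma not_bddAbove_of_le_deriv {σ σ' : ℝ → ℝ} {s₀ ε : ℝ} (hε : 0 < ε)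
    (hσ : ∀ s ∈ Ici s₀, HasDerivAt σ (σ' s) s) (hle : ∀ s ∈ Ici s₀, ε ≤ σ' s) (B : ℝ) :
    ∃ s ∈ Ici s₀, B < σ s := by
  have h1 : ∀ s ∈ Ici s₀, ε * (s - s₀) ≤ σ s - σ s₀ := fun s hs ↦
    (convex_Ici s₀).mul_sub_le_image_sub_of_le_deriv
      (fun s hs ↦ (hσ s hs).continuousAt.continuousWithinAt)
      (fun s hs ↦ (hσ s (interior_subset hs)).differentiableAt.differentiableWithinAt)
      (fun s hs ↦ by rw [(hσ s (interior_subset hs)).deriv]; exact hle s (interior_subset hs))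
      s₀ self_mem_Ici s hs hs
  have hpos : 0 ≤ (|B - σ s₀| + 1) / ε := by positivity
  have hs : s₀ + (|B - σ s₀| + 1) / ε ∈ Ici s₀ := by simpa using hpos
  refine ⟨_, hs, ?_⟩
  have h2 := h1 _ hs
  rw [add_sub_cancel_left, mul_div_cancel₀ _ hε.ne'] at h2
  linarith [le_abs_self (B - σ s₀)]

variable {E : Type*} [NormedAddCommGroup E] [NormedSpace ℝ E]
  {M : Type*} [TopologicalSpace M] [ChartedSpace E M] [IsManifold 𝓘(ℝ, E) ∞ M]

namespace Spray
variable {S : Spray E M} {c : ℝ → M} {J : Set ℝ}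

lemma IsGeodesicOn.hasMFDerivAt (hc : S.IsGeodesicOn c J) {t : ℝ} (ht : t ∈ J) :
    HasMFDerivAt 𝓘(ℝ, ℝ) 𝓘(ℝ, E).tangent (curveLift E c) t
      ((1 : ℝ →L[ℝ] ℝ).smulRight (S.toFun (curveLift E c t))) :=
  (hc.isMIntegralCurveOn t ht).hasMFDerivAt (hc.isOpen.mem_nhds ht)

/-- The second-order condition says that the projection of an integral curve has velocity `dπ(S(v))
= v`, so every integral curve is the lift of its projection. -/
lemma curveLift_eq_of_hasMFDerivAt {v : ℝ → TangentBundle 𝓘(ℝ, E) M} {t : ℝ}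
    (hv : HasMFDerivAt 𝓘(ℝ, ℝ) 𝓘(ℝ, E).tangent v t ((1 : ℝ →L[ℝ] ℝ).smulRight (S.toFun (v t)))) :
    curveLift E (fun t ↦ (v t).proj) t = v t := by
  have h0 := (((contMDiff_proj (IB := 𝓘(ℝ, E)) (n := ∞) (F := E)
    (TangentSpace 𝓘(ℝ, E) : M → Type _)).contMDiffAt
      (x := v t)).mdifferentiableAt (by simp)).hasMFDerivAt
  have h1 := (h0.comp t hv).mfderiv
  refine TotalSpace.ext rfl (heq_of_eq ?_)
  refine (congrArg (fun L ↦ L (1 : ℝ)) h1).trans ?_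
  refine Eq.trans ?_ (S.second_order (v t))
  exact congrArg (mfderiv 𝓘(ℝ, E).tangent 𝓘(ℝ, E)
    (fun w : TangentBundle 𝓘(ℝ, E) M ↦ w.proj) (v t)) (one_smul ℝ (S.toFun (v t)))

lemma isGeodesicOn_proj (hJ : IsOpen J) (hJc : J.OrdConnected) (hJn : J.Nonempty)
    {v : ℝ → TangentBundle 𝓘(ℝ, E) M}
    (hv : ∀ t ∈ J, HasMFDerivAt 𝓘(ℝ, ℝ) 𝓘(ℝ, E).tangent v t
      ((1 : ℝ →L[ℝ] ℝ).smulRight (S.toFun (v t)))) :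
    S.IsGeodesicOn (fun t ↦ (v t).proj) J := by
  refine ⟨hJ, hJc, hJn, fun t ht ↦ HasMFDerivAt.hasMFDerivWithinAt ?_⟩
  rw [curveLift_eq_of_hasMFDerivAt (hv t ht)]
  refine (hv t ht).congr_of_eventuallyEq ?_
  filter_upwards [hJ.mem_nhds ht] with r hr using curveLift_eq_of_hasMFDerivAt (hv r hr)

lemma hasMFDerivAt_comp {y : ℝ → TangentBundle 𝓘(ℝ, E) M} {τ : ℝ → ℝ} {s a r : ℝ}
    (hy : HasMFDerivAt 𝓘(ℝ, ℝ) 𝓘(ℝ, E).tangent y (τ s)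
      ((1 : ℝ →L[ℝ] ℝ).smulRight (a • S.toFun (y (τ s))))) (hτ : HasDerivAt τ r s) :
    HasMFDerivAt 𝓘(ℝ, ℝ) 𝓘(ℝ, E).tangent (fun s ↦ y (τ s)) s
      ((1 : ℝ →L[ℝ] ℝ).smulRight ((r * a) • S.toFun (y (τ s)))) := by
  refine HasMFDerivAt.congr_mfderiv (hy.comp s hτ.hasFDerivAt.hasMFDerivAt) ?_
  refine ContinuousLinearMap.ext fun q ↦ ?_
  change ((id q : ℝ) • r) • (a • S.toFun (y (τ s))) = (id q : ℝ) • ((r * a) • S.toFun (y (τ s)))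
  rw [smul_smul, smul_smul, smul_eq_mul, mul_assoc]

lemma IsGeodesicOn.continuousOn_curveLift (hc : S.IsGeodesicOn c J) :
    ContinuousOn (curveLift E c) J :=
  fun _ ht ↦ (hc.hasMFDerivAt ht).continuousAt.continuousWithinAt

lemma IsGeodesicOn.continuousOn (hc : S.IsGeodesicOn c J) : ContinuousOn c J :=
  (FiberBundle.continuous_proj E (TangentSpace 𝓘(ℝ, E) : M → Type _)).comp_continuousOn
    hc.continuousOn_curveLift

variable {h : ContMDiffRiemannianMetric 𝓘(ℝ, E) ∞ E (fun x : M ↦ TangentSpace 𝓘(ℝ, E) x)}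

/-- Geodesics with nonvanishing velocity can be parametrized by arc length. -/
lemma IsGeodesicOn.exists_arcCurve (hc : S.IsGeodesicOn c J)
    (hpos : ∀ t ∈ J, 0 < energy h (curveLift E c t)) {a : ℝ} (ha : a ∈ J) :
    ∃ (I : Set ℝ) (σ τ : ℝ → ℝ), IsReparam J I (fun t ↦ √(energy h (curveLift E c t))) σ τ ∧
      σ a = 0 ∧ ∀ s ∈ I, S.IsArcCurveAt h (fun s ↦ curveLift E c (τ s)) s := by
  obtain ⟨I, σ, τ, hr, h0⟩ := exists_isReparam hc.isOpen hc.ordConnected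
    (((continuous_energy h).comp_continuousOn hc.continuousOn_curveLift).sqrt)
    (fun t ht ↦ Real.sqrt_pos.2 (hpos t ht)) ha
  refine ⟨I, σ, τ, hr, h0, fun s hs ↦ ⟨hpos _ (hr.mapsTo_symm hs), ?_⟩⟩
  have h1 := hc.hasMFDerivAt (hr.mapsTo_symm hs)
  rw [← one_smul ℝ (S.toFun _)] at h1
  have h2 := hasMFDerivAt_comp h1 (hr.hasDerivAt_symm s hs)
  rwa [mul_one] at h2

/-- The curves parametrized by arc length come from geodesics. -/
lemma exists_geodesic_of_arcCurve {I : Set ℝ} (hI : IsOpen I) (hIc : I.OrdConnected)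
    {y : ℝ → TangentBundle 𝓘(ℝ, E) M} (hy : ∀ s ∈ I, S.IsArcCurveAt h y s) {a : ℝ} (ha : a ∈ I) :
    ∃ (J : Set ℝ) (σ τ : ℝ → ℝ), IsReparam I J (fun s ↦ (√(energy h (y s)))⁻¹) σ τ ∧
      S.IsGeodesicOn (fun t ↦ (y (τ t)).proj) J ∧
      ∀ t ∈ J, curveLift E (fun t ↦ (y (τ t)).proj) t = y (τ t) := by
  have hyc : ContinuousOn y I := fun s hs ↦ (hy s hs).continuousAt.continuousWithinAt
  have hN : ∀ s ∈ I, 0 < √(energy h (y s)) := fun s hs ↦ Real.sqrt_pos.2 (hy s hs).1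
  obtain ⟨J, σ, τ, hr, h0⟩ := exists_isReparam (n := fun s ↦ (√(energy h (y s)))⁻¹) hI hIc
    ((((continuous_energy h).comp_continuousOn hyc).sqrt).inv₀ fun s hs ↦ (hN s hs).ne')
    (fun s hs ↦ inv_pos.2 (hN s hs)) ha
  have hd : ∀ t ∈ J, HasMFDerivAt 𝓘(ℝ, ℝ) 𝓘(ℝ, E).tangent (fun t ↦ y (τ t)) t
      ((1 : ℝ →L[ℝ] ℝ).smulRight (S.toFun (y (τ t)))) := fun t ht ↦ by
    have h1 := hasMFDerivAt_comp (r := ((√(energy h (y (τ t))))⁻¹)⁻¹)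
      (hy _ (hr.mapsTo_symm ht)).2 (hr.hasDerivAt_symm t ht)
    rwa [inv_mul_cancel₀ (inv_pos.2 (hN _ (hr.mapsTo_symm ht))).ne', one_smul] at h1
  exact ⟨J, σ, τ, hr, isGeodesicOn_proj hr.isOpen hr.ordConnected ⟨σ a, hr.mapsTo ha⟩ hd,
    fun t ht ↦ curveLift_eq_of_hasMFDerivAt (hd t ht)⟩

end Spray
end

/-! ### Nonvanishing velocity, and inextendibility from infinite length. -/

noncomputable section

lemma IsOpen.exists_lt_mem {J : Set ℝ} (hJ : IsOpen J) {p : ℝ} (hp : p ∈ J) : ∃ a ∈ J, a < p := by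
  have h1 : ∀ᶠ r in 𝓝[<] p, r ∈ J := nhdsWithin_le_nhds (hJ.mem_nhds hp)
  have h2 : ∀ᶠ r in 𝓝[<] p, r < p := self_mem_nhdsWithin
  exact (h1.and h2).exists

lemma IsOpen.exists_gt_mem {J : Set ℝ} (hJ : IsOpen J) {p : ℝ} (hp : p ∈ J) : ∃ a ∈ J, p < a := by
  have h1 : ∀ᶠ r in 𝓝[>] p, r ∈ J := nhdsWithin_le_nhds (hJ.mem_nhds hp)
  have h2 : ∀ᶠ r in 𝓝[>] p, p < r := self_mem_nhdsWithin
  exact (h1.and h2).exists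

variable {E : Type*} [NormedAddCommGroup E] [NormedSpace ℝ E]
  {M : Type*} [TopologicalSpace M] [ChartedSpace E M] [IsManifold 𝓘(ℝ, E) ∞ M]

namespace Spray
variable {S : Spray E M} {c : ℝ → M} {J : Set ℝ}
variable {h : ContMDiffRiemannianMetric 𝓘(ℝ, E) ∞ E (fun x : M ↦ TangentSpace 𝓘(ℝ, E) x)}

lemma IsGeodesicOn.hasDerivAt_energy (hc : S.IsGeodesicOn c J) {t : ℝ} (ht : t ∈ J) :
    HasDerivAt (fun t ↦ energy h (curveLift E c t))
      (energyDeriv h (S.total (curveLift E c t))) t := by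
  have h1 := hc.hasMFDerivAt ht
  rw [← one_smul ℝ (S.toFun _)] at h1
  simpa using _root_.hasDerivAt_energy h S h1

/-- Along a geodesic the energy solves a linear equation `e' = k e` with `k` bounded on compact
intervals, because `|dE(S)|` is at most a constant times `|y| ^ 3`. Uniqueness then compares it with
the zero solution. -/
lemma IsGeodesicOn.energy_eq_zero [FiniteDimensional ℝ E] (hS : S.IsHomogeneous 2)
    (hc : S.IsGeodesicOn c J) {t₀ t₁ : ℝ} (ht₀ : t₀ ∈ J) (ht₁ : t₁ ∈ J)
    (h0 : energy h (curveLift E c t₀) = 0) : energy h (curveLift E c t₁) = 0 := by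
  obtain ⟨a, haJ, ha⟩ := hc.isOpen.exists_lt_mem (p := min t₀ t₁)
    (by rcases min_choice t₀ t₁ with e | e <;> rwa [e])
  obtain ⟨b, hbJ, hb⟩ := hc.isOpen.exists_gt_mem (p := max t₀ t₁)
    (by rcases max_choice t₀ t₁ with e | e <;> rwa [e])
  rw [lt_min_iff] at ha
  rw [max_lt_iff] at hb
  have hsub : Icc a b ⊆ J := hc.ordConnected.out haJ hbJ
  have hK : IsCompact (c '' Icc a b) := isCompact_Icc.image_of_continuousOn
    (hc.continuousOn.mono hsub)
  obtain ⟨C, hC⟩ := exists_abs_energyDeriv_lt h hK S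
  have hec : ContinuousOn (fun t ↦ energy h (curveLift E c t)) (Icc a b) :=
    (continuous_energy h).comp_continuousOn (hc.continuousOn_curveLift.mono hsub)
  obtain ⟨B, hB⟩ := isCompact_Icc.exists_bound_of_continuousOn hec.sqrt
  -- Where the energy vanishes, `k` is zero by the convention for division by zero. The equation
  -- holds there too, since a zero is a minimum of the energy and its derivative vanishes.
  let k : ℝ → ℝ := fun t ↦ energyDeriv h (S.total (curveLift E c t)) / energy h (curveLift E c t)
  have hk : ∀ t ∈ Ioo a b, |k t| ≤ |C| * |B| := by
    intro t ht
    have htI := Ioo_subset_Icc_self ht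
    rcases (energy_nonneg h (curveLift E c t)).eq_or_lt with he | he
    · simp only [k, ← he, div_zero, abs_zero]
      positivity
    · have h1 := abs_energyDeriv_le hS (fun u hu huA ↦ (hC u hu huA).le) he
        (mem_image_of_mem c htI)
      have h2 := hB t htI
      rw [Real.norm_of_nonneg (Real.sqrt_nonneg _)] at h2
      rw [abs_div, abs_of_pos he, div_le_iff₀ he]
      refine h1.trans ?_
      have h3 := Real.sqrt_nonneg (energy h (curveLift E c t))
      rw [pow_succ', Real.sq_sqrt he.le, ← mul_assoc]
      refine mul_le_mul_of_nonneg_right ?_ he.le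
      exact (mul_le_mul_of_nonneg_right (le_abs_self C) h3).trans
        (mul_le_mul_of_nonneg_left (h2.trans (le_abs_self B)) (abs_nonneg C))
  have huniq := ODE_solution_unique_of_mem_Icc (v := fun t x ↦ k t * x) (s := fun _ ↦ univ)
    (K := ⟨|C| * |B|, by positivity⟩) (f := fun t ↦ energy h (curveLift E c t)) (g := fun _ ↦ 0)
    (a := a) (b := b) (t₀ := t₀)
    (fun t ht ↦ (LipschitzWith.of_dist_le_mul fun x y ↦ by
      rw [Real.dist_eq, Real.dist_eq, ← mul_sub, abs_mul]
      exact mul_le_mul_of_nonneg_right (hk t ht) (abs_nonneg _)).lipschitzOnWith) ⟨ha.1, hb.1⟩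
    hec (fun t ht ↦ by
      have hd := hc.hasDerivAt_energy (h := h) (hsub (Ioo_subset_Icc_self ht))
      refine hd.congr_deriv ?_
      by_cases he : energy h (curveLift E c t) = 0
      · have hmin : IsLocalMin (fun t ↦ energy h (curveLift E c t)) t :=
          Filter.Eventually.of_forall fun r ↦ he.le.trans (energy_nonneg h _)
        rw [hmin.hasDerivAt_eq_zero hd, he, mul_zero]
      · exact (div_mul_cancel₀ _ he).symm) (fun _ _ ↦ mem_univ _) continuousOn_const
    (fun t _ ↦ by simpa using hasDerivAt_const t (0 : ℝ)) (fun _ _ ↦ mem_univ _) h0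
  exact huniq ⟨ha.2.le, hb.2.le⟩

/-- With zero velocity the chart coordinates of the curve have zero derivative on an interval around
`t`, and the chart is injective. -/
lemma IsGeodesicOn.eventually_eq (hc : S.IsGeodesicOn c J)
    (h0 : ∀ t ∈ J, energy h (curveLift E c t) = 0) {t : ℝ} (ht : t ∈ J) :
    ∀ᶠ r in 𝓝 t, c r = c t := by
  set x := c t with hx
  have hcx : ∀ᶠ r in 𝓝 t, c r ∈ (extChartAt 𝓘(ℝ, E) x).source ∧ r ∈ J :=
    ((hc.continuousOn.continuousAt (hc.isOpen.mem_nhds ht)).eventually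
      (extChartAt_source_mem_nhds x)).and (hc.isOpen.mem_nhds ht)
  obtain ⟨ε, hε, hball⟩ := Metric.eventually_nhds_iff_ball.1 hcx
  have hd : ∀ r ∈ Metric.ball t ε, HasDerivAt (fun r ↦ extChartAt 𝓘(ℝ, E) x (c r)) 0 r := by
    intro r hr
    have h1 := hc.hasMFDerivAt (hball r hr).2
    rw [← one_smul ℝ (S.toFun _)] at h1
    have h2 := S.hasDerivAt_tangentCoord x (hball r hr).1 h1
    have h3 : HasDerivAt (fun r ↦ (tangentCoord E x (curveLift E c r)).1) _ r :=
      (ContinuousLinearMap.fst ℝ E E).hasFDerivAt.comp_hasDerivAt r h2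
    refine h3.congr_deriv ?_
    rw [one_smul]
    refine (S.coord_fst x (mem_target_tangentCoord x (hball r hr).1)).trans ?_
    have h4 : (curveLift E c r).2 = 0 := by
      by_contra hne
      exact (energy_pos h hne).ne' (h0 r (hball r hr).2)
    change chartDeriv E x (c r) (curveLift E c r).2 = 0
    rw [h4]
    exact map_zero _
  filter_upwards [Metric.ball_mem_nhds t hε] with r hr
  have h1 := Metric.isOpen_ball.is_const_of_deriv_eq_zero (convex_ball t ε).isPreconnected
    (fun r hr ↦ (hd r hr).differentiableAt.differentiableWithinAt) (fun r hr ↦ (hd r hr).deriv)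
    hr (Metric.mem_ball_self hε)
  exact (extChartAt 𝓘(ℝ, E) x).injOn (hball r hr).1 (hball t (Metric.mem_ball_self hε)).1 h1

/-- The velocity of a nonconstant geodesic does not vanish. -/
lemma IsGeodesicOn.energy_pos [FiniteDimensional ℝ E] (hS : S.IsHomogeneous 2)
    (hc : S.IsGeodesicOn c J) {s t : ℝ} (hs : s ∈ J) (ht : t ∈ J) (hst : c s ≠ c t) :
    ∀ r ∈ J, 0 < energy h (curveLift E c r) := by
  intro r hr
  refine (energy_nonneg h _).lt_of_ne fun h0 ↦ hst ?_
  have hz : ∀ t ∈ J, energy h (curveLift E c t) = 0 := fun t ht ↦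
    hc.energy_eq_zero hS hr ht h0.symm
  have : PreconnectedSpace J := isPreconnected_iff_preconnectedSpace.1
    hc.ordConnected.isPreconnected
  have hloc : IsLocallyConstant (fun r : J ↦ c r) := by
    rw [IsLocallyConstant.iff_eventually_eq]
    exact fun r ↦ continuous_subtype_val.continuousAt.eventually (hc.eventually_eq hz r.2)
  exact hloc.apply_eq_of_preconnectedSpace ⟨s, hs⟩ ⟨t, ht⟩

lemma IsGeodesicOn.energy_eq_zero_of_const (hc : S.IsGeodesicOn c J)
    (hconst : ∀ s ∈ J, ∀ t ∈ J, c s = c t) {t : ℝ} (ht : t ∈ J) :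
    energy h (curveLift E c t) = 0 := by
  have h1 : c =ᶠ[𝓝 t] fun _ ↦ c t := by
    filter_upwards [hc.isOpen.mem_nhds ht] with r hr using hconst r hr t ht
  have h2 : (curveLift E c t).2 = 0 := by
    change mfderiv 𝓘(ℝ, ℝ) 𝓘(ℝ, E) c t (1 : ℝ) = 0
    rw [h1.mfderiv_eq, mfderiv_const]
    rfl
  simp [energy, h2]

/-- A geodesic of infinite length in both directions is inextendible. -/
lemma isInextendible_of_arcCurve {y : ℝ → TangentBundle 𝓘(ℝ, E) M} {σ τ : ℝ → ℝ}
    (hy : ∀ s, S.IsArcCurveAt h y s)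
    (hr : IsReparam univ J (fun s ↦ (√(energy h (y s)))⁻¹) σ τ)
    (hc : S.IsGeodesicOn c J) (hcy : ∀ t ∈ J, curveLift E c t = y (τ t)) :
    S.IsInextendibleGeodesicOn c J := by
  refine ⟨hc, fun c' J' hc' hJJ' hcc' ↦ ?_⟩
  by_contra hne
  obtain ⟨t₁, ht₁', ht₁⟩ : ∃ t ∈ J', t ∉ J := by
    by_contra! hcon
    exact hne (Subset.antisymm hcon hJJ')
  have hcc : ∀ t ∈ J, curveLift E c' t = y (τ t) := fun t ht ↦ by
    rw [← hcy t ht]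
    have h1 : c =ᶠ[𝓝 t] c' := by
      filter_upwards [hc.isOpen.mem_nhds ht] with r hr using hcc' hr
    refine TotalSpace.ext h1.eq_of_nhds.symm ?_
    change HEq (mfderiv 𝓘(ℝ, ℝ) 𝓘(ℝ, E) c' t (1 : ℝ)) (mfderiv 𝓘(ℝ, ℝ) 𝓘(ℝ, E) c t (1 : ℝ))
    exact heq_of_eq (congrArg (fun L : ℝ →L[ℝ] E ↦ L (1 : ℝ)) h1.symm.mfderiv_eq)
  -- At an endpoint `β` of `J` inside `J'` the extended lift is continuous, so its norm is bounded
  -- nearby and the time spent per unit of arc length is bounded below. Infinite arc length would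
  -- then take infinite time before `β`.
  have hbound : ∀ β ∈ J', ∃ ε > 0, ∀ᶠ t in 𝓝 β, ∀ s, σ s = t → ε ≤ (√(energy h (y s)))⁻¹ := by
    intro β hβ
    have h1 : ContinuousAt (fun t ↦ √(energy h (curveLift E c' t))) β :=
      (((continuous_energy h).comp_continuousOn hc'.continuousOn_curveLift).sqrt).continuousAt
        (hc'.isOpen.mem_nhds hβ)
    set B := √(energy h (curveLift E c' β)) + 1
    have hB : 0 < B := by positivity
    refine ⟨B⁻¹, inv_pos.2 hB, ?_⟩
    filter_upwards [h1.eventually_lt_const (lt_add_one _)] with t ht s hst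
    have h2 := hcc t (hst ▸ hr.mapsTo (mem_univ s))
    rw [h2, ← hst, hr.left_inv s (mem_univ s)] at ht
    exact inv_anti₀ (Real.sqrt_pos.2 (hy s).1) ht.le
  have hmono : StrictMono σ := strictMonoOn_univ.1 hr.strictMonoOn
  have hJ0 : σ 0 ∈ J := hr.mapsTo (mem_univ 0)
  rcases lt_trichotomy t₁ (σ 0) with hlt | heq | hgt
  · have hbd : ∀ t ∈ J, t₁ ≤ t := fun t ht ↦ by
      by_contra! hcon
      exact ht₁ (hc.ordConnected.out ht hJ0 ⟨hcon.le, hlt.le⟩)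
    have hbdd : BddBelow J := ⟨t₁, hbd⟩
    have hβ : sInf J ∈ J' := hc'.ordConnected.out ht₁' (hJJ' hJ0)
      ⟨le_csInf ⟨_, hJ0⟩ hbd, csInf_le hbdd hJ0⟩
    obtain ⟨ε, hε, hev⟩ := hbound _ hβ
    obtain ⟨δ, hδ, hball⟩ := Metric.eventually_nhds_iff_ball.1 hev
    obtain ⟨t₂, ht₂, ht₂δ⟩ := exists_lt_of_csInf_lt ⟨_, hJ0⟩ (lt_add_of_pos_right (sInf J) hδ)
    -- Reversing time and arc length reduces the lower endpoint to the upper one.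
    obtain ⟨s, -, hs⟩ := not_bddAbove_of_le_deriv (σ := fun s ↦ -σ (-s))
      (σ' := fun s ↦ (√(energy h (y (-s))))⁻¹) (s₀ := -τ t₂) hε
      (fun s _ ↦ by
        have h1 := (hr.hasDerivAt (-s) (mem_univ _)).scomp s (hasDerivAt_neg s)
        exact h1.neg.congr_deriv (by simp))
      (fun s hs ↦ hball (σ (-s)) (by
        have h1 : σ (-s) ≤ t₂ := by
          rw [← hr.right_inv t₂ ht₂]
          exact hmono.monotone (by linarith [mem_Ici.1 hs])
        have h2 := csInf_le hbdd (hr.mapsTo (mem_univ (-s)))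
        rw [Metric.mem_ball, Real.dist_eq, abs_lt]
        constructor <;> linarith) (-s) rfl) (-sInf J)
    have := csInf_le hbdd (hr.mapsTo (mem_univ (-s)))
    linarith
  · exact ht₁ (heq ▸ hJ0)
  · have hbd : ∀ t ∈ J, t ≤ t₁ := fun t ht ↦ by
      by_contra! hcon
      exact ht₁ (hc.ordConnected.out hJ0 ht ⟨hgt.le, hcon.le⟩)
    have hbdd : BddAbove J := ⟨t₁, hbd⟩
    have hβ : sSup J ∈ J' := hc'.ordConnected.out (hJJ' hJ0) ht₁'
      ⟨le_csSup hbdd hJ0, csSup_le ⟨_, hJ0⟩ hbd⟩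
    obtain ⟨ε, hε, hev⟩ := hbound _ hβ
    obtain ⟨δ, hδ, hball⟩ := Metric.eventually_nhds_iff_ball.1 hev
    obtain ⟨t₂, ht₂, ht₂δ⟩ := exists_lt_of_lt_csSup ⟨_, hJ0⟩ (sub_lt_self (sSup J) hδ)
    obtain ⟨s, -, hs⟩ := not_bddAbove_of_le_deriv (σ := σ)
      (σ' := fun s ↦ (√(energy h (y s)))⁻¹) (s₀ := τ t₂) hε
      (fun s _ ↦ hr.hasDerivAt s (mem_univ _))
      (fun s hs ↦ hball (σ s) (by
        have h1 : t₂ ≤ σ s := by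
          rw [← hr.right_inv t₂ ht₂]
          exact hmono.monotone hs
        have h2 := le_csSup hbdd (hr.mapsTo (mem_univ s))
        rw [Metric.mem_ball, Real.dist_eq, abs_lt]
        constructor <;> linarith) s rfl) (sSup J)
    have := le_csSup hbdd (hr.mapsTo (mem_univ s))
    linarith

end Spray
end

/-! ### Extension of geodesics and infinite length of trapped ones. -/

noncomputable section

variable {E : Type*} [NormedAddCommGroup E] [NormedSpace ℝ E]
  {M : Type*} [TopologicalSpace M] [ChartedSpace E M] [IsManifold 𝓘(ℝ, E) ∞ M]

lemma IsOpen.csSup_notMem {J : Set ℝ} (hJ : IsOpen J) (hb : BddAbove J) : sSup J ∉ J := fun h ↦ by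
  obtain ⟨a, ha, hlt⟩ := hJ.exists_gt_mem h
  exact (le_csSup hb ha).not_gt hlt

namespace Spray
variable {S : Spray E M} {c : ℝ → M} {J : Set ℝ}
variable {h : ContMDiffRiemannianMetric 𝓘(ℝ, E) ∞ E (fun x : M ↦ TangentSpace 𝓘(ℝ, E) x)}

/-- An integral curve which has a limit at the end of its interval can be extended. -/
lemma exists_extension [FiniteDimensional ℝ E] (hJ : IsOpen J) (hJc : J.OrdConnected)
    (hJn : J.Nonempty) (hb : BddAbove J) {v : ℝ → TangentBundle 𝓘(ℝ, E) M}
    (hv : ∀ t ∈ J, HasMFDerivAt 𝓘(ℝ, ℝ) 𝓘(ℝ, E).tangent v t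
      ((1 : ℝ →L[ℝ] ℝ).smulRight (S.toFun (v t)))) {u : TangentBundle 𝓘(ℝ, E) M}
    (hu : Filter.Tendsto v (𝓝[<] sSup J) (𝓝 u)) :
    ∃ (v' : ℝ → TangentBundle 𝓘(ℝ, E) M) (J' : Set ℝ), IsOpen J' ∧ J'.OrdConnected ∧ J ⊆ J' ∧
      sSup J ∈ J' ∧ EqOn v v' J ∧ ∀ t ∈ J', HasMFDerivAt 𝓘(ℝ, ℝ) 𝓘(ℝ, E).tangent v' t
        ((1 : ℝ →L[ℝ] ℝ).smulRight (S.toFun (v' t))) := by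
  have : CompleteSpace E := FiniteDimensional.complete ℝ E
  set β := sSup J with hβ
  set x := u.proj
  have hx : u.proj ∈ (extChartAt 𝓘(ℝ, E) x).source := mem_extChartAt_source _
  set p₀ := tangentCoord E x u
  have hp : p₀.1 ∈ (extChartAt 𝓘(ℝ, E) x).target := mem_target_tangentCoord x hx
  have hltJ : ∀ t ∈ J, t < β := fun t ht ↦
    (le_csSup hb ht).lt_of_ne fun e ↦ hJ.csSup_notMem hb (e ▸ ht)
  -- The continuation is the local solution in the chart with value `p₀`, the coordinates of the
  -- limit, at time `β`.
  obtain ⟨α', hα'⟩ := ((S.contDiffAt_coord x hp).of_le (m := 1)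
    (by exact_mod_cast le_top)).exists_eventually_eq_hasDerivAt β
  have hα'' := hα'.curry.self_of_nhds
  set α := α' p₀
  have hαβ : α β = p₀ := hα''.self_of_nhds.1
  have hαc : ContinuousAt α β := hα''.self_of_nhds.2.continuousAt
  have hαt : ∀ᶠ t in 𝓝 β, (α t).1 ∈ (extChartAt 𝓘(ℝ, E) x).target :=
    hαc.eventually ((isOpen_tangent_target E x).mem_nhds (hαβ ▸ hp))
  have hαd : ∀ᶠ t in 𝓝 β, HasDerivAt α (S.coord x (α t)) t := hα''.mono fun t ht ↦ ht.2
  obtain ⟨ε, hε, hball⟩ := Metric.eventually_nhds_iff_ball.1 (hαt.and hαd)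
  let z : ℝ → E × E := fun t ↦ if t < β then tangentCoord E x (v t) else α t
  let v' : ℝ → TangentBundle 𝓘(ℝ, E) M := fun t ↦ if t < β then v t else tangentParam E x (α t)
  obtain ⟨t₃, ht₃⟩ := hJn
  have hJmem : ∀ t, t₃ ≤ t → t < β → t ∈ J := fun t h1 h2 ↦ by
    obtain ⟨r, hr, htr⟩ := exists_lt_of_lt_csSup ⟨t₃, ht₃⟩ h2
    exact hJc.out ht₃ hr ⟨h1, htr.le⟩
  have hleft : ∀ᶠ t in 𝓝[<] β, t ∈ J ∧ (v t).proj ∈ (extChartAt 𝓘(ℝ, E) x).source := by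
    refine Filter.Eventually.and ?_ (hu.eventually ((isOpen_tangent_source E x).mem_nhds hx))
    filter_upwards [Ico_mem_nhdsLT (hltJ t₃ ht₃)] with t ht using hJmem t ht.1 ht.2
  have hzv : ∀ t < β, z t = tangentCoord E x (v t) := fun t ht ↦ if_pos ht
  have hzβ : z β = p₀ := (if_neg (lt_irrefl β)).trans hαβ
  have hzleft : ∀ t < β, t ∈ J → (v t).proj ∈ (extChartAt 𝓘(ℝ, E) x).source →
      HasDerivAt z (S.coord x (z t)) t := fun t ht htJ hts ↦ by
    have h1 := hv t htJ
    rw [← one_smul ℝ (S.toFun _)] at h1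
    have h2 := S.hasDerivAt_tangentCoord x hts h1
    rw [one_smul, ← hzv t ht] at h2
    refine h2.congr_of_eventuallyEq ?_
    filter_upwards [Iio_mem_nhds ht] with r hr using hzv r hr
  have hzlim : Filter.Tendsto z (𝓝[<] β) (𝓝 p₀) := by
    refine ((contMDiffAt_tangentCoord x hx).continuousAt.tendsto.comp hu).congr' ?_
    filter_upwards [self_mem_nhdsWithin] with t ht using (hzv t ht).symm
  have hzd : HasDerivAt z ((1 : ℝ) • S.coord x (z β)) β := by
    rw [one_smul, hzβ]
    -- At the gluing point the left derivative exists because the derivatives have a limit there,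
    -- and it equals the right derivative of the new solution.
    have hl : HasDerivWithinAt z (S.coord x p₀) (Iic β) β := by
      refine hasDerivWithinAt_Iic_of_tendsto_deriv
        (s := {t | t < β ∧ t ∈ J ∧ (v t).proj ∈ (extChartAt 𝓘(ℝ, E) x).source})
        (fun t ht ↦ (hzleft t ht.1 ht.2.1 ht.2.2).differentiableAt.differentiableWithinAt) ?_ ?_ ?_
      · rw [ContinuousWithinAt, hzβ]
        exact hzlim.mono_left (nhdsWithin_mono β fun t ht ↦ ht.1)
      · filter_upwards [hleft, self_mem_nhdsWithin] with t ht ht'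
        exact ⟨ht', ht⟩
      · refine ((S.contDiffAt_coord x hp).continuousAt.tendsto.comp hzlim).congr' ?_
        filter_upwards [hleft, self_mem_nhdsWithin] with t ht ht'
        exact (hzleft t ht' ht.1 ht.2).deriv.symm
    have hr : HasDerivWithinAt z (S.coord x p₀) (Ici β) β := by
      have h1 := (hball β (Metric.mem_ball_self hε)).2
      rw [hαβ] at h1
      exact h1.hasDerivWithinAt.congr (fun t ht ↦ if_neg (not_lt.2 ht)) (if_neg (lt_irrefl β))
    have := hl.union hr
    rwa [Iic_union_Ici, hasDerivWithinAt_univ] at this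
  refine ⟨v', J ∪ Ioo t₃ (β + ε), hJ.union isOpen_Ioo, ?_, subset_union_left,
    Or.inr ⟨hltJ t₃ ht₃, by linarith⟩, fun t ht ↦ (if_pos (hltJ t ht)).symm, fun t ht ↦ ?_⟩
  · obtain ⟨r, hr, htr⟩ := exists_lt_of_lt_csSup ⟨t₃, ht₃⟩ (hltJ t₃ ht₃)
    have hr' : r ∈ Ioo t₃ (β + ε) := ⟨htr, by linarith [hltJ r hr]⟩
    exact (hJc.isPreconnected.union r hr hr' isPreconnected_Ioo).ordConnected
  have hcases : (t < β ∧ t ∈ J) ∨ t = β ∨ (β < t ∧ t < β + ε) := by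
    rcases ht with ht | ht
    · exact Or.inl ⟨hltJ t ht, ht⟩
    · rcases lt_trichotomy t β with h1 | h1 | h1
      · exact Or.inl ⟨h1, hJmem t ht.1.le h1⟩
      · exact Or.inr (Or.inl h1)
      · exact Or.inr (Or.inr ⟨h1, ht.2⟩)
  rcases hcases with ⟨h1, h2⟩ | h1 | ⟨h1, h2⟩
  · have e : v' t = v t := if_pos h1
    rw [e]
    refine (hv t h2).congr_of_eventuallyEq ?_
    filter_upwards [Iio_mem_nhds h1] with r hr using if_pos hr
  · rw [h1]
    have h3 := S.hasMFDerivAt_tangentParam x (by rw [hzβ]; exact hp) hzd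
    rw [one_smul] at h3
    have e : ∀ᶠ t in 𝓝 β, v' t = tangentParam E x (z t) := by
      have h4 := eventually_nhdsWithin_iff.1 hleft
      filter_upwards [h4] with r hr
      by_cases hrβ : r < β
      · simp only [v', z, if_pos hrβ]
        exact (tangentParam_tangentCoord x (hr hrβ).2).symm
      · simp only [v', z, if_neg hrβ]
    rw [e.self_of_nhds]
    exact h3.congr_of_eventuallyEq e
  · have hmem : t ∈ Metric.ball β ε := by
      rw [Metric.mem_ball, Real.dist_eq, abs_lt]
      constructor <;> linarith
    have e : v' t = tangentParam E x (α t) := if_neg h1.not_gt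
    rw [e]
    have h3 := S.hasMFDerivAt_tangentParam (a := 1) x (hball t hmem).1
      (by rw [one_smul]; exact (hball t hmem).2)
    rw [one_smul] at h3
    refine h3.congr_of_eventuallyEq ?_
    filter_upwards [Ioi_mem_nhds h1] with r hr using if_neg (not_lt.2 (le_of_lt hr))

/-- An inextendible geodesic which stays in a compact set has infinite length. -/
lemma IsInextendibleGeodesicOn.not_bddAbove [FiniteDimensional ℝ E] [T2Space M]
    (hS : S.IsHomogeneous 2) (hin : S.IsInextendibleGeodesicOn c J) {I : Set ℝ} {σ τ : ℝ → ℝ}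
    (hr : IsReparam J I (fun t ↦ √(energy h (curveLift E c t))) σ τ)
    (hy : ∀ s ∈ I, S.IsArcCurveAt h (fun s ↦ curveLift E c (τ s)) s)
    {K : Set M} (hK : IsCompact K) (hmaps : MapsTo c J K) : ¬ BddAbove I := by
  intro hb
  have hc := hin.1
  obtain ⟨t₀, ht₀⟩ := hc.nonempty
  set y := fun s ↦ curveLift E c (τ s) with hydef
  set s₀ := σ t₀
  have hs₀ : s₀ ∈ I := hr.mapsTo ht₀
  set b := sSup I
  have hlt : ∀ s ∈ I, s < b := fun s hs ↦
    (le_csSup hb hs).lt_of_ne fun e ↦ hr.isOpen.csSup_notMem hb (e ▸ hs)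
  have hImem : ∀ s, s₀ ≤ s → s < b → s ∈ I := fun t h1 h2 ↦ by
    obtain ⟨r, hr', htr⟩ := exists_lt_of_lt_csSup ⟨s₀, hs₀⟩ h2
    exact hr.ordConnected.out hs₀ hr' ⟨h1, htr.le⟩
  have hyK : ∀ s ∈ I, (y s).proj ∈ K := fun s hs ↦ hmaps (hr.mapsTo_symm hs)
  obtain ⟨C, hC⟩ := exists_abs_energyDeriv_lt h hK S
  set R := |Real.log (energy h (y s₀))| + |C| * (b - s₀) with hR
  have hlog : ∀ s ∈ Ico s₀ b, |Real.log (energy h (y s))| ≤ R := by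
    intro s hs
    have h1 := abs_log_energy_sub_le hS (fun u hu huA ↦ (hC u hu huA).le) (y := y) (s := s₀)
      (t := s) (fun r hr' ↦ by
        have := hr.ordConnected.uIcc_subset hs₀ (hImem s hs.1 hs.2) hr'
        exact ⟨hy r this, hyK r this⟩)
    have h2 : C * |s - s₀| ≤ |C| * (b - s₀) := by
      rw [abs_of_nonneg (by linarith [hs.1])]
      exact mul_le_mul (le_abs_self C) (by linarith [hs.2]) (by linarith [hs.1]) (abs_nonneg C)
    have h3 := abs_sub_abs_le_abs_sub (Real.log (energy h (y s))) (Real.log (energy h (y s₀)))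
    linarith
  have hs₀b : s₀ < b := hlt s₀ hs₀
  let 𝒰 : Ultrafilter ℝ := Ultrafilter.of (𝓝[<] b)
  have h𝒰 : (𝒰 : Filter ℝ) ≤ 𝓝[<] b := Ultrafilter.of_le _
  have hev : ∀ᶠ i in 𝒰, i ∈ Ico s₀ b := h𝒰 (Ico_mem_nhdsLT hs₀b)
  obtain ⟨u, hu, huK, hue⟩ := exists_tendsto_of_abs_log_energy_le (h := h) (𝒰 := 𝒰) hK (v := y)
    (R := R) (by
      filter_upwards [hev] with s hs
      have := hImem s hs.1 hs.2
      exact ⟨hyK s this, (hy s this).1, hlog s hs⟩)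
  -- The limit along one ultrafilter is upgraded to a true limit by equicontinuity: if `y` kept
  -- leaving `O`, it would do so after arbitrarily short lengths from points arbitrarily close to
  -- `u`.
  have hlim : Filter.Tendsto y (𝓝[<] b) (𝓝 u) := by
    intro O hO
    by_contra hcon
    have hfreq : ∀ i ∈ Ico s₀ b, ∃ r ∈ Ico i b, y r ∉ O := by
      intro i hi
      by_contra! hno
      exact hcon (Filter.mem_map.2 (Filter.mem_of_superset (Ico_mem_nhdsLT hi.2) hno))
    have : ∀ i : ℝ, ∃ r, i ∈ Ico s₀ b → r ∈ Ico i b ∧ y r ∉ O := fun i ↦ by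
      by_cases hi : i ∈ Ico s₀ b
      · obtain ⟨r, hr1, hr2⟩ := hfreq i hi
        exact ⟨r, fun _ ↦ ⟨hr1, hr2⟩⟩
      · exact ⟨0, fun h ↦ absurd h hi⟩
    choose r hr' using this
    -- The limit results apply to the constant family `S`, indexed by the starting parameters of the
    -- pieces of `y`.
    have hl : IsFineLimit h K (𝒰 : Filter ℝ) (fun _ ↦ S) S := fun O _ hO ↦
      Filter.Eventually.of_forall fun _ u hu _ ↦ hO u hu
    obtain ⟨δ, hδ, hev2⟩ := hl.eventually_mem (fun _ ↦ hS) hS (a := id) (b := r) (s₀ := id)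
      (y := fun _ ↦ y) (by
        filter_upwards [hev] with i hi s hs
        have : s ∈ I := hImem s (hi.1.trans hs.1) (hs.2.trans_lt (hr' i hi).1.2)
        exact ⟨hy s this, hyK s this⟩) (by
        filter_upwards [hev] with i hi using ⟨le_rfl, (hr' i hi).1.1⟩) hu hue hO
    have hδ' : ∀ᶠ i in 𝒰, b - δ < i :=
      h𝒰 (nhdsWithin_le_nhds (Ioi_mem_nhds (by linarith)))
    obtain ⟨i, hi1, hi2, hi3⟩ := (hev2.and (hδ'.and hev)).exists
    have h4 := (hr' i hi3).1
    refine (hr' i hi3).2 (hi1 (r i) ⟨h4.1, le_rfl⟩ ?_)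
    rw [id, abs_of_nonneg (by linarith [h4.1])]
    linarith [h4.2]
  have hN : ∀ s ∈ Ico s₀ b, (√(energy h (y s)))⁻¹ ≤ (√(Real.exp (-R)))⁻¹ := fun s hs ↦ by
    refine inv_anti₀ (Real.sqrt_pos.2 (Real.exp_pos _)) (Real.sqrt_le_sqrt ?_)
    exact (Real.le_log_iff_exp_le (hy s (hImem s hs.1 hs.2)).1).1 (abs_le.1 (hlog s hs)).1
  -- Finite length means finite time here, because the norm of the velocity is bounded below; so the
  -- lift has a limit at the finite end of `J`, and the geodesic can be extended.
  have hbJ : BddAbove J := by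
    refine ⟨max t₀ (t₀ + (√(Real.exp (-R)))⁻¹ * (b - s₀)), fun t ht ↦ ?_⟩
    rcases le_total t t₀ with htt | htt
    · exact htt.trans (le_max_left _ _)
    refine le_trans ?_ (le_max_right _ _)
    have hσ : σ t ∈ I := hr.mapsTo ht
    have hle : s₀ ≤ σ t := (hr.strictMonoOn.le_iff_le ht₀ ht).2 htt
    have hsub : Icc s₀ (σ t) ⊆ Ico s₀ b := fun r hr' ↦ ⟨hr'.1, hr'.2.trans_lt (hlt _ hσ)⟩
    have hsubI : Icc s₀ (σ t) ⊆ I := fun r hr' ↦ hImem r (hsub hr').1 (hsub hr').2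
    have h1 := (convex_Icc s₀ (σ t)).image_sub_le_mul_sub_of_deriv_le (f := τ)
      (C := (√(Real.exp (-R)))⁻¹)
      (fun r hr' ↦ (hr.hasDerivAt_symm r (hsubI hr')).continuousAt.continuousWithinAt)
      (fun r hr' ↦ (hr.hasDerivAt_symm r
        (hsubI (interior_subset hr'))).differentiableAt.differentiableWithinAt)
      (fun r hr' ↦ by
        rw [(hr.hasDerivAt_symm r (hsubI (interior_subset hr'))).deriv]
        exact hN r (hsub (interior_subset hr'))) s₀ ⟨le_rfl, hle⟩ (σ t) ⟨hle, le_rfl⟩ hle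
    rw [hr.left_inv t ht, hr.left_inv t₀ ht₀] at h1
    have h2 := mul_le_mul_of_nonneg_left (sub_le_sub_right (hlt _ hσ).le s₀)
      (inv_nonneg.2 (Real.sqrt_nonneg (Real.exp (-R))))
    linarith
  have hlimJ : Filter.Tendsto (curveLift E c) (𝓝[<] sSup J) (𝓝 u) := by
    intro O hO
    obtain ⟨s₁, hs₁, hs₁O⟩ := (mem_nhdsLT_iff_exists_mem_Ico_Ioo_subset hs₀b).1 (hlim hO)
    have hs₁I : s₁ ∈ I := hImem s₁ hs₁.1 hs₁.2
    have hτ := hr.mapsTo_symm hs₁I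
    have hτlt : τ s₁ < sSup J := (le_csSup hbJ hτ).lt_of_ne fun e ↦
      hc.isOpen.csSup_notMem hbJ (e ▸ hτ)
    refine Filter.mem_map.2 (Filter.mem_of_superset (Ioo_mem_nhdsLT hτlt) fun t ht ↦ ?_)
    obtain ⟨q, hq, htq⟩ := exists_lt_of_lt_csSup ⟨_, hτ⟩ ht.2
    have htJ : t ∈ J := hc.ordConnected.out hτ hq ⟨ht.1.le, htq.le⟩
    have h1 : s₁ < σ t := by
      rw [← hr.right_inv s₁ hs₁I]
      exact hr.strictMonoOn hτ htJ ht.1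
    have h2 := hs₁O ⟨h1, hlt _ (hr.mapsTo htJ)⟩
    simp only [hydef, mem_preimage, hr.left_inv t htJ] at h2
    exact h2
  obtain ⟨v', J', hJ', hJ'c, hJJ', hβ, heq, hv'⟩ := exists_extension hc.isOpen hc.ordConnected
    hc.nonempty hbJ (fun t ht ↦ hc.hasMFDerivAt ht) hlimJ
  have h1 := hin.2 _ J' (isGeodesicOn_proj hJ' hJ'c ⟨_, hβ⟩ hv') hJJ'
    (fun t ht ↦ congrArg TotalSpace.proj (heq ht))
  exact hc.isOpen.csSup_notMem hbJ (h1 ▸ hβ)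

end Spray
end

/-! ### Stability on a compact set: bounded length and control of segments. -/

noncomputable section

variable {E : Type*} [NormedAddCommGroup E] [NormedSpace ℝ E]
  {M : Type*} [TopologicalSpace M] [ChartedSpace E M] [IsManifold 𝓘(ℝ, E) ∞ M]

/-- The open sets of `TTM` which contain the image of the unit sphere bundle under `S₀`. -/
def FineNhd (h : ContMDiffRiemannianMetric 𝓘(ℝ, E) ∞ E (fun x : M ↦ TangentSpace 𝓘(ℝ, E) x))
    (S₀ : Spray E M) : Type _ :=
  {O : Set (TangentBundle 𝓘(ℝ, E).tangent (TangentBundle 𝓘(ℝ, E) M)) //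
    IsOpen O ∧ ∀ u ∈ unitSphereBundle h, S₀.total u ∈ O}

variable {h : ContMDiffRiemannianMetric 𝓘(ℝ, E) ∞ E (fun x : M ↦ TangentSpace 𝓘(ℝ, E) x)}

namespace FineNhd
variable {S₀ : Spray E M}

instance : PartialOrder (FineNhd h S₀) := inferInstanceAs (PartialOrder (Subtype _))

instance : Nonempty (FineNhd h S₀) := ⟨⟨univ, isOpen_univ, fun _ _ ↦ mem_univ _⟩⟩

/-- The intersection of two neighbourhoods. -/
def inter (O O' : FineNhd h S₀) : FineNhd h S₀ :=
  ⟨O.1 ∩ O'.1, O.2.1.inter O'.2.1, fun u hu ↦ ⟨O.2.2 u hu, O'.2.2 u hu⟩⟩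

/-- This makes `Filter.atBot` proper, so that an ultrafilter refining it exists. -/
instance : IsCodirectedOrder (FineNhd h S₀) :=
  ⟨fun O O' ↦ ⟨O.inter O', inter_subset_left (s := O.1), inter_subset_right (s := O.1)⟩⟩

/-- Above `A`, the image of the unit sphere bundle under `S` lies in `O`. -/
def Contains (O : FineNhd h S₀) (A : Set M) (S : Spray E M) : Prop :=
  ∀ u ∈ unitSphereBundle h, u.proj ∈ A → S.total u ∈ O.1

/-- The neighbourhoods themselves serve as indices, so a failure of every neighbourhood becomes a
convergent family of sprays with no countable base required. -/
lemma isFineLimit {ι : Type*} {l : Filter ι} {A : Set M} {S : ι → Spray E M}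
    {O : ι → FineNhd h S₀} (hO : Filter.Tendsto O l Filter.atBot)
    (hS : ∀ i, (O i).Contains A (S i)) : IsFineLimit h A l S S₀ := fun O' hO' hO'S ↦ by
  filter_upwards [hO.eventually (Filter.eventually_le_atBot (⟨O', hO', hO'S⟩ : FineNhd h S₀))]
    with i hi u hu huA
  exact (show (O i).1 ⊆ O' from hi) (hS i u hu huA)

end FineNhd

/-- An arc curve can be translated and scaled so that it has unit velocity at the parameter `0`. -/
lemma exists_normalized_arcCurve [FiniteDimensional ℝ E] {S : Spray E M} (hS : S.IsHomogeneous 2)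
    {A : Set M} {y : ℝ → TangentBundle 𝓘(ℝ, E) M} {a b s₀ : ℝ}
    (hy : ∀ s ∈ Icc a b, S.IsArcCurveAt h y s ∧ (y s).proj ∈ A) (hs₀ : s₀ ∈ Icc a b) :
    ∃ y' : ℝ → TangentBundle 𝓘(ℝ, E) M,
      (∀ s ∈ Icc (a - s₀) (b - s₀), S.IsArcCurveAt h y' s ∧ (y' s).proj ∈ A) ∧
      energy h (y' 0) = 1 ∧ ∀ s, (y' s).proj = (y (s + s₀)).proj := by
  have he := (hy s₀ hs₀).1.1
  refine ⟨fun s ↦ tangentSMul (√(energy h (y s₀)))⁻¹ (y (s + s₀)), fun s hs ↦ ?_, ?_, fun s ↦ rfl⟩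
  · have h1 := hy (s + s₀) ⟨by linarith [hs.1], by linarith [hs.2]⟩
    exact ⟨h1.1.comp_add.tangentSMul hS (inv_pos.2 (Real.sqrt_pos.2 he)), h1.2⟩
  · beta_reduce
    rw [zero_add, energy_tangentSMul, inv_pow, Real.sq_sqrt he.le, inv_mul_cancel₀ he.ne']

section
variable [FiniteDimensional ℝ E] [T2Space M] {S₀ : Spray E M} {A : Set M}

variable (h) in
/-- The geodesic segments in a compact set of the sprays close to a disprisoning spray have bounded
length. -/
lemma Spray.IsDisprisoning.exists_length_le (hdis : S₀.IsDisprisoning)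
    (hS₀ : S₀.IsHomogeneous 2) (hA : IsCompact A) :
    ∃ (O : FineNhd h S₀) (L : ℝ), ∀ S : Spray E M, S.IsHomogeneous 2 → O.Contains A S →
      ∀ (y : ℝ → TangentBundle 𝓘(ℝ, E) M) (a b : ℝ), a ≤ b →
        (∀ s ∈ Icc a b, S.IsArcCurveAt h y s ∧ (y s).proj ∈ A) → b - a ≤ L := by
  by_contra! hcon
  -- A counterexample of length more than `n` is centered at its midpoint, with unit velocity there,
  -- so that its domain grows to all of `ℝ` on both sides.
  have hcon' : ∀ p : FineNhd h S₀ × ℕ, ∃ (S : Spray E M) (y : ℝ → TangentBundle 𝓘(ℝ, E) M)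
      (ℓ : ℝ), S.IsHomogeneous 2 ∧ p.1.Contains A S ∧ (p.2 : ℝ) < 2 * ℓ ∧
      (∀ s ∈ Icc (-ℓ) ℓ, S.IsArcCurveAt h y s ∧ (y s).proj ∈ A) ∧ energy h (y 0) = 1 := by
    intro p
    obtain ⟨S, hS, hSO, y, a, b, hab, hy, hlen⟩ := hcon p.1 p.2
    obtain ⟨y', hy', h1, -⟩ := exists_normalized_arcCurve hS (s₀ := (a + b) / 2) hy
      ⟨by linarith, by linarith⟩
    refine ⟨S, y', (b - a) / 2, hS, hSO, by linarith, fun s hs ↦ hy' s ?_, h1⟩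
    exact ⟨by linarith [hs.1], by linarith [hs.2]⟩
  choose S y ℓ hS hSO hℓ hy h1 using hcon'
  let 𝒰 : Ultrafilter (FineNhd h S₀ × ℕ) := Ultrafilter.of (Filter.atBot ×ˢ Filter.atTop)
  have h𝒰 : (𝒰 : Filter (FineNhd h S₀ × ℕ)) ≤ Filter.atBot ×ˢ Filter.atTop := Ultrafilter.of_le _
  have hl : IsFineLimit h A 𝒰 S S₀ :=
    FineNhd.isFineLimit (O := Prod.fst) (Filter.tendsto_fst.mono_left h𝒰) hSO
  have hn : Filter.Tendsto (fun p : FineNhd h S₀ × ℕ ↦ (p.2 : ℝ)) 𝒰 Filter.atTop :=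
    tendsto_natCast_atTop_atTop.comp (Filter.tendsto_snd.mono_left h𝒰)
  have h0 : ∀ p, (0 : ℝ) ∈ Icc (-ℓ p) (ℓ p) := fun p ↦ by
    have := (Nat.cast_nonneg (α := ℝ) p.2).trans_lt (hℓ p)
    exact ⟨by linarith, by linarith⟩
  obtain ⟨y₀, hy₀⟩ := hl.exists_limit_curve hA hS hS₀ hy h0 h1 isOpen_univ fun s _ ↦ by
    filter_upwards [hn.eventually_ge_atTop (2 * |s|)] with p hp
    have := hℓ p
    exact abs_le.1 (by linarith)
  obtain ⟨J, σ, τ, hr, hc, hcy⟩ := S₀.exists_geodesic_of_arcCurve isOpen_univ ordConnected_univ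
    (fun s hs ↦ (hy₀ s hs).1) (mem_univ (0 : ℝ))
  have hin := Spray.isInextendible_of_arcCurve (fun s ↦ (hy₀ s (mem_univ s)).1) hr hc hcy
  refine hdis _ J hin ?_ A hA fun t _ ↦ (hy₀ (τ t) (mem_univ _)).2.1
  -- The limit geodesic is not constant, because limits of arc curves keep positive energy.
  by_contra! hconst
  obtain ⟨t, ht⟩ := hc.nonempty
  have h2 := hc.energy_eq_zero_of_const (h := h) hconst ht
  rw [hcy t ht] at h2
  exact (hy₀ (τ t) (mem_univ _)).1.1.ne' h2

variable (h) in
/-- If the geodesic segments of `S₀` with endpoints in `K₁` lie in the interior of `K₂`, then for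
the sprays close to `S₀` the segments in `A` with endpoints in `K₀` lie in `K₂`. -/
lemma Spray.IsDisprisoning.exists_segment_subset (hdis : S₀.IsDisprisoning)
    (hS₀ : S₀.IsHomogeneous 2) (hA : IsCompact A) {K₀ K₁ K₂ : Set M} (hK₀ : IsClosed K₀)
    (hK₁ : IsClosed K₁) (h01 : K₀ ⊆ interior K₁) (h12 : K₁ ⊆ K₂)
    (hseg : ∀ (c : ℝ → M) (J : Set ℝ), S₀.IsGeodesicOn c J → ∀ a ∈ J, ∀ b ∈ J, a ≤ b →
      c a ∈ K₁ → c b ∈ K₁ → ∀ t ∈ Icc a b, c t ∈ interior K₂) :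
    ∃ O : FineNhd h S₀, ∀ S : Spray E M, S.IsHomogeneous 2 → O.Contains A S →
      ∀ (y : ℝ → TangentBundle 𝓘(ℝ, E) M) (a b : ℝ),
        (∀ s ∈ Icc a b, S.IsArcCurveAt h y s ∧ (y s).proj ∈ A) →
        (y a).proj ∈ K₀ → (y b).proj ∈ K₀ → ∀ s ∈ Icc a b, (y s).proj ∈ K₂ := by
  -- Bounded length lets the endpoints of the parameter intervals converge.
  obtain ⟨O', L, hL⟩ := hdis.exists_length_le h hS₀ hA
  by_contra! hcon
  -- The parameter `0` is placed at a point outside `K₂`, so that the failure is visible in the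
  -- limit.
  have hcon' : ∀ O : FineNhd h S₀, ∃ (S : Spray E M) (y : ℝ → TangentBundle 𝓘(ℝ, E) M)
      (a b : ℝ), S.IsHomogeneous 2 ∧ O.Contains A S ∧ (0 : ℝ) ∈ Icc a b ∧ b - a ≤ L ∧
      (∀ s ∈ Icc a b, S.IsArcCurveAt h y s ∧ (y s).proj ∈ A) ∧ energy h (y 0) = 1 ∧
      (y a).proj ∈ K₀ ∧ (y b).proj ∈ K₀ ∧ (y 0).proj ∉ K₂ := by
    intro O
    obtain ⟨S, hS, hSO, y, a, b, hy, ha, hb, s, hs, hsK⟩ := hcon (O.inter O')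
    obtain ⟨y', hy', h1, hpr⟩ := exists_normalized_arcCurve hS (s₀ := s) hy hs
    refine ⟨S, y', a - s, b - s, hS, fun u hu huA ↦ (hSO u hu huA).1,
      ⟨by linarith [hs.1], by linarith [hs.2]⟩, ?_, hy', h1, ?_, ?_, ?_⟩
    · rw [sub_sub_sub_cancel_right]
      exact hL S hS (fun u hu huA ↦ (hSO u hu huA).2) y a b (hs.1.trans hs.2) hy
    · rwa [hpr, sub_add_cancel]
    · rwa [hpr, sub_add_cancel]
    · rwa [hpr, zero_add]
  choose S y a b hS hSO h0 hab hy h1 ha hb hmid using hcon'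
  let 𝒰 : Ultrafilter (FineNhd h S₀) := Ultrafilter.of Filter.atBot
  have hl : IsFineLimit h A 𝒰 S S₀ := FineNhd.isFineLimit (O := id) (Ultrafilter.of_le _) hSO
  have hab' : ∀ i, a i ≤ b i := fun i ↦ (h0 i).1.trans (h0 i).2
  have haL : ∀ i, a i ∈ Icc (-L) 0 := fun i ↦ ⟨by linarith [hab i, (h0 i).2], (h0 i).1⟩
  have hbL : ∀ i, b i ∈ Icc 0 L := fun i ↦ ⟨(h0 i).2, by linarith [hab i, (h0 i).1]⟩
  obtain ⟨α, -, hα⟩ := (isCompact_Icc (a := -L) (b := 0)).ultrafilter_le_nhds (𝒰.map a)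
    (Filter.le_principal_iff.2
      (show ∀ᶠ i in 𝒰, a i ∈ Icc (-L) 0 from .of_forall haL))
  obtain ⟨β, -, hβ⟩ := (isCompact_Icc (a := 0) (b := L)).ultrafilter_le_nhds (𝒰.map b)
    (Filter.le_principal_iff.2
      (show ∀ᶠ i in 𝒰, b i ∈ Icc 0 L from .of_forall hbL))
  have hα : Filter.Tendsto a 𝒰 (𝓝 α) := hα
  have hβ : Filter.Tendsto b 𝒰 (𝓝 β) := hβ
  have hpr : Continuous fun v : TangentBundle 𝓘(ℝ, E) M ↦ v.proj :=
    FiberBundle.continuous_proj E (TangentSpace 𝓘(ℝ, E) : M → Type _)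
  -- For a uniform length after the start and before the end the curves remain in `interior K₁`. As
  -- their points at `0` are outside `K₂ ⊇ K₁`, the parameter `0` stays away from both ends, which
  -- gives `α ≤ -τa` and `τb ≤ β`.
  have hend : ∀ s : FineNhd h S₀ → ℝ, (∀ i, s i ∈ Icc (a i) (b i)) → (∀ i, |s i| ≤ L) →
      (∀ i, (y i (s i)).proj ∈ K₀) → ∃ τ > 0, ∀ᶠ i in 𝒰, ∀ t ∈ Icc (a i) (b i), |t - s i| ≤ τ →
        (y i t).proj ∈ interior K₁ := fun s hs hsL hsK ↦ by
    obtain ⟨u, hu, -, he⟩ := hl.exists_tendsto hA hS hy h0 h1 (.of_forall hs) (.of_forall hsL)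
    have huK : u.proj ∈ K₀ := hK₀.mem_of_tendsto ((hpr.tendsto u).comp hu) (.of_forall hsK)
    exact hl.eventually_mem hS hS₀ (.of_forall hy) (.of_forall hs) hu he
      ((isOpen_interior.preimage hpr).mem_nhds (h01 huK))
  obtain ⟨τa, hτa, hea⟩ := hend a (fun i ↦ ⟨le_rfl, hab' i⟩)
    (fun i ↦ abs_le.2 ⟨(haL i).1, by linarith [(haL i).1, (haL i).2]⟩) ha
  obtain ⟨τb, hτb, heb⟩ := hend b (fun i ↦ ⟨hab' i, le_rfl⟩)
    (fun i ↦ abs_le.2 ⟨by linarith [(hbL i).1, (hbL i).2], (hbL i).2⟩) hb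
  have hατ : α ≤ -τa := le_of_tendsto hα (hea.mono fun i hi ↦ by
    by_contra! hlt
    exact hmid i (h12 (interior_subset (hi 0 (h0 i) (by
      rw [zero_sub, abs_neg, abs_of_nonpos (haL i).2]; linarith)))))
  have hβτ : τb ≤ β := ge_of_tendsto hβ (heb.mono fun i hi ↦ by
    by_contra! hlt
    exact hmid i (h12 (interior_subset (hi 0 (h0 i) (by
      rw [zero_sub, abs_neg, abs_of_nonneg (hbL i).1]; linarith)))))
  have hI : ∀ s ∈ Ioo α β, ∀ᶠ i in 𝒰, s ∈ Icc (a i) (b i) := fun s hs ↦ by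
    filter_upwards [hα.eventually_lt_const hs.1, hβ.eventually_const_lt hs.2] with i hi hi'
    exact ⟨hi.le, hi'.le⟩
  obtain ⟨y₀, hy₀⟩ := hl.exists_limit_curve hA hS hS₀ hy h0 h1 isOpen_Ioo hI
  -- The limit curve is only known on the open interval, so its segment is taken between two inner
  -- parameters. Its endpoints lie in `K₁` rather than `K₀`, which is the reason for enlarging `K₀`.
  have hs1 : α + τa / 2 ∈ Ioo α β := ⟨by linarith, by linarith⟩
  have hs2 : β - τb / 2 ∈ Ioo α β := ⟨by linarith, by linarith⟩
  have h00 : (0 : ℝ) ∈ Ioo α β := ⟨by linarith, by linarith⟩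
  have hK1 : (y₀ (α + τa / 2)).proj ∈ K₁ := by
    refine hK₁.mem_of_tendsto ((hpr.tendsto _).comp (hy₀ _ hs1).2.2) ?_
    filter_upwards [hea, hI _ hs1, hα.eventually (Metric.ball_mem_nhds α (half_pos hτa))]
      with i hi hi' hi''
    refine interior_subset (hi _ hi' (abs_le.2 ?_))
    have := abs_lt.1 (Real.dist_eq _ _ ▸ Metric.mem_ball.1 hi'')
    constructor <;> linarith
  have hK2 : (y₀ (β - τb / 2)).proj ∈ K₁ := by
    refine hK₁.mem_of_tendsto ((hpr.tendsto _).comp (hy₀ _ hs2).2.2) ?_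
    filter_upwards [heb, hI _ hs2, hβ.eventually (Metric.ball_mem_nhds β (half_pos hτb))]
      with i hi hi' hi''
    refine interior_subset (hi _ hi' (abs_le.2 ?_))
    have := abs_lt.1 (Real.dist_eq _ _ ▸ Metric.mem_ball.1 hi'')
    constructor <;> linarith
  obtain ⟨J, σ, τ, hr, hc, -⟩ := S₀.exists_geodesic_of_arcCurve isOpen_Ioo ordConnected_Ioo
    (fun s hs ↦ (hy₀ s hs).1) h00
  have h2 := hseg _ J hc _ (hr.mapsTo hs1) _ (hr.mapsTo hs2)
    (hr.strictMonoOn.monotoneOn hs1 hs2 (by linarith))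
    (by simpa only [hr.left_inv _ hs1] using hK1) (by simpa only [hr.left_inv _ hs2] using hK2)
    (σ 0) ⟨hr.strictMonoOn.monotoneOn hs1 h00 (by linarith),
      hr.strictMonoOn.monotoneOn h00 hs2 (by linarith)⟩
  simp only [hr.left_inv _ h00] at h2
  have h3 := ((hpr.tendsto _).comp (hy₀ 0 h00).2.2).eventually (isOpen_interior.mem_nhds h2)
  obtain ⟨i, hi⟩ := h3.exists
  exact hmid i (interior_subset hi)

end
end

/-! ### Topological preliminaries on exhaustions and excursions. -/

noncomputable section

section topology
variable {X : Type*} [TopologicalSpace X]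

/-- A connected, locally compact and paracompact Hausdorff space is σ-compact. -/
lemma sigmaCompactSpace_of_paracompact [T2Space X] [LocallyCompactSpace X] [ParacompactSpace X]
    [ConnectedSpace X] : SigmaCompactSpace X := by
  choose u hu hxu using fun x : X ↦ exists_compact_mem_nhds x
  obtain ⟨s, hso, hsc, hsf, hsu⟩ := precise_refinement (fun x ↦ interior (u x))
    (fun x ↦ isOpen_interior) (eq_univ_of_forall fun x ↦
      mem_iUnion.2 ⟨x, mem_interior_iff_mem_nhds.2 (hxu x)⟩)
  -- A compact set meets finitely many members of the locally finite refinement, and each is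
  -- contained in a compact set. Iterating from a point gives an increasing chain of neighbours
  -- whose union is clopen, hence everything.
  have hstep : ∀ C : {C : Set X // IsCompact C}, ∃ C' : {C : Set X // IsCompact C},
      ∀ a, (s a ∩ C.1).Nonempty → s a ⊆ C'.1 := fun C ↦ by
    have hfin := hsf.finite_nonempty_inter_compact C.2
    exact ⟨⟨⋃ a ∈ {a | (s a ∩ C.1).Nonempty}, u a, hfin.isCompact_biUnion fun a _ ↦ hu a⟩,
      fun a ha ↦ ((hsu a).trans interior_subset).trans
        (subset_biUnion_of_mem (u := u) (show a ∈ {a | (s a ∩ C.1).Nonempty} from ha))⟩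
  choose F hF using hstep
  obtain ⟨x₀⟩ := (inferInstance : Nonempty X)
  let C : ℕ → {C : Set X // IsCompact C} := fun n ↦
    Nat.rec ⟨{x₀}, isCompact_singleton⟩ (fun _ C ↦ F C) n
  have hC : ∀ n a, (s a ∩ (C n).1).Nonempty → s a ⊆ (C (n + 1)).1 := fun n ↦ hF (C n)
  have hcov : ∀ x, ∃ a, x ∈ s a := fun x ↦ mem_iUnion.1 (hsc ▸ mem_univ x)
  have hclopen : IsClopen (⋃ n, (C n).1) := by
    constructor
    · refine isClosed_of_closure_subset fun x hx ↦ ?_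
      obtain ⟨a, ha⟩ := hcov x
      obtain ⟨z, hz, hzC⟩ := mem_closure_iff.1 hx (s a) (hso a) ha
      obtain ⟨n, hn⟩ := mem_iUnion.1 hzC
      exact mem_iUnion.2 ⟨n + 1, hC n a ⟨z, hz, hn⟩ ha⟩
    · refine isOpen_iff_mem_nhds.2 fun x hx ↦ ?_
      obtain ⟨n, hn⟩ := mem_iUnion.1 hx
      obtain ⟨a, ha⟩ := hcov x
      exact Filter.mem_of_superset ((hso a).mem_nhds ha)
        ((hC n a ⟨x, ha, hn⟩).trans (subset_iUnion (fun n ↦ (C n).1) (n + 1)))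
  refine SigmaCompactSpace_iff_exists_compact_covering.2 ⟨fun n ↦ (C n).1, fun n ↦ (C n).2, ?_⟩
  exact hclopen.eq_univ ⟨x₀, mem_iUnion.2 ⟨0, mem_singleton x₀⟩⟩

/-- A curve which leaves a closed set and returns to it has a subsegment outside its interior. -/
lemma exists_excursion {f : ℝ → X} {a b s : ℝ} (hf : ContinuousOn f (Icc a b)) {C : Set X}
    (hC : IsClosed C) (ha : f a ∈ C) (hb : f b ∈ C) (hs : s ∈ Icc a b) (hsC : f s ∉ C) :
    ∃ a' b', a ≤ a' ∧ a' ≤ s ∧ s ≤ b' ∧ b' ≤ b ∧ f a' ∈ C ∧ f b' ∈ C ∧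
      ∀ t ∈ Icc a' b', f t ∉ interior C := by
  have hl : IsCompact (Icc a s ∩ f ⁻¹' C) := isCompact_Icc.of_isClosed_subset
    ((hf.mono (Icc_subset_Icc_right hs.2)).preimage_isClosed_of_isClosed isClosed_Icc hC)
    inter_subset_left
  have hr : IsCompact (Icc s b ∩ f ⁻¹' C) := isCompact_Icc.of_isClosed_subset
    ((hf.mono (Icc_subset_Icc_left hs.1)).preimage_isClosed_of_isClosed isClosed_Icc hC)
    inter_subset_left
  -- The excursion runs from the last visit to `C` before `s` to the first one after it. Even these
  -- two points are outside the interior, since an interior point would have a point of `C` nearer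
  -- to `s`.
  obtain ⟨a', ⟨ha's, ha'C⟩, ha'⟩ := hl.exists_isGreatest ⟨a, ⟨le_rfl, hs.1⟩, ha⟩
  obtain ⟨b', ⟨hb's, hb'C⟩, hb'⟩ := hr.exists_isLeast ⟨b, ⟨hs.2, le_rfl⟩, hb⟩
  refine ⟨a', b', ha's.1, ha's.2, hb's.1, hb's.2, ha'C, hb'C, fun t ht htC ↦ ?_⟩
  have hts : t ≠ s := fun e ↦ hsC (interior_subset (e ▸ htC))
  have hmem : t ∈ Icc a b := ⟨ha's.1.trans ht.1, ht.2.trans hb's.2⟩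
  have hnear : ∀ᶠ r in 𝓝[Icc a b] t, f r ∈ interior C :=
    (hf t hmem).eventually (isOpen_interior.mem_nhds htC)
  rcases lt_or_gt_of_ne hts with hlt | hlt
  · have h1 : ∀ᶠ r in 𝓝[>] t, r ∈ Ioo t s := Ioo_mem_nhdsGT hlt
    have h2 : 𝓝[Ioo t s] t ≤ 𝓝[Icc a b] t :=
      nhdsWithin_mono _ fun r hr ↦ ⟨hmem.1.trans hr.1.le, hr.2.le.trans hs.2⟩
    rw [← nhdsWithin_Ioo_eq_nhdsGT hlt] at h1
    have : (𝓝[Ioo t s] t).NeBot := by rw [nhdsWithin_Ioo_eq_nhdsGT hlt]; infer_instance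
    obtain ⟨r, hr, hrC⟩ := (h1.and (h2 hnear)).exists
    exact (ha' ⟨⟨hmem.1.trans hr.1.le, hr.2.le⟩, (interior_subset (s := C) hrC :)⟩).not_gt
      (ht.1.trans_lt hr.1)
  · have h1 : ∀ᶠ r in 𝓝[<] t, r ∈ Ioo s t := Ioo_mem_nhdsLT hlt
    have h2 : 𝓝[Ioo s t] t ≤ 𝓝[Icc a b] t :=
      nhdsWithin_mono _ fun r hr ↦ ⟨hs.1.trans hr.1.le, hr.2.le.trans hmem.2⟩
    rw [← nhdsWithin_Ioo_eq_nhdsLT hlt] at h1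
    have : (𝓝[Ioo s t] t).NeBot := by rw [nhdsWithin_Ioo_eq_nhdsLT hlt]; infer_instance
    obtain ⟨r, hr, hrC⟩ := (h1.and (h2 hnear)).exists
    exact (hb' ⟨⟨hr.1.le, hr.2.le.trans hmem.2⟩, (interior_subset (s := C) hrC :)⟩).not_gt
      (hr.2.trans_le ht.2)

/-- The open set `interior (K n)` can only meet the shells of index less than `n`. -/
lemma CompactExhaustion.locallyFinite_shell (K : CompactExhaustion X) (k : ℕ) :
    LocallyFinite fun m ↦ K (m + k) \ interior (K m) := fun x ↦ by
  obtain ⟨n, hn⟩ := K.exists_mem_nhds x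
  refine ⟨interior (K n), interior_mem_nhds.2 hn, (finite_Iio n).subset ?_⟩
  rintro m ⟨z, hz, hzn⟩
  by_contra hm
  exact hz.2 (interior_mono (K.subset (not_lt.1 hm)) hzn)

end topology

/-! ### Descent through the shells of a convex exhaustion. -/

variable {E : Type*} [NormedAddCommGroup E] [NormedSpace ℝ E]
  {M : Type*} [TopologicalSpace M] [ChartedSpace E M] [IsManifold 𝓘(ℝ, E) ∞ M]

namespace Spray
variable {S S₀ : Spray E M}
variable {h : ContMDiffRiemannianMetric 𝓘(ℝ, E) ∞ E (fun x : M ↦ TangentSpace 𝓘(ℝ, E) x)}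

/-- The geodesic segments with endpoints in the `n`-th term of the exhaustion lie in the interior of
the next term. -/
def IsConvexExhaustion (S : Spray E M) (K : CompactExhaustion M) : Prop :=
  ∀ (n : ℕ) (c : ℝ → M) (J : Set ℝ), S.IsGeodesicOn c J → ∀ a ∈ J, ∀ b ∈ J, a ≤ b →
    c a ∈ K n → c b ∈ K n → ∀ t ∈ Icc a b, c t ∈ interior (K (n + 1))

/-- Each term is chosen to contain in its interior the previous one, a member of a compact covering,
and all segments with endpoints in these. Shifting the index by `k` prepends empty terms, at which
the later descent terminates. -/
lemma IsPseudoconvex.exists_isConvexExhaustion [LocallyCompactSpace M] [SigmaCompactSpace M]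
    (hpc : S.IsPseudoconvex) (k : ℕ) :
    ∃ K : CompactExhaustion M, K k = ∅ ∧ S.IsConvexExhaustion K := by
  have hstep : ∀ C : {C : Set M // IsCompact C}, ∃ C' : {C : Set M // IsCompact C},
      C.1 ⊆ interior C'.1 ∧ ∀ (c : ℝ → M) (J : Set ℝ), S.IsGeodesicOn c J → ∀ a ∈ J, ∀ b ∈ J,
        a ≤ b → c a ∈ C.1 → c b ∈ C.1 → ∀ t ∈ Icc a b, c t ∈ interior C'.1 := fun C ↦ by
    obtain ⟨C₁, hC₁, hseg⟩ := hpc C.1 C.2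
    obtain ⟨C', hC', hsub⟩ := exists_compact_superset (C.2.union hC₁)
    exact ⟨⟨C', hC'⟩, subset_union_left.trans hsub, fun c J hc a ha b hb hab hca hcb t ht ↦
      hsub (Or.inr (hseg c J hc a ha b hb hab hca hcb t ht))⟩
  choose F hF hFseg using hstep
  let D : ℕ → {C : Set M // IsCompact C} := fun n ↦ Nat.rec ⟨∅, isCompact_empty⟩
    (fun n C ↦ F ⟨C.1 ∪ compactCovering M n, C.2.union (isCompact_compactCovering M n)⟩) n
  have hD : ∀ n, (D n).1 ∪ compactCovering M n ⊆ interior (D (n + 1)).1 := fun n ↦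
    hF ⟨(D n).1 ∪ compactCovering M n, (D n).2.union (isCompact_compactCovering M n)⟩
  -- The subtraction is truncated: for `n ≤ k` the term is `D 0 = ∅` and there is nothing to show.
  have hcases : ∀ n, (D (n - k)).1 = ∅ ∨ n + 1 - k = n - k + 1 := fun n ↦ by
    rcases le_or_gt n k with hn | hn
    · rw [Nat.sub_eq_zero_of_le hn]
      exact Or.inl rfl
    · exact Or.inr (by omega)
  refine ⟨⟨fun n ↦ (D (n - k)).1, fun n ↦ (D _).2, fun n ↦ ?_, ?_⟩, ?_,
    fun n c J hc a ha b hb hab hca hcb t ht ↦ ?_⟩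
  · rcases hcases n with e | e
    · rw [e]
      exact empty_subset _
    · rw [e]
      exact subset_union_left.trans (hD _)
  · refine eq_univ_of_forall fun x ↦ ?_
    obtain ⟨n, hn⟩ := exists_mem_compactCovering x
    refine mem_iUnion.2 ⟨n + 1 + k, ?_⟩
    rw [Nat.add_sub_cancel]
    exact interior_subset (hD n (Or.inr hn))
  · change (D (k - k)).1 = ∅
    rw [Nat.sub_self]
    rfl
  · change c a ∈ (D (n - k)).1 at hca
    change c b ∈ (D (n - k)).1 at hcb
    change c t ∈ interior (D (n + 1 - k)).1
    rcases hcases n with e | e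
    · rw [e] at hca
      exact absurd hca (notMem_empty _)
    · rw [e]
      exact hFseg ⟨(D (n - k)).1 ∪ compactCovering M (n - k), _⟩ c J hc a ha b hb hab
        (Or.inl hca) (Or.inl hcb) t ht

variable (h) in
/-- The arc curves of `S` in a shell of the exhaustion have bounded length. -/
def HasBoundedShellLength (S : Spray E M) (K : CompactExhaustion M) : Prop :=
  ∀ m, ∃ L : ℝ, ∀ (y : ℝ → TangentBundle 𝓘(ℝ, E) M) (a b : ℝ), a ≤ b →
    (∀ s ∈ Icc a b, S.IsArcCurveAt h y s ∧ (y s).proj ∈ K (m + 3) \ interior (K m)) → b - a ≤ L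

variable (h) in
/-- The arc curves of `S` in a shell of the exhaustion with endpoints in `K m` lie in
`K (m + 2)`. -/
def HasConvexShells (S : Spray E M) (K : CompactExhaustion M) : Prop :=
  ∀ (m : ℕ) (y : ℝ → TangentBundle 𝓘(ℝ, E) M) (a b : ℝ),
    (∀ s ∈ Icc a b, S.IsArcCurveAt h y s ∧ (y s).proj ∈ K (m + 3) \ interior (K m)) →
    (y a).proj ∈ K m → (y b).proj ∈ K m → ∀ s ∈ Icc a b, (y s).proj ∈ K (m + 2)

variable (h) in
/-- The sprays close to a disprisoning spray have shells like it. -/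
lemma IsDisprisoning.exists_fineNhd [FiniteDimensional ℝ E] [T2Space M]
    (hdis : S₀.IsDisprisoning) (hS₀ : S₀.IsHomogeneous 2) {K : CompactExhaustion M}
    (hK : S₀.IsConvexExhaustion K) :
    ∃ O : FineNhd h S₀, ∀ S : Spray E M, S.IsHomogeneous 2 →
      (∀ u ∈ unitSphereBundle h, S.total u ∈ O.1) →
      S.HasBoundedShellLength h K ∧ S.HasConvexShells h K := by
  let A : ℕ → Set M := fun m ↦ K (m + 3) \ interior (K m)
  have hA : ∀ m, IsCompact (A m) := fun m ↦ (K.isCompact _).diff isOpen_interior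
  choose O₁ L hO₁ using fun m ↦ hdis.exists_length_le h hS₀ (hA m)
  choose O₂ hO₂ using fun m ↦ hdis.exists_segment_subset h hS₀ (hA m) (K.isCompact m).isClosed
    (K.isCompact (m + 1)).isClosed (K.subset_interior_succ m) (K.subset_succ (m + 1)) (hK (m + 1))
  have hpr : Continuous fun ξ : TangentBundle 𝓘(ℝ, E).tangent (TangentBundle 𝓘(ℝ, E) M) ↦
    ξ.proj.proj := (FiberBundle.continuous_proj E (TangentSpace 𝓘(ℝ, E))).comp
      (FiberBundle.continuous_proj (E × E) (TangentSpace 𝓘(ℝ, E).tangent))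
  -- The forbidden vectors above the `m`-th shell. Local finiteness of the shells makes their union
  -- closed, so its complement is one open set imposing all the conditions.
  let Z : ℕ → Set (TangentBundle 𝓘(ℝ, E).tangent (TangentBundle 𝓘(ℝ, E) M)) := fun m ↦
    {ξ | ξ.proj.proj ∈ A m} ∩ ((O₁ m).inter (O₂ m)).1ᶜ
  have hZ : IsClosed (⋃ m, Z m) := by
    refine LocallyFinite.isClosed_iUnion
      (((K.locallyFinite_shell 3).preimage_continuous hpr).subset fun m ↦ inter_subset_left)
      fun m ↦ ((hA m).isClosed.preimage hpr).inter ((O₁ m).inter (O₂ m)).2.1.isClosed_compl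
  have hsub : ∀ m (S : Spray E M), (∀ u ∈ unitSphereBundle h, S.total u ∈ (⋃ m, Z m)ᶜ) →
      ∀ u ∈ unitSphereBundle h, u.proj ∈ A m → S.total u ∈ ((O₁ m).inter (O₂ m)).1 := by
    intro m S hS u hu huA
    by_contra hcon
    exact hS u hu (mem_iUnion.2 ⟨m, huA, hcon⟩)
  refine ⟨⟨(⋃ m, Z m)ᶜ, hZ.isOpen_compl, fun u hu hcon ↦ ?_⟩,
    fun S hS hSO ↦ ⟨fun m ↦ ?_, fun m ↦ ?_⟩⟩
  · obtain ⟨m, hm⟩ := mem_iUnion.1 hcon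
    exact hm.2 (((O₁ m).inter (O₂ m)).2.2 u hu)
  · exact ⟨L m, hO₁ m S hS fun u hu huA ↦ (hsub m S hSO u hu huA).1⟩
  · exact hO₂ m S hS fun u hu huA ↦ (hsub m S hSO u hu huA).2

section
variable [T2Space M] {K : CompactExhaustion M}

omit [T2Space M] in
lemma continuousOn_proj_of_isArcCurveAt {y : ℝ → TangentBundle 𝓘(ℝ, E) M} {I : Set ℝ}
    (hy : ∀ s ∈ I, S.IsArcCurveAt h y s) : ContinuousOn (fun s ↦ (y s).proj) I :=
  (FiberBundle.continuous_proj E (TangentSpace 𝓘(ℝ, E) : M → Type _)).comp_continuousOn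
    fun s hs ↦ (hy s hs).continuousAt.continuousWithinAt

/-- A point outside `K (m + 2)` would lie on an excursion from `K m`; this excursion is contained in
the shell, where the hypothesis excludes such a point. -/
lemma HasConvexShells.mem_of_forall_mem_add_three (hB : S.HasConvexShells h K) {m : ℕ}
    {y : ℝ → TangentBundle 𝓘(ℝ, E) M} {a b : ℝ} (hy : ∀ s ∈ Icc a b, S.IsArcCurveAt h y s)
    (hyK : ∀ s ∈ Icc a b, (y s).proj ∈ K (m + 3)) (ha : (y a).proj ∈ K m)
    (hb : (y b).proj ∈ K m) : ∀ s ∈ Icc a b, (y s).proj ∈ K (m + 2) := by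
  intro s hs
  by_contra hcon
  obtain ⟨a', b', h1, h2, h3, h4, h5, h6, h7⟩ := exists_excursion
    (continuousOn_proj_of_isArcCurveAt hy) (K.isCompact m).isClosed ha hb hs
    fun hm ↦ hcon (K.subset (by omega) hm)
  have hsub : Icc a' b' ⊆ Icc a b := Icc_subset_Icc h1 h4
  exact hcon (hB m y a' b' (fun t ht ↦ ⟨hy t (hsub ht), hyK t (hsub ht), h7 t ht⟩) h5 h6 s ⟨h2, h3⟩)

/-- Descending induction: as long as `j` exceeds `n + 2`, the endpoints lie in `K (j - 3)` and the
previous lemma lowers `j` by one. The result no longer depends on `j`, which is what gives a compact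
set common to all segments. -/
lemma HasConvexShells.mem_add_two (hB : S.HasConvexShells h K) {n j : ℕ}
    {y : ℝ → TangentBundle 𝓘(ℝ, E) M} {a b : ℝ} (hy : ∀ s ∈ Icc a b, S.IsArcCurveAt h y s)
    (hyK : ∀ s ∈ Icc a b, (y s).proj ∈ K j) (ha : (y a).proj ∈ K n)
    (hb : (y b).proj ∈ K n) : ∀ s ∈ Icc a b, (y s).proj ∈ K (n + 2) := by
  induction j with
  | zero => exact fun s hs ↦ K.subset (Nat.zero_le _) (hyK s hs)
  | succ j ih =>
    rcases le_or_gt (j + 1) (n + 2) with hj | hj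
    · exact fun s hs ↦ K.subset hj (hyK s hs)
    · obtain ⟨m, rfl⟩ : ∃ m, j = m + 2 := ⟨j - 2, by omega⟩
      have hnm : K n ⊆ K m := K.subset (by omega)
      exact ih (hB.mem_of_forall_mem_add_three hy hyK (hnm ha) (hnm hb))

lemma HasConvexShells.isPseudoconvex [FiniteDimensional ℝ E] (hB : S.HasConvexShells h K)
    (hS : S.IsHomogeneous 2) : S.IsPseudoconvex := by
  intro C hC
  obtain ⟨n, hn⟩ := K.exists_superset_of_isCompact hC
  refine ⟨K (n + 2), K.isCompact _, fun c J hc a ha b hb hab hca hcb t ht ↦ ?_⟩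
  have hIJ : Icc a b ⊆ J := hc.ordConnected.out ha hb
  -- Constant geodesics have no arc length parameter; a point different from `c a` guarantees a
  -- nonvanishing velocity.
  by_cases hconst : c t = c a
  · exact hconst ▸ K.subset (by omega) (hn hca)
  have hpos := hc.energy_pos (h := h) hS (hIJ ht) ha hconst
  obtain ⟨I, σ, τ, hr, -, hy⟩ := hc.exists_arcCurve hpos ha
  obtain ⟨j, hj⟩ := K.exists_superset_of_isCompact
    (isCompact_Icc.image_of_continuousOn (hc.continuousOn.mono hIJ))
  have hI : Icc (σ a) (σ b) ⊆ I := hr.ordConnected.out (hr.mapsTo ha) (hr.mapsTo hb)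
  have hτ : ∀ s ∈ Icc (σ a) (σ b), τ s ∈ Icc a b := fun s hs ↦ by
    have h1 := hr.strictMonoOn_symm.monotoneOn (hr.mapsTo ha) (hI hs) hs.1
    have h2 := hr.strictMonoOn_symm.monotoneOn (hI hs) (hr.mapsTo hb) hs.2
    rw [hr.left_inv a ha] at h1
    rw [hr.left_inv b hb] at h2
    exact ⟨h1, h2⟩
  have key := hB.mem_add_two (n := n) (j := j) (fun s hs ↦ hy s (hI hs))
    (fun s hs ↦ hj (mem_image_of_mem c (hτ s hs)))
    (by simpa only [curveLift, hr.left_inv a ha] using hn hca)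
    (by simpa only [curveLift, hr.left_inv b hb] using hn hcb) (σ t)
    ⟨hr.strictMonoOn.monotoneOn ha (hIJ ht) ht.1, hr.strictMonoOn.monotoneOn (hIJ ht) hb ht.2⟩
  simpa only [curveLift, hr.left_inv t (hIJ ht)] using key

/-- A nonconstant geodesic trapped in a compact set has infinite forward length. If it is finally in
some `K j`, the shell conditions force it finally into smaller and smaller terms, down to the empty
`K 2`. -/
lemma HasConvexShells.isDisprisoning [FiniteDimensional ℝ E] (hB : S.HasConvexShells h K)
    (hA : S.HasBoundedShellLength h K) (hK2 : K 2 = ∅) (hS : S.IsHomogeneous 2) :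
    S.IsDisprisoning := by
  rintro c J hin ⟨t₀, ht₀, t₁, ht₁, hne⟩ C hC hmaps
  obtain ⟨I, σ, τ, hr, -, hy⟩ := hin.1.exists_arcCurve (h := h)
    (hin.1.energy_pos hS ht₀ ht₁ hne) ht₀
  have hunb := hin.not_bddAbove hS hr hy hC hmaps
  set y := fun s ↦ curveLift E c (τ s)
  have hI : Ici (σ t₀) ⊆ I := fun s hs ↦ by
    obtain ⟨r, hrI, hsr⟩ := not_bddAbove_iff.1 hunb s
    exact hr.ordConnected.out (hr.mapsTo ht₀) hrI ⟨hs, hsr.le⟩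
  obtain ⟨n, hn⟩ := K.exists_superset_of_isCompact hC
  have key : ∀ j, ¬ ∃ T ≥ σ t₀, ∀ s ≥ T, (y s).proj ∈ K j := fun j ↦ by
    have hsmall : ∀ i ≤ 2, ¬ ∃ T ≥ σ t₀, ∀ s ≥ T, (y s).proj ∈ K i := by
      rintro i hi ⟨T, -, hT⟩
      exact notMem_empty _ (hK2 ▸ K.subset hi (hT T le_rfl))
    induction j with
    | zero => exact hsmall 0 (by omega)
    | succ j ih =>
      rcases le_or_gt (j + 1) 2 with hj | hj
      · exact hsmall _ hj
      obtain ⟨m, rfl⟩ : ∃ m, j = m + 2 := ⟨j - 2, by omega⟩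
      rintro ⟨T, hT₀, hT⟩
      -- Either the curve finally avoids `K m` and has infinite length in one shell, or it returns
      -- to `K m` arbitrarily late and each piece between returns lies in `K (m + 2)`.
      by_cases hm : ∃ T', ∀ s ≥ T', (y s).proj ∉ K m
      · obtain ⟨T', hT'⟩ := hm
        obtain ⟨L, hL⟩ := hA m
        have := hL y (max T T') (max T T' + (|L| + 1)) (by linarith [abs_nonneg L]) fun s hs ↦
          ⟨hy s (hI (hT₀.trans ((le_max_left _ _).trans hs.1))),
            hT s ((le_max_left _ _).trans hs.1),
            fun hs' ↦ hT' s ((le_max_right _ _).trans hs.1) (interior_subset hs')⟩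
        linarith [le_abs_self L]
      · push Not at hm
        obtain ⟨T₁, hT₁, hT₁K⟩ := hm T
        refine ih ⟨T₁, hT₀.trans hT₁, fun s hs ↦ ?_⟩
        obtain ⟨b, hb, hbK⟩ := hm s
        exact hB.mem_of_forall_mem_add_three (a := T₁) (b := b)
          (fun r hr ↦ hy r (hI (hT₀.trans (hT₁.trans hr.1)))) (fun r hr ↦ hT r (hT₁.trans hr.1))
          hT₁K hbK s ⟨hs, hb⟩
  exact key n ⟨σ t₀, le_rfl, fun s hs ↦ hn (hmaps (hr.mapsTo_symm (hI hs)))⟩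

end

/-! ### Uniqueness of the degree, the weak topology and the conclusion. -/

/-- A spray on a manifold of positive dimension is homogeneous of at most one degree. -/
lemma IsHomogeneous.unique [Nontrivial E] [Nonempty M] {m n : ℝ} (hm : S.IsHomogeneous m)
    (hn : S.IsHomogeneous n) : m = n := by
  by_contra hne
  obtain ⟨e, he⟩ := exists_ne (0 : E)
  obtain ⟨x⟩ := ‹Nonempty M›
  let v : TangentBundle 𝓘(ℝ, E) M := ⟨x, e⟩
  have h1 : (m - 1) • S.toFun v = (n - 1) • S.toFun v := (hm.2 v).symm.trans (hn.2 v)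
  have h2 : S.toFun v = 0 := by
    have h3 : ((m - 1) - (n - 1)) • S.toFun v = 0 := by rw [sub_smul, h1, sub_self]
    exact (smul_eq_zero.1 h3).resolve_left fun h4 ↦ hne (by linarith)
  have h5 := S.second_order v
  rw [h2, map_zero] at h5
  exact he h5.symm

end Spray

/-- In degree `n` the trace is a generator of the fine topology; in every other degree it is empty
by uniqueness of the degree. -/
lemma isOpen_fineTopology [Nontrivial E] [Nonempty M]
    (h : ContMDiffRiemannianMetric 𝓘(ℝ, E) ∞ E (fun x : M ↦ TangentSpace 𝓘(ℝ, E) x)) (n : ℝ)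
    {O : Set (TangentBundle 𝓘(ℝ, E).tangent (TangentBundle 𝓘(ℝ, E) M))} (hO : IsOpen O) :
    IsOpen[fineTopology h] {S : HomogeneousSpray E M |
      S.1.IsHomogeneous n ∧ ∀ u ∈ unitSphereBundle h, S.1.total u ∈ O} := by
  refine isOpen_iSup_iff.2 fun m ↦ isOpen_coinduced.2 ?_
  by_cases hmn : m = n
  · subst hmn
    refine TopologicalSpace.GenerateOpen.basic _ ⟨O, hO, ?_⟩
    ext S
    exact ⟨fun hS ↦ hS.2, fun hS ↦ ⟨S.2, hS⟩⟩
  · convert isOpen_empty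
    refine eq_empty_of_forall_notMem fun S hS ↦ hmn ?_
    exact Spray.IsHomogeneous.unique S.2 hS.1

end

theorem mainTheorem8 {E : Type*} [NormedAddCommGroup E] [NormedSpace ℝ E] [FiniteDimensional ℝ E]
    {M : Type*} [TopologicalSpace M] [ChartedSpace E M] [IsManifold 𝓘(ℝ, E) ∞ M]
    [T2Space M] [ParacompactSpace M] [ConnectedSpace M]
    (g : PseudoRiemannianMetric E M)
    (hpc : g.geodesicSpray.IsPseudoconvex) (hdis : g.geodesicSpray.IsDisprisoning)
    (h : ContMDiffRiemannianMetric 𝓘(ℝ, E) ∞ E (fun x : M ↦ TangentSpace 𝓘(ℝ, E) x)) :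
    ∃ W : Set (HomogeneousSpray E M), IsOpen[fineTopology h] W ∧
      g.geodesicHomogeneousSpray ∈ W ∧
      ∀ S ∈ W, S.1.IsPseudoconvex ∧ S.1.IsDisprisoning := by
  -- In dimension zero the degree is not determined by the spray, but then `M` is a single point and
  -- both properties hold for every spray.
  rcases subsingleton_or_nontrivial E with hE | hE
  · have : DiscreteTopology M := ChartedSpace.discreteTopology E M
    have hM : Subsingleton M := subsingleton_of_preconnected_totallyDisconnected
    exact ⟨univ, @isOpen_univ _ (fineTopology h), mem_univ _, fun S _ ↦
      ⟨fun K _ ↦ ⟨univ, (finite_univ).isCompact, fun _ _ _ _ _ _ _ _ _ _ _ _ ↦ mem_univ _⟩,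
        fun c J _ ⟨s, _, t, _, hst⟩ ↦ absurd (Subsingleton.elim _ _) hst⟩⟩
  have : LocallyCompactSpace M := Manifold.locallyCompact_of_finiteDimensional 𝓘(ℝ, E)
  have : SigmaCompactSpace M := sigmaCompactSpace_of_paracompact
  have hg := g.geodesicSpray_isHomogeneous
  obtain ⟨K, hK2, hK⟩ := hpc.exists_isConvexExhaustion 2
  obtain ⟨O, hO⟩ := hdis.exists_fineNhd h hg hK
  refine ⟨_, isOpen_fineTopology h 2 O.2.1, ⟨hg, O.2.2⟩, fun S hS ↦ ?_⟩
  obtain ⟨hA, hB⟩ := hO S.1 hS.1 hS.2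
  exact ⟨hB.isPseudoconvex hS.1, hB.isDisprisoning hA hK2 hS.1⟩
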